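/- Let $(\mathbf M,\otimes,I,\tau)$ be a complete and cocomplete closed symmetric monoidal category, with symmetric braiding $\tau$. **Orthogonal categories.** An orthogonal category $\overline{\mathbf C}=(\mathbf C,\perp)$ is a small category $\mathbf C$ with a set $\perp$ of pairs $(f_1,f_2)$ of morphisms with a common target such that $f_1\perp f_2$ implies $f_2\perp f_1$, $gf_1\perp gf_2$ and $f_1h_1\perp f_2h_2$ for all composable $g,h_1,h_2$. A morphism $\overline{\mathbf C}\to\overline{\mathbf D}$ in $\mathbf{OrthCat}$ (an orthogonal functor) is a functor $F:\mathbf C\to\mathbf D$ such that $f_1\perp f_2$ implies $F(f_1)\perp F(f_2)$. **The operad $\mathcal O_{\overline{\mathbf C}}$.** Its colors are the objects of $\mathbf C$. For objects $t$ and $\underline c=(c_1,\dots,c_n)$, $n\ge 0$, let $$\mathcal O_{\mathbf C}\big(\substack{t\\ \underline c}\big)=\Sigma_n\times\prod_{i=1}^n\mathbf C(c_i,t).$$ A permutation $\sigma'\in\Sigma_n$ acts by $(\sigma,\underline f)\mapsto(\sigma\sigma',\underline f\sigma')\in\mathcal O_{\mathbf C}\big(\substack{t\\ \underline c\sigma'}\big)$,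 where $\underline c\sigma'=(c_{\sigma'(1)},\dots,c_{\sigma'(n)})$ and $\underline f\sigma'=(f_{\sigma'(1)},\dots,f_{\sigma'(n)})$. The unit is $(e,\mathrm{id}_t)$. The composition of $(\sigma,\underline f)$ with $(\sigma_i,\underline g_i)$, $\underline g_i=(g_{i1},\dots,g_{ik_i})$, $i=1,\dots,m$, has as its morphisms the composites $f_ig_{ij}$, and as its permutation the one that sends the $j$-th entry of the $i$-th block to the $\sigma_i(j)$-th entry of the $\sigma(i)$-th block, where the blocks of the source have the sizes $k_1,\dots,k_m$ and those of the target the sizes $k_{\sigma^{-1}(1)},\dots,k_{\sigma^{-1}(m)}$. Let $(\sigma,\underline f)\sim_\perp(\sigma',\underline f')$ if $\underline f=\underline f'$ and $\underline f\sigma'^{-1}$ is reached from $\underline f\sigma^{-1}$ by $\sigma\sigma'^{-1}=\tau_1\cdots\tau_N$, where each $\tau_k$ transposes two adjacent entries of the sequence $\underline f\sigma^{-1}\tau_1\cdots\tau_{k-1}$ that are orthogonal to each other. The quotients $\mathcal O_{\mathbf C}\big(\substack{t\\ \underline c}\big)/{\sim_\perp}$ form a colored operad in sets, and $\mathcal O_{\overline{\mathbf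 C}}$ denotes the $\mathbf M$-valued colored operad which is obtained from it by replacing each set $S$ of operations by the coproduct $\coprod_{s\in S}I$. An orthogonal functor $F$ induces a morphism of colored operads $\mathcal O_{\overline{\mathbf C}}\to\mathcal O_{\overline{\mathbf D}}$, given by $F$ on colors and by $[\sigma,\underline f]\mapsto[\sigma,F(\underline f)]$ on operations. **Algebras.** An algebra over an $\mathbf M$-valued colored operad $\mathcal O$ consists of an object $A_t\in\mathbf M$ for each color $t$ and of morphisms $\mathcal O\big(\substack{t\\ \underline a}\big)\otimes A_{a_1}\otimes\cdots\otimes A_{a_n}\to A_t$ which are equivariant under permutations and compatible with the operadic compositions and units. A morphism of algebras is a family of morphisms $A_t\to B_t$ compatible with these structure maps. Let $\mathbf{Alg}(\mathcal O)$ be the category of algebras. **$\perp$-commutative functors.** Let $\mathbf{Mon}_{\mathbf M}$ be the category of monoids in $\mathbf M$. Let $\mathbf{Mon}_{\mathbf M}^{\overline{\mathbf C}}$ be the full subcategory of the category of functors $\mathbf C\to\mathbf{Mon}_{\mathbf M}$ on the functors $\mathfrak A$ such that $$\mu_c\,(\mathfrak A(f_1)\otimes\mathfrak A(f_2))=\mu_c\,\tau\,(\mathfrak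 A(f_1)\otimes\mathfrak A(f_2))$$ for all $f_1\perp f_2$ with target $c$, where $\mu_c$ is the multiplication of $\mathfrak A(c)$. (These functors are the algebraic quantum field theories on $\overline{\mathbf C}$.) **Theorem.** For every orthogonal category $\overline{\mathbf C}$ there is an isomorphism of categories $$\mathbf{Alg}(\mathcal O_{\overline{\mathbf C}})\;\cong\;\mathbf{Mon}_{\mathbf M}^{\overline{\mathbf C}},$$ and these isomorphisms can be chosen natural in $\overline{\mathbf C}\in\mathbf{OrthCat}$: for every orthogonal functor $F:\overline{\mathbf C}\to\overline{\mathbf D}$ they commute strictly with the pullback $\mathbf{Alg}(\mathcal O_{\overline{\mathbf D}})\to\mathbf{Alg}(\mathcal O_{\overline{\mathbf C}})$ of algebras along the induced morphism of colored operads and with the precomposition $\mathfrak A\mapsto\mathfrak A F$. -/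

import Mathlib

open CategoryTheory MonoidalCategory Limits Opposite

universe v u w

namespace AQFT

section Tensor

variable {M : Type u} [Category.{v} M] [MonoidalCategory M]

/-- The tensor product `X 0 ⊗ (X 1 ⊗ (⋯ ⊗ 𝟙_ M))` of a finite sequence of objects. -/
def tensorFin : {n : ℕ} → (Fin n → M) → M
  | 0, _ => 𝟙_ M
  | _ + 1, X => X 0 ⊗ tensorFin (fun i => X i.succ)

/-- The tensor product of a finite sequence of morphisms. -/
def tensorFinMap : {n : ℕ} → {X Y : Fin n → M} → (∀ i, X i ⟶ Y i) → (tensorFin X ⟶ tensorFin Y)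
  | 0, _, _, _ => 𝟙 (𝟙_ M)
  | _ + 1, _, _, f => f 0 ⊗ₘ tensorFinMap (fun i => f i.succ)

theorem tensorFinMap_id : {n : ℕ} → (X : Fin n → M) →
    tensorFinMap (fun i => 𝟙 (X i)) = 𝟙 (tensorFin X)
  | 0, _ => rfl
  | _ + 1, X => by
    show 𝟙 (X 0) ⊗ₘ tensorFinMap (fun i => 𝟙 (X (Fin.succ i))) = 𝟙 (X 0 ⊗ _)
    rw [tensorFinMap_id (fun i => X (Fin.succ i))]
    simp

theorem tensorFinMap_comp : {n : ℕ} → {X Y Z : Fin n → M} → (f : ∀ i, X i ⟶ Y i) →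
    (g : ∀ i, Y i ⟶ Z i) →
    tensorFinMap (fun i => f i ≫ g i) = tensorFinMap f ≫ tensorFinMap g
  | 0, _, _, _, _, _ => (Category.id_comp (𝟙 (𝟙_ M))).symm
  | _ + 1, X, Y, Z, f, g => by
    show (f 0 ≫ g 0) ⊗ₘ tensorFinMap (fun i => f (Fin.succ i) ≫ g (Fin.succ i)) =
      (f 0 ⊗ₘ tensorFinMap (fun i => f (Fin.succ i))) ≫
        (g 0 ⊗ₘ tensorFinMap (fun i => g (Fin.succ i)))
    rw [tensorFinMap_comp (fun i => f (Fin.succ i)) (fun i => g (Fin.succ i))]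
    simp

/-- The tensor product of a finite sequence of isomorphisms. -/
def tensorFinIso {n : ℕ} {X Y : Fin n → M} (f : ∀ i, X i ≅ Y i) : tensorFin X ≅ tensorFin Y where
  hom := tensorFinMap (fun i => (f i).hom)
  inv := tensorFinMap (fun i => (f i).inv)
  hom_inv_id := by rw [← tensorFinMap_comp]; simp [tensorFinMap_id]
  inv_hom_id := by rw [← tensorFinMap_comp]; simp [tensorFinMap_id]

/-- Concatenation of a finite sequence of lists. -/
def concatLists {ι : Type w} : {n : ℕ} → (Fin n → List ι) → List ι
  | 0, _ => []
  | _ + 1, l => l 0 ++ concatLists (fun i => l i.succ)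

/-- Bracketed tensor expressions in letters from `ι`. -/
inductive TensorWord (ι : Type w) : Type w
  | unit : TensorWord ι
  | letter (i : ι) : TensorWord ι
  | mul (a b : TensorWord ι) : TensorWord ι
  | nary (n : ℕ) (a : Fin n → TensorWord ι) : TensorWord ι

/-- The list of the letters of a tensor expression, read from left to right. -/
def TensorWord.letters {ι : Type w} : TensorWord ι → List ι
  | .unit => []
  | .letter i => [i]
  | .mul a b => a.letters ++ b.letters
  | .nary _ a => concatLists (fun i => (a i).letters)

/-- The value of a tensor expression when the letter `i` stands for the object `X i`. -/
def TensorWord.eval {ι : Type w} (X : ι → M) : TensorWord ι → M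
  | .unit => 𝟙_ M
  | .letter i => X i
  | .mul a b => a.eval X ⊗ b.eval X
  | .nary _ a => tensorFin (fun i => (a i).eval X)

/-- The right-bracketed tensor product of the objects named by a list of letters. -/
def tensorList {ι : Type w} (X : ι → M) : List ι → M
  | [] => 𝟙_ M
  | i :: l => X i ⊗ tensorList X l

/-- Rebracketing: the tensor product over a concatenated list. -/
def appendIso {ι : Type w} (X : ι → M) : (l l' : List ι) →
    (tensorList X (l ++ l') ≅ tensorList X l ⊗ tensorList X l')
  | [], _ => (λ_ _).symm
  | i :: l, l' => whiskerLeftIso (X i) (appendIso X l l') ≪≫ (α_ _ _ _).symm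

/-- Rebracketing: the tensor product over a finite sequence of lists. -/
def concatIso {ι : Type w} (X : ι → M) : {n : ℕ} → (l : Fin n → List ι) →
    (tensorFin (fun i => tensorList X (l i)) ≅ tensorList X (concatLists l))
  | 0, _ => Iso.refl (𝟙_ M)
  | _ + 1, l => whiskerLeftIso (tensorList X (l 0)) (concatIso X (fun i => l i.succ)) ≪≫
      (appendIso X (l 0) (concatLists (fun i => l i.succ))).symm

/-- Rebracketing: a tensor expression is canonically isomorphic to the right-bracketed tensor
product of its letters, taken in the same order (only associators and unitors are used). -/
def TensorWord.normIso {ι : Type w} (X : ι → M) : (a : TensorWord ι) →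
    (a.eval X ≅ tensorList X a.letters)
  | .unit => Iso.refl (𝟙_ M)
  | .letter i => (ρ_ (X i)).symm
  | .mul a b => (a.normIso X ⊗ᵢ b.normIso X) ≪≫ (appendIso X a.letters b.letters).symm
  | .nary _ a => tensorFinIso (fun i => (a i).normIso X) ≪≫ concatIso X (fun i => (a i).letters)

variable [SymmetricCategory M]

/-- Move the (first occurrence of the) letter `i` to the front, by the symmetric braiding. -/
def bringIso {ι : Type w} [DecidableEq ι] (X : ι → M) (i : ι) : (l : List ι) → i ∈ l →
    (tensorList X l ≅ X i ⊗ tensorList X (l.erase i))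
  | [], h => absurd h List.not_mem_nil
  | j :: l, h =>
    if e : j = i then
      eqToIso (by rw [e, List.erase_cons_head]; rfl)
    else
      whiskerLeftIso (X j) (bringIso X i l ((List.mem_cons.1 h).resolve_left (Ne.symm e))) ≪≫
        (α_ (X j) (X i) (tensorList X (l.erase i))).symm ≪≫
        whiskerRightIso (β_ (X j) (X i)) (tensorList X (l.erase i)) ≪≫
        α_ (X i) (X j) (tensorList X (l.erase i)) ≪≫
        eqToIso (by rw [List.erase_cons_tail (by simpa using e)]; rfl)

/-- Reorder the tensor factors named by `l` into the order in which they occur in `l'`, by the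
symmetric braiding. -/
def reorderIso {ι : Type w} [DecidableEq ι] (X : ι → M) : (l l' : List ι) → l.Perm l' →
    (tensorList X l ≅ tensorList X l')
  | l, [], h => eqToIso (by rw [List.perm_nil.1 h])
  | l, i :: l', h =>
    bringIso X i l (h.mem_iff.2 List.mem_cons_self) ≪≫
      whiskerLeftIso (X i) (reorderIso X (l.erase i) l' (List.cons_perm_iff_perm_erase.1 h.symm).2.symm)

/-- The canonical isomorphism between two tensor expressions with the same letters (used below
only when every letter occurs exactly once): it permutes the tensor factors by means of the
symmetric braiding, and rebrackets by means of the associator and the unitors. -/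
def canonIso {ι : Type w} [DecidableEq ι] (X : ι → M) (a b : TensorWord ι)
    (h : a.letters.Perm b.letters) : a.eval X ≅ b.eval X :=
  a.normIso X ≪≫ reorderIso X a.letters b.letters h ≪≫ (b.normIso X).symm

end Tensor

section Points

variable {M : Type u} [Category.{v} M] [MonoidalCategory M]

/-- The tensor product of two points `𝟙_ M ⟶ A` and `𝟙_ M ⟶ B`. -/
def ptTensor {A B : M} (p : 𝟙_ M ⟶ A) (q : 𝟙_ M ⟶ B) : 𝟙_ M ⟶ A ⊗ B :=
  (λ_ (𝟙_ M)).inv ≫ (p ⊗ₘ q)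

theorem ptTensor_comp {A B A' B' : M} (p : 𝟙_ M ⟶ A) (q : 𝟙_ M ⟶ B) (f : A ⟶ A') (g : B ⟶ B') :
    ptTensor p q ≫ (f ⊗ₘ g) = ptTensor (p ≫ f) (q ≫ g) := by
  simp [ptTensor]

theorem ptTensor_whiskerLeft {A B B' : M} (p : 𝟙_ M ⟶ A) (q : 𝟙_ M ⟶ B) (g : B ⟶ B') :
    ptTensor p q ≫ (A ◁ g) = ptTensor p (q ≫ g) := by
  rw [← id_tensorHom, ptTensor_comp, Category.comp_id]

theorem ptTensor_whiskerRight {A B A' : M} (p : 𝟙_ M ⟶ A) (q : 𝟙_ M ⟶ B) (f : A ⟶ A') :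
    ptTensor p q ≫ (f ▷ B) = ptTensor (p ≫ f) q := by
  rw [← tensorHom_id, ptTensor_comp, Category.comp_id]

theorem ptTensor_leftUnitor {A : M} (p : 𝟙_ M ⟶ A) : ptTensor (𝟙 (𝟙_ M)) p ≫ (λ_ A).hom = p := by
  simp [ptTensor]

theorem ptTensor_leftUnitor_inv {A : M} (p : 𝟙_ M ⟶ A) :
    p ≫ (λ_ A).inv = ptTensor (𝟙 (𝟙_ M)) p := by
  simp [ptTensor]

theorem ptTensor_rightUnitor_inv {A : M} (p : 𝟙_ M ⟶ A) :
    p ≫ (ρ_ A).inv = ptTensor p (𝟙 (𝟙_ M)) := by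
  simp [ptTensor, unitors_inv_equal]

theorem ptTensor_assoc {A B C : M} (p : 𝟙_ M ⟶ A) (q : 𝟙_ M ⟶ B) (r : 𝟙_ M ⟶ C) :
    ptTensor (ptTensor p q) r ≫ (α_ A B C).hom = ptTensor p (ptTensor q r) := by
  have h1 : ((λ_ (𝟙_ M)).inv ≫ (p ⊗ₘ q)) ⊗ₘ r = ((λ_ (𝟙_ M)).inv ▷ 𝟙_ M) ≫ ((p ⊗ₘ q) ⊗ₘ r) := by
    rw [← tensorHom_id, tensorHom_comp_tensorHom, Category.id_comp]
  have h2 : p ⊗ₘ ((λ_ (𝟙_ M)).inv ≫ (q ⊗ₘ r)) = (𝟙_ M ◁ (λ_ (𝟙_ M)).inv) ≫ (p ⊗ₘ (q ⊗ₘ r)) := by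
    rw [← id_tensorHom, tensorHom_comp_tensorHom, Category.id_comp]
  have h3 : ((λ_ (𝟙_ M)).inv ▷ 𝟙_ M) ≫ (α_ (𝟙_ M) (𝟙_ M) (𝟙_ M)).hom =
      𝟙_ M ◁ (λ_ (𝟙_ M)).inv := by monoidal_coherence
  unfold ptTensor
  rw [h1, h2, Category.assoc, Category.assoc, associator_naturality, ← h3, Category.assoc]

theorem ptTensor_assoc_inv {A B C : M} (p : 𝟙_ M ⟶ A) (q : 𝟙_ M ⟶ B) (r : 𝟙_ M ⟶ C) :
    ptTensor p (ptTensor q r) ≫ (α_ A B C).inv = ptTensor (ptTensor p q) r := by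
  rw [Iso.comp_inv_eq, ptTensor_assoc]

/-- The tensor product of a finite sequence of points. -/
def ptFin : {n : ℕ} → {X : Fin n → M} → (∀ i, 𝟙_ M ⟶ X i) → (𝟙_ M ⟶ tensorFin X)
  | 0, _, _ => 𝟙 (𝟙_ M)
  | _ + 1, _, p => ptTensor (p 0) (ptFin (fun i => p i.succ))

theorem ptFin_map : {n : ℕ} → {X Y : Fin n → M} → (p : ∀ i, 𝟙_ M ⟶ X i) → (f : ∀ i, X i ⟶ Y i) →
    ptFin p ≫ tensorFinMap f = ptFin (fun i => p i ≫ f i)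
  | 0, _, _, _, _ => Category.id_comp (𝟙 (𝟙_ M))
  | _ + 1, X, Y, p, f => by
    show ptTensor (p 0) (ptFin (fun i => p (Fin.succ i))) ≫
      (f 0 ⊗ₘ tensorFinMap (fun i => f (Fin.succ i))) = _
    rw [ptTensor_comp, ptFin_map]
    rfl

/-- The point of the value of a tensor expression given by points of the letters. -/
def ptWord {ι : Type w} {X : ι → M} (p : ∀ i, 𝟙_ M ⟶ X i) : (a : TensorWord ι) → (𝟙_ M ⟶ a.eval X)
  | .unit => 𝟙 (𝟙_ M)
  | .letter i => p i
  | .mul a b => ptTensor (ptWord p a) (ptWord p b)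
  | .nary _ a => ptFin (fun i => ptWord p (a i))

/-- The point of `tensorList X l` given by points of the letters. -/
def ptList {ι : Type w} {X : ι → M} (p : ∀ i, 𝟙_ M ⟶ X i) : (l : List ι) → (𝟙_ M ⟶ tensorList X l)
  | [] => 𝟙 (𝟙_ M)
  | i :: l => ptTensor (p i) (ptList p l)

theorem ptList_append {ι : Type w} {X : ι → M} (p : ∀ i, 𝟙_ M ⟶ X i) : (l l' : List ι) →
    ptList p (l ++ l') ≫ (appendIso X l l').hom = ptTensor (ptList p l) (ptList p l')
  | [], l' => ptTensor_leftUnitor_inv (ptList p l')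
  | i :: l, l' => by
    show ptTensor (p i) (ptList p (l ++ l')) ≫ (X i ◁ (appendIso X l l').hom) ≫ (α_ _ _ _).inv = _
    rw [← Category.assoc, ptTensor_whiskerLeft, ptList_append, ptTensor_assoc_inv]
    rfl

theorem ptList_concat {ι : Type w} {X : ι → M} (p : ∀ i, 𝟙_ M ⟶ X i) : {n : ℕ} →
    (l : Fin n → List ι) →
    ptFin (fun i => ptList p (l i)) ≫ (concatIso X l).hom = ptList p (concatLists l)
  | 0, _ => Category.id_comp (𝟙 (𝟙_ M))
  | _ + 1, l => by
    show ptTensor (ptList p (l 0)) (ptFin (fun i => ptList p (l (Fin.succ i)))) ≫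
      (_ ◁ (concatIso X (fun i => l (Fin.succ i))).hom) ≫ (appendIso X _ _).inv = _
    rw [← Category.assoc, ptTensor_whiskerLeft, ptList_concat]
    exact (Iso.comp_inv_eq _).2 (ptList_append p _ _).symm

theorem ptWord_norm {ι : Type w} {X : ι → M} (p : ∀ i, 𝟙_ M ⟶ X i) : (a : TensorWord ι) →
    ptWord p a ≫ (a.normIso X).hom = ptList p a.letters
  | .unit => Category.id_comp (𝟙 (𝟙_ M))
  | .letter i => ptTensor_rightUnitor_inv (p i)
  | .mul a b => by
    show ptTensor (ptWord p a) (ptWord p b) ≫ ((a.normIso X).hom ⊗ₘ (b.normIso X).hom) ≫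
      (appendIso X _ _).inv = _
    rw [← Category.assoc, ptTensor_comp, ptWord_norm p a, ptWord_norm p b]
    exact (Iso.comp_inv_eq _).2 (ptList_append p _ _).symm
  | .nary _ a => by
    show ptFin (fun i => ptWord p (a i)) ≫ tensorFinMap (fun i => ((a i).normIso X).hom) ≫
      (concatIso X _).hom = _
    rw [← Category.assoc, ptFin_map]
    have : (fun i => ptWord p (a i) ≫ ((a i).normIso X).hom) = fun i => ptList p (a i).letters :=
      funext fun i => ptWord_norm p (a i)
    rw [this]
    exact ptList_concat p _

theorem ptList_eqToHom {ι : Type w} {X : ι → M} (p : ∀ i, 𝟙_ M ⟶ X i) {l l' : List ι} (h : l = l')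
    (h' : tensorList X l = tensorList X l') : ptList p l ≫ eqToHom h' = ptList p l' := by
  subst h
  simp

variable [SymmetricCategory M]

theorem ptTensor_braiding {A B : M} (p : 𝟙_ M ⟶ A) (q : 𝟙_ M ⟶ B) :
    ptTensor p q ≫ (β_ A B).hom = ptTensor q p := by
  simp [ptTensor, BraidedCategory.braiding_naturality, unitors_inv_equal]

theorem ptList_bring {ι : Type w} [DecidableEq ι] {X : ι → M} (p : ∀ i, 𝟙_ M ⟶ X i) (i : ι) :
    (l : List ι) → (h : i ∈ l) →
    ptList p l ≫ (bringIso X i l h).hom = ptTensor (p i) (ptList p (l.erase i))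
  | [], h => absurd h List.not_mem_nil
  | j :: l, h => by
    by_cases e : j = i
    · subst e
      rw [bringIso, dif_pos rfl]
      have := ptList_eqToHom p (l := j :: l) (l' := j :: ((j :: l).erase j)) (by simp)
        (by simp)
      exact this
    · rw [bringIso, dif_neg e]
      have hE : X i ⊗ X j ⊗ tensorList X (l.erase i) = X i ⊗ tensorList X ((j :: l).erase i) := by
        rw [List.erase_cons_tail (by simpa using e)]; rfl
      show ptTensor (p j) (ptList p l) ≫ (X j ◁ (bringIso X i l _).hom) ≫ (α_ _ _ _).inv ≫
        ((β_ (X j) (X i)).hom ▷ _) ≫ (α_ _ _ _).hom ≫ eqToHom hE = _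
      rw [← Category.assoc, ptTensor_whiskerLeft, ptList_bring p i l, ← Category.assoc,
        ptTensor_assoc_inv, ← Category.assoc, ptTensor_whiskerRight, ptTensor_braiding,
        ← Category.assoc, ptTensor_assoc]
      exact ptList_eqToHom p (l := i :: (j :: l.erase i)) (l' := i :: ((j :: l).erase i))
        (by rw [List.erase_cons_tail (by simpa using e)]) (by
          rw [List.erase_cons_tail (by simpa using e)])

theorem ptList_reorder {ι : Type w} [DecidableEq ι] {X : ι → M} (p : ∀ i, 𝟙_ M ⟶ X i) :
    (l l' : List ι) → (h : l.Perm l') →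
    ptList p l ≫ (reorderIso X l l' h).hom = ptList p l'
  | l, [], h => ptList_eqToHom p (List.perm_nil.1 h) (by rw [List.perm_nil.1 h])
  | l, i :: l', h => by
    rw [reorderIso]
    show ptList p l ≫ (bringIso X i l _).hom ≫ (X i ◁ (reorderIso X (l.erase i) l' _).hom) = _
    rw [← Category.assoc, ptList_bring, ptTensor_whiskerLeft, ptList_reorder]
    rfl

theorem ptWord_canon {ι : Type w} [DecidableEq ι] {X : ι → M} (p : ∀ i, 𝟙_ M ⟶ X i)
    (a b : TensorWord ι) (h : a.letters.Perm b.letters) :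
    ptWord p a ≫ (canonIso X a b h).hom = ptWord p b := by
  simp only [canonIso, Iso.trans_hom, Iso.symm_hom]
  rw [← Category.assoc, ptWord_norm, ← Category.assoc, ptList_reorder, Iso.comp_inv_eq,
    ptWord_norm]

end Points


section Profiles

/-- A profile: a finite sequence of colors. -/
structure Profile (𝔠 : Type w) where
  /-- the length of the sequence -/
  len : ℕ
  /-- the entries of the sequence -/
  col : Fin len → 𝔠

namespace Profile

/-- A morphism `c ⟶ d` of profiles is a permutation `σ` with `d = c σ`, where
`c σ = (c (σ 1), …, c (σ n))`; the lengths of `c` and `d` then agree. -/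
@[ext]
structure Hom {𝔠 : Type w} (c d : Profile 𝔠) where
  perm : Fin d.len ≃ Fin c.len
  col_eq : ∀ i, d.col i = c.col (perm i)

/-- The groupoid of profiles and right permutations. -/
instance category (𝔠 : Type w) : Category (Profile 𝔠) where
  Hom := Hom
  id _ := ⟨Equiv.refl _, fun _ => rfl⟩
  comp f g := ⟨g.perm.trans f.perm, fun i => (g.col_eq i).trans (f.col_eq (g.perm i))⟩

/-- The profile `c σ = (c (σ 1), …, c (σ n))`. -/
abbrev permute {𝔠 : Type w} (c : Profile 𝔠) (σ : Equiv.Perm (Fin c.len)) : Profile 𝔠 :=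
  ⟨c.len, fun i => c.col (σ i)⟩

/-- The permutation `σ`, as a morphism `c ⟶ c σ`. -/
def permHom {𝔠 : Type w} (c : Profile 𝔠) (σ : Equiv.Perm (Fin c.len)) : c ⟶ c.permute σ :=
  Hom.mk (d := c.permute σ) σ fun _ => rfl

/-- The profile `(t)` of length one. -/
abbrev single {𝔠 : Type w} (t : 𝔠) : Profile 𝔠 :=
  ⟨1, fun _ => t⟩

/-- The concatenation of the profiles `b 0, …, b (m - 1)`. -/
abbrev concat {𝔠 : Type w} {m : ℕ} (b : Fin m → Profile 𝔠) : Profile 𝔠 :=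
  ⟨∑ i, (b i).len, fun p => (b (finSigmaFinEquiv.symm p).1).col (finSigmaFinEquiv.symm p).2⟩

/-- The positions of a concatenated profile are the pairs of a block `i` and a position in `b i`,
in lexicographic order. -/
def split {𝔠 : Type w} {m : ℕ} (b : Fin m → Profile 𝔠) :
    Fin (concat b).len ≃ (i : Fin m) × Fin (b i).len :=
  finSigmaFinEquiv.symm

/-- The morphism of concatenated profiles given by a color preserving bijection between the
positions. -/
def sigmaHom {𝔠 : Type w} {m m' : ℕ} (b : Fin m → Profile 𝔠) (b' : Fin m' → Profile 𝔠)
    (e : ((i : Fin m') × Fin (b' i).len) ≃ ((i : Fin m) × Fin (b i).len))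
    (h : ∀ x, (b' x.1).col x.2 = (b (e x).1).col (e x).2) : concat b ⟶ concat b' :=
  Hom.mk (c := concat b) (d := concat b') ((split b').trans (e.trans (split b).symm)) fun p => by
    show (b' (split b' p).1).col (split b' p).2 =
      (b (split b ((split b).symm (e (split b' p)))).1).col
        (split b ((split b).symm (e (split b' p)))).2
    rw [Equiv.apply_symm_apply]
    exact h _

/-- The block permutation
`σ⟨k 1, …, k m⟩ : b 1 ⊗ ⋯ ⊗ b m ⟶ b (σ 1) ⊗ ⋯ ⊗ b (σ m)`. -/
def blockPerm {𝔠 : Type w} {m : ℕ} (b : Fin m → Profile 𝔠) (σ : Equiv.Perm (Fin m)) :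
    concat b ⟶ concat (fun i => b (σ i)) :=
  sigmaHom b (fun i => b (σ i)) (Equiv.sigmaCongrLeft (β := fun i => Fin (b i).len) σ)
    fun _ => rfl

/-- The block sum `σ 1 ⊕ ⋯ ⊕ σ m : b 1 ⊗ ⋯ ⊗ b m ⟶ b' 1 ⊗ ⋯ ⊗ b' m`. -/
def blockSum {𝔠 : Type w} {m : ℕ} {b b' : Fin m → Profile 𝔠} (σ : ∀ i, b i ⟶ b' i) :
    concat b ⟶ concat b' :=
  sigmaHom b b' (Equiv.sigmaCongrRight fun i => (σ i).perm) fun x => (σ x.1).col_eq x.2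

/-- The identity permutation, as a morphism `a ⟶ (a 1) ⊗ ⋯ ⊗ (a n)`. -/
def singlesHom {𝔠 : Type w} (a : Profile 𝔠) : a ⟶ concat (fun i => single (a.col i)) :=
  Hom.mk (c := a) (d := concat (fun i => single (a.col i)))
    ((split fun i => single (a.col i)).trans (Equiv.sigmaUnique (Fin a.len) fun _ => Fin 1))
    fun _ => rfl

/-- The identity permutation, as a morphism from `a` to the concatenation of the one-term
sequence of profiles `a`. -/
def oneBlockHom {𝔠 : Type w} (a : Profile 𝔠) : a ⟶ concat (fun _ : Fin 1 => a) :=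
  Hom.mk (c := a) (d := concat (fun _ : Fin 1 => a))
    ((split fun _ : Fin 1 => a).trans
      { toFun := fun x => x.2
        invFun := fun j => ⟨0, j⟩
        left_inv := fun _ => Sigma.ext (Subsingleton.elim _ _) HEq.rfl
        right_inv := fun _ => rfl })
    fun _ => rfl

/-- The two ways to decompose the positions of a twice concatenated profile. -/
def assocEquiv {𝔠 : Type w} {m : ℕ} (b : Fin m → Profile 𝔠)
    (c : ∀ i, Fin (b i).len → Profile 𝔠) :
    ((i : Fin m) × Fin (concat (c i)).len) ≃
      ((p : Fin (concat b).len) × Fin (c (split b p).1 (split b p).2).len) :=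
  ((Equiv.sigmaCongrRight fun i => split (c i)).trans
    (Equiv.sigmaAssoc fun i j => Fin (c i j).len).symm).trans
      (Equiv.sigmaCongrLeft (β := fun x : (i : Fin m) × Fin (b i).len => Fin (c x.1 x.2).len)
        (split b)).symm

theorem assocEquiv_spec {𝔠 : Type w} {m : ℕ} (b : Fin m → Profile 𝔠)
    (c : ∀ i, Fin (b i).len → Profile 𝔠) (x : (i : Fin m) × Fin (concat (c i)).len) :
    (⟨split b (assocEquiv b c x).1, (assocEquiv b c x).2⟩ :
        (u : (i : Fin m) × Fin (b i).len) × Fin (c u.1 u.2).len) =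
      ⟨⟨x.1, (split (c x.1) x.2).1⟩, (split (c x.1) x.2).2⟩ :=
  Equiv.apply_symm_apply (Equiv.sigmaCongrLeft
    (β := fun x : (i : Fin m) × Fin (b i).len => Fin (c x.1 x.2).len) (split b)) _

/-- The identity permutation, as a morphism
`(c 11 ⊗ ⋯ ) ⊗ ⋯ ⊗ ( ⋯ ⊗ c mk) ⟶ c 11 ⊗ ⋯ ⊗ c mk`. -/
def assocHom {𝔠 : Type w} {m : ℕ} (b : Fin m → Profile 𝔠)
    (c : ∀ i, Fin (b i).len → Profile 𝔠) :
    concat (fun p : Fin (concat b).len => c (split b p).1 (split b p).2) ⟶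
      concat (fun i => concat (c i)) :=
  sigmaHom (fun p : Fin (concat b).len => c (split b p).1 (split b p).2)
    (fun i => concat (c i)) (assocEquiv b c) fun x =>
      (congrArg (fun u : (u : (i : Fin m) × Fin (b i).len) × Fin (c u.1 u.2).len =>
        (c u.1.1 u.1.2).col u.2) (assocEquiv_spec b c x)).symm

/-- The functor of profile groupoids induced by a map of colors. -/
abbrev mapColor {𝔠 𝔡 : Type w} (f : 𝔠 → 𝔡) (c : Profile 𝔠) : Profile 𝔡 :=
  ⟨c.len, fun i => f (c.col i)⟩

/-- The action of `mapColor` on permutations. -/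
def mapColorHom {𝔠 𝔡 : Type w} (f : 𝔠 → 𝔡) {c d : Profile 𝔠} (σ : c ⟶ d) :
    c.mapColor f ⟶ d.mapColor f :=
  Hom.mk (c := c.mapColor f) (d := d.mapColor f) σ.perm fun i => congrArg f (σ.col_eq i)

end Profile

end Profiles

section Operads

variable {M : Type u} [Category.{v} M] [MonoidalCategory M] [SymmetricCategory M]

theorem mem_concatLists {ι : Type w} : {n : ℕ} → (l : Fin n → List ι) → (x : ι) →
    (x ∈ concatLists l ↔ ∃ i, x ∈ l i)
  | 0, _, x => by simp [concatLists]
  | _ + 1, l, x => by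
    rw [concatLists, List.mem_append, mem_concatLists, Fin.exists_fin_succ]

theorem nodup_concatLists {ι : Type w} : {n : ℕ} → (l : Fin n → List ι) →
    (∀ i, (l i).Nodup) → (∀ i j x, x ∈ l i → x ∈ l j → i = j) → (concatLists l).Nodup
  | 0, _, _, _ => List.nodup_nil
  | _ + 1, l, h1, h2 => by
    rw [concatLists, List.nodup_append']
    refine ⟨h1 0, nodup_concatLists _ (fun i => h1 i.succ) fun i j x hi hj =>
      Fin.succ_injective _ (h2 _ _ x hi hj), fun x hx hx' => ?_⟩
    obtain ⟨i, hi⟩ := (mem_concatLists _ x).1 hx'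
    exact (Fin.succ_ne_zero i) (h2 _ _ x hi hx)

/-- The tensor expression `σ 1 ⊗ ⋯ ⊗ σ n`. -/
def permWord {n : ℕ} (σ : Equiv.Perm (Fin n)) : TensorWord (Fin n) :=
  .nary n fun i => .letter (σ i)

theorem permWord_perm {n : ℕ} (σ τ : Equiv.Perm (Fin n)) :
    (permWord σ).letters.Perm (permWord τ).letters := by
  have key : ∀ ρ : Equiv.Perm (Fin n), (permWord ρ).letters.Nodup ∧
      ∀ x, x ∈ (permWord ρ).letters := by
    intro ρ
    constructor
    · refine nodup_concatLists _ (fun i => List.nodup_singleton _) fun i j x hi hj => ?_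
      have hi' := List.mem_singleton.1 hi
      have hj' := List.mem_singleton.1 hj
      exact ρ.injective (hi'.symm.trans hj')
    · intro x
      exact (mem_concatLists _ x).2 ⟨ρ.symm x, List.mem_singleton.2 (ρ.apply_symm_apply x).symm⟩
  exact (List.perm_ext_iff_of_nodup (key σ).1 (key τ).1).2 fun x =>
    ⟨fun _ => (key τ).2 x, fun _ => (key σ).2 x⟩

/-- The permutation `X 1 ⊗ ⋯ ⊗ X n ⟶ X (σ 1) ⊗ ⋯ ⊗ X (σ n)` of tensor factors. -/
def permFin {n : ℕ} (X : Fin n → M) (σ : Equiv.Perm (Fin n)) :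
    tensorFin X ⟶ tensorFin (fun i => X (σ i)) :=
  (canonIso X (permWord (Equiv.refl _)) (permWord σ) (permWord_perm _ _)).hom

theorem ptFin_perm {n : ℕ} {X : Fin n → M} (p : ∀ i, 𝟙_ M ⟶ X i) (σ : Equiv.Perm (Fin n)) :
    ptFin p ≫ permFin X σ = ptFin (fun i => p (σ i)) :=
  ptWord_canon p (permWord (Equiv.refl _)) (permWord σ) (permWord_perm _ _)

/-- Names for tensor factors `P`, `X i` and `Y i j`. -/
abbrev FactorName (m : ℕ) (k : Fin m → ℕ) : Type :=
  Unit ⊕ (Fin m ⊕ ((i : Fin m) × Fin (k i)))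

/-- The tensor expression `(P ⊗ ⨂ i, X i) ⊗ ⨂ (i, j), Y i j`, the last product being taken in the
order given by `e`. -/
def outerWord {m N : ℕ} {k : Fin m → ℕ} (e : Fin N ≃ (i : Fin m) × Fin (k i)) :
    TensorWord (FactorName m k) :=
  .mul (.mul (.letter (Sum.inl ())) (.nary m fun i => .letter (Sum.inr (Sum.inl i))))
    (.nary N fun p => .letter (Sum.inr (Sum.inr (e p))))

/-- The tensor expression `P ⊗ ⨂ i, (X i ⊗ ⨂ j, Y i j)`. -/
def innerWord {m : ℕ} (k : Fin m → ℕ) : TensorWord (FactorName m k) :=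
  .mul (.letter (Sum.inl ())) (.nary m fun i =>
    .mul (.letter (Sum.inr (Sum.inl i))) (.nary (k i) fun j => .letter (Sum.inr (Sum.inr ⟨i, j⟩))))

theorem outerWord_perm {m N : ℕ} {k : Fin m → ℕ} (e : Fin N ≃ (i : Fin m) × Fin (k i)) :
    (outerWord e).letters.Perm (innerWord k).letters := by
  refine (List.perm_ext_iff_of_nodup ?_ ?_).2 ?_
  · simp only [outerWord, TensorWord.letters]
    rw [List.nodup_append']
    refine ⟨?_, nodup_concatLists _ (fun i => List.nodup_singleton _) ?_, ?_⟩
    · rw [List.nodup_append']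
      refine ⟨List.nodup_singleton _,
        nodup_concatLists _ (fun i => List.nodup_singleton _) ?_, ?_⟩
      · intro i j x hi hj
        simp_all
      · intro x hx hx'
        simp_all [mem_concatLists]
    · intro i j x hi hj
      have h1 := List.mem_singleton.1 hi
      have h2 := List.mem_singleton.1 hj
      exact e.injective (Sum.inr_injective (Sum.inr_injective (h1.symm.trans h2)))
    · intro x hx hx'
      rw [mem_concatLists] at hx'
      rw [List.mem_append, mem_concatLists] at hx
      obtain ⟨p, hp⟩ := hx'
      rw [List.mem_singleton] at hp
      subst hp
      simp at hx
  · simp only [innerWord, TensorWord.letters]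
    rw [List.nodup_append']
    refine ⟨List.nodup_singleton _, nodup_concatLists _ (fun i => ?_) ?_, ?_⟩
    · rw [List.nodup_append']
      refine ⟨List.nodup_singleton _,
        nodup_concatLists _ (fun i => List.nodup_singleton _) ?_, ?_⟩
      · intro j j' x hi hj
        simp_all
      · intro x hx hx'
        simp_all [mem_concatLists]
    · intro i j x hi hj
      rw [List.mem_append, mem_concatLists] at hi hj
      rcases hi with hi | ⟨p, hi⟩ <;> rcases hj with hj | ⟨q, hj⟩ <;> simp_all
    · intro x hx hx'
      rw [List.mem_singleton] at hx
      subst hx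
      rw [mem_concatLists] at hx'
      obtain ⟨i, hi⟩ := hx'
      rw [List.mem_append, mem_concatLists] at hi
      simp at hi
  · intro x
    simp only [outerWord, innerWord, TensorWord.letters, List.mem_append, mem_concatLists,
      List.mem_singleton]
    rcases x with x | x | x
    · simp
    · simp
    · simp only [reduceCtorEq, exists_false, false_or, Sum.inr.injEq, or_false]
      exact ⟨fun _ => ⟨x.1, x.2, rfl⟩, fun _ => ⟨e.symm x, by simp⟩⟩

/-- The objects named by `FactorName`. -/
def factor {m : ℕ} {k : Fin m → ℕ} (P : M) (X : Fin m → M) (Y : ∀ i, Fin (k i) → M) :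
    FactorName m k → M
  | .inl _ => P
  | .inr (.inl i) => X i
  | .inr (.inr x) => Y x.1 x.2

/-- The canonical permutation of tensor factors
`(P ⊗ ⨂ i, X i) ⊗ ⨂ (i, j), Y i j ⟶ P ⊗ ⨂ i, (X i ⊗ ⨂ j, Y i j)`. -/
def unshuffle {m N : ℕ} {k : Fin m → ℕ} (e : Fin N ≃ (i : Fin m) × Fin (k i))
    (P : M) (X : Fin m → M) (Y : ∀ i, Fin (k i) → M) :
    (P ⊗ tensorFin X) ⊗ tensorFin (fun p => Y (e p).1 (e p).2) ⟶
      P ⊗ tensorFin (fun i => X i ⊗ tensorFin (Y i)) :=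
  (canonIso (factor P X Y) (outerWord e) (innerWord k) (outerWord_perm e)).hom

theorem pt_unshuffle {m N : ℕ} {k : Fin m → ℕ} (e : Fin N ≃ (i : Fin m) × Fin (k i))
    {P : M} {X : Fin m → M} {Y : ∀ i, Fin (k i) → M} (p : 𝟙_ M ⟶ P) (x : ∀ i, 𝟙_ M ⟶ X i)
    (y : ∀ i j, 𝟙_ M ⟶ Y i j) :
    ptTensor (ptTensor p (ptFin x)) (ptFin (fun q => y (e q).1 (e q).2)) ≫ unshuffle e P X Y =
      ptTensor p (ptFin (fun i => ptTensor (x i) (ptFin (y i)))) :=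
  ptWord_canon (X := factor P X Y)
    (fun n => match n with
      | .inl _ => p
      | .inr (.inl i) => x i
      | .inr (.inr z) => y z.1 z.2) (outerWord e) (innerWord k) (outerWord_perm e)

/-- The canonical isomorphism `P ⊗ 𝟙_ M ⊗ ⋯ ⊗ 𝟙_ M ⟶ P`. -/
def dropUnits (P : M) (n : ℕ) : P ⊗ tensorFin (fun _ : Fin n => 𝟙_ M) ⟶ P :=
  (canonIso (fun _ : Unit => P) (.mul (.letter ()) (.nary n fun _ => .unit)) (.letter ()) (by
    have h : ∀ n : ℕ, concatLists (fun _ : Fin n => ([] : List Unit)) = [] := by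
      intro n
      refine List.eq_nil_iff_forall_not_mem.2 fun x hx => ?_
      simp [mem_concatLists] at hx
    simp only [TensorWord.letters]
    rw [h]; rfl)).hom

theorem pt_dropUnits {P : M} (p : 𝟙_ M ⟶ P) (n : ℕ) :
    ptTensor p (ptFin (fun _ : Fin n => 𝟙 (𝟙_ M))) ≫ dropUnits P n = p :=
  ptWord_canon (X := fun _ : Unit => P) (fun _ => p)
    (.mul (.letter ()) (.nary n fun _ => .unit)) (.letter ()) _

/-- The canonical isomorphism `𝟙_ M ⊗ P ⟶ P`, where the one-fold tensor product `P` is written as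
`tensorFin`. -/
def dropUnit (P : M) : 𝟙_ M ⊗ tensorFin (fun _ : Fin 1 => P) ⟶ P :=
  (λ_ (P ⊗ 𝟙_ M)).hom ≫ (ρ_ P).hom

theorem pt_dropUnit {P : M} (p : 𝟙_ M ⟶ P) :
    ptTensor (𝟙 (𝟙_ M)) (ptFin (fun _ : Fin 1 => p)) ≫ dropUnit P = p := by
  show ptTensor (𝟙 (𝟙_ M)) (ptTensor p (𝟙 (𝟙_ M))) ≫ (λ_ (P ⊗ 𝟙_ M)).hom ≫ (ρ_ P).hom = p
  rw [← Category.assoc, ptTensor_leftUnitor, ← Iso.eq_comp_inv, ptTensor_rightUnitor_inv]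

variable (M) in
/-- A colored operad with values in `M` and with colors `𝔠`: a symmetric sequence `obj` (`obj t` is
a functor on the groupoid of profiles for every output color `t`), composition maps `comp` and
units `one`, subject to the two equivariance axioms, associativity and unitality. -/
structure ColoredOperad (𝔠 : Type w) where
  obj : 𝔠 → (Profile 𝔠 ⥤ M)
  comp : ∀ (t : 𝔠) (a : Profile 𝔠) (b : Fin a.len → Profile 𝔠),
    (obj t).obj a ⊗ tensorFin (fun i => (obj (a.col i)).obj (b i)) ⟶ (obj t).obj (Profile.concat b)
  one : ∀ t : 𝔠, 𝟙_ M ⟶ (obj t).obj (Profile.single t)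
  comp_perm : ∀ (t : 𝔠) (a : Profile 𝔠) (b : Fin a.len → Profile 𝔠)
    (σ : Equiv.Perm (Fin a.len)),
    ((obj t).map (a.permHom σ) ⊗ₘ permFin (fun i => (obj (a.col i)).obj (b i)) σ) ≫
        comp t (a.permute σ) (fun i => b (σ i)) =
      comp t a b ≫ (obj t).map (Profile.blockPerm b σ)
  comp_blockSum : ∀ (t : 𝔠) (a : Profile 𝔠) (b b' : Fin a.len → Profile 𝔠) (σ : ∀ i, b i ⟶ b' i),
    ((obj t).obj a ◁ tensorFinMap (fun i => (obj (a.col i)).map (σ i))) ≫ comp t a b' =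
      comp t a b ≫ (obj t).map (Profile.blockSum σ)
  assoc : ∀ (t : 𝔠) (a : Profile 𝔠) (b : Fin a.len → Profile 𝔠)
    (c : ∀ i, Fin (b i).len → Profile 𝔠),
    (comp t a b ▷ tensorFin (fun p : Fin (Profile.concat b).len =>
          (obj ((b (Profile.split b p).1).col (Profile.split b p).2)).obj
            (c (Profile.split b p).1 (Profile.split b p).2))) ≫
        comp t (Profile.concat b) (fun p => c (Profile.split b p).1 (Profile.split b p).2) ≫
        (obj t).map (Profile.assocHom b c) =
      unshuffle (Profile.split b) ((obj t).obj a) (fun i => (obj (a.col i)).obj (b i))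
          (fun i j => (obj ((b i).col j)).obj (c i j)) ≫
        ((obj t).obj a ◁ tensorFinMap (fun i => comp (a.col i) (b i) (c i))) ≫
        comp t a (fun i => Profile.concat (c i))
  comp_one : ∀ (t : 𝔠) (a : Profile 𝔠),
    ((obj t).obj a ◁ tensorFinMap (fun i => one (a.col i))) ≫
        comp t a (fun i => Profile.single (a.col i)) =
      dropUnits ((obj t).obj a) a.len ≫ (obj t).map a.singlesHom
  one_comp : ∀ (t : 𝔠) (a : Profile 𝔠),
    (one t ▷ tensorFin (fun _ : Fin 1 => (obj t).obj a)) ≫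
        comp t (Profile.single t) (fun _ => a) =
      dropUnit ((obj t).obj a) ≫ (obj t).map a.oneBlockHom

/-- A colored operad with values in sets, described by its elements. -/
structure SetOperad (𝔠 : Type v) where
  obj : 𝔠 → Profile 𝔠 → Type v
  map : ∀ {t : 𝔠} {c d : Profile 𝔠}, (c ⟶ d) → obj t c → obj t d
  map_id : ∀ {t : 𝔠} {c : Profile 𝔠} (x : obj t c), map (𝟙 c) x = x
  map_comp : ∀ {t : 𝔠} {c d e : Profile 𝔠} (σ : c ⟶ d) (τ : d ⟶ e) (x : obj t c),
    map (σ ≫ τ) x = map τ (map σ x)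
  comp : ∀ {t : 𝔠} {a : Profile 𝔠} {b : Fin a.len → Profile 𝔠}, obj t a →
    (∀ i, obj (a.col i) (b i)) → obj t (Profile.concat b)
  one : ∀ t : 𝔠, obj t (Profile.single t)
  comp_perm : ∀ {t : 𝔠} {a : Profile 𝔠} {b : Fin a.len → Profile 𝔠}
    (σ : Equiv.Perm (Fin a.len)) (x : obj t a) (y : ∀ i, obj (a.col i) (b i)),
    comp (a := a.permute σ) (b := fun i => b (σ i)) (map (a.permHom σ) x) (fun i => y (σ i)) =
      map (Profile.blockPerm b σ) (comp x y)
  comp_blockSum : ∀ {t : 𝔠} {a : Profile 𝔠} {b b' : Fin a.len → Profile 𝔠}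
    (σ : ∀ i, b i ⟶ b' i) (x : obj t a) (y : ∀ i, obj (a.col i) (b i)),
    comp x (fun i => map (σ i) (y i)) = map (Profile.blockSum σ) (comp x y)
  assoc : ∀ {t : 𝔠} {a : Profile 𝔠} {b : Fin a.len → Profile 𝔠}
    {c : ∀ i, Fin (b i).len → Profile 𝔠} (x : obj t a) (y : ∀ i, obj (a.col i) (b i))
    (z : ∀ i j, obj ((b i).col j) (c i j)),
    map (Profile.assocHom b c) (comp (a := Profile.concat b)
        (b := fun p => c (Profile.split b p).1 (Profile.split b p).2) (comp x y)
        (fun p => z (Profile.split b p).1 (Profile.split b p).2)) =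
      comp x (fun i => comp (y i) (z i))
  comp_one : ∀ {t : 𝔠} {a : Profile 𝔠} (x : obj t a),
    comp x (fun i => one (a.col i)) = map a.singlesHom x
  one_comp : ∀ {t : 𝔠} {a : Profile 𝔠} (x : obj t a),
    comp (a := Profile.single t) (b := fun _ => a) (one t) (fun _ => x) = map a.oneBlockHom x

end Operads


section BaseChange

variable {M : Type u} [Category.{v} M] [MonoidalCategory M]

/-- The copower `S ⊗ I`, that is, the coproduct of copies of the unit object indexed by `S`. -/
noncomputable def copower (M : Type u) [Category.{v} M] [MonoidalCategory M] [HasColimits M]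
    (S : Type v) : M :=
  ∐ fun _ : S => 𝟙_ M

/-- The summand of `S ⊗ I` with index `s`. -/
noncomputable def copowerPt [HasColimits M] {S : Type v} (s : S) : 𝟙_ M ⟶ copower M S :=
  Sigma.ι (fun _ : S => 𝟙_ M) s

/-- The morphism out of `S ⊗ I` given by a family of points. -/
noncomputable def copowerDesc [HasColimits M] {S : Type v} {Y : M} (g : S → (𝟙_ M ⟶ Y)) :
    copower M S ⟶ Y :=
  Sigma.desc g

theorem copowerPt_desc [HasColimits M] {S : Type v} {Y : M} (g : S → (𝟙_ M ⟶ Y)) (s : S) :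
    copowerPt s ≫ copowerDesc g = g s :=
  Sigma.ι_desc _ _

/-- A family of points of `B` is generating if morphisms out of `B` are determined by their values
on it. -/
def Generating {K : Type w} {B : M} (p : K → (𝟙_ M ⟶ B)) : Prop :=
  ∀ ⦃Y : M⦄ (f g : B ⟶ Y), (∀ k, p k ≫ f = p k ≫ g) → f = g

theorem generating_copower [HasColimits M] (S : Type v) :
    Generating (fun s : S => (copowerPt s : 𝟙_ M ⟶ copower M S)) :=
  fun _ _ _ h => Sigma.hom_ext _ _ h

variable [SymmetricCategory M] [MonoidalClosed M]

theorem Generating.whisker {K : Type w} {B : M} {p : K → (𝟙_ M ⟶ B)} (hp : Generating p) {A Y : M}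
    (f g : A ⊗ B ⟶ Y) (h : ∀ k, (A ◁ p k) ≫ f = (A ◁ p k) ≫ g) : f = g := by
  apply MonoidalClosed.curry_injective
  apply hp
  intro k
  rw [← MonoidalClosed.curry_natural_left, ← MonoidalClosed.curry_natural_left, h k]

theorem Generating.tensor {K : Type w} {L : Type w} {A B : M} {p : K → (𝟙_ M ⟶ A)}
    {q : L → (𝟙_ M ⟶ B)} (hp : Generating p) (hq : Generating q) :
    Generating (fun x : K × L => ptTensor (p x.1) (q x.2)) := by
  intro Y f g h
  apply hq.whisker
  intro l
  rw [← cancel_epi (ρ_ A).inv]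
  apply hp
  intro k
  have e : p k ≫ (ρ_ A).inv ≫ (A ◁ q l) = ptTensor (p k) (q l) := by
    rw [← Category.assoc, ptTensor_rightUnitor_inv, ptTensor_whiskerLeft, Category.id_comp]
  have := h (k, l)
  simp only [← e, Category.assoc] at this
  exact this

theorem Generating.fin : {n : ℕ} → {X : Fin n → M} → {K : Fin n → Type w} →
    {p : ∀ i, K i → (𝟙_ M ⟶ X i)} → (∀ i, Generating (p i)) →
    Generating (fun x : ∀ i, K i => ptFin (fun i => p i (x i)))
  | 0, _, _, _, _ => fun _ f g h => by
    have := h fun i => i.elim0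
    exact (Category.id_comp (X := 𝟙_ M) f).symm.trans (this.trans (Category.id_comp (X := 𝟙_ M) g))
  | n + 1, X, K, p, hp => fun Y f g h => by
    have := (hp 0).tensor (Generating.fin (p := fun i => p i.succ) fun i => hp i.succ)
    exact this f g fun x => h (Fin.cons (α := K) x.1 x.2)

/-- The morphism `(S ⊗ I) ⊗ Z ⟶ Y` given by a family of morphisms `Z ⟶ Y`. -/
noncomputable def copowerTensorDesc [HasColimits M] {S : Type v} {Z Y : M} (g : S → (Z ⟶ Y)) :
    copower M S ⊗ Z ⟶ Y :=
  (β_ (copower M S) Z).hom ≫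
    MonoidalClosed.uncurry (copowerDesc fun s => MonoidalClosed.curry ((ρ_ Z).hom ≫ g s))

theorem pt_copowerTensorDesc [HasColimits M] {S : Type v} {Z Y : M} (g : S → (Z ⟶ Y)) (s : S)
    (q : 𝟙_ M ⟶ Z) : ptTensor (copowerPt s) q ≫ copowerTensorDesc g = q ≫ g s := by
  have h : (Z ◁ copowerPt s) ≫ MonoidalClosed.uncurry
      (copowerDesc fun s => MonoidalClosed.curry ((ρ_ Z).hom ≫ g s)) = (ρ_ Z).hom ≫ g s := by
    rw [← MonoidalClosed.uncurry_natural_left, copowerPt_desc, MonoidalClosed.uncurry_curry]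
  have h2 : ptTensor q (copowerPt s) = q ≫ (ρ_ Z).inv ≫ (Z ◁ (copowerPt s : 𝟙_ M ⟶ copower M S)) := by
    rw [← Category.assoc, ptTensor_rightUnitor_inv, ptTensor_whiskerLeft, Category.id_comp]
  rw [copowerTensorDesc, ← Category.assoc, ptTensor_braiding, h2]
  simp only [Category.assoc]
  rw [h]
  simp

/-- The morphism `(S 1 ⊗ I) ⊗ ⋯ ⊗ (S n ⊗ I) ⟶ Y` given by a family of points of `Y` indexed by
`S 1 × ⋯ × S n`. -/
noncomputable def copowerFinDesc [HasColimits M] : {n : ℕ} → {S : Fin n → Type v} → {Y : M} →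
    ((∀ i, S i) → (𝟙_ M ⟶ Y)) → (tensorFin (fun i => copower M (S i)) ⟶ Y)
  | 0, _, _, g => g fun i => i.elim0
  | _ + 1, S, _, g => copowerTensorDesc fun s => copowerFinDesc fun r => g (Fin.cons (α := S) s r)

theorem pt_copowerFinDesc [HasColimits M] : {n : ℕ} → {S : Fin n → Type v} → {Y : M} →
    (g : (∀ i, S i) → (𝟙_ M ⟶ Y)) → (x : ∀ i, S i) →
    ptFin (fun i => copowerPt (x i)) ≫ copowerFinDesc g = g x
  | 0, S, _, g, x => by
    have e : x = fun i => i.elim0 := funext fun i => i.elim0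
    rw [e]
    exact Category.id_comp _
  | _ + 1, S, _, g, x => by
    show ptTensor (copowerPt (x 0)) (ptFin fun i => copowerPt (x (Fin.succ i))) ≫
      copowerTensorDesc (fun s => copowerFinDesc fun r => g (Fin.cons (α := S) s r)) = _
    rw [pt_copowerTensorDesc, pt_copowerFinDesc]
    congr 1
    exact Fin.cons_self_tail x

theorem generating_unit : Generating (fun _ : PUnit.{w + 1} => 𝟙 (𝟙_ M)) := fun _ f g h =>
  (Category.id_comp f).symm.trans ((h PUnit.unit).trans (Category.id_comp g))

namespace SetOperad

variable (M) [HasColimits M] {𝔠 : Type v} (O : SetOperad.{v} 𝔠)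

/-- The `M`-valued symmetric sequence `O ⊗ I`. -/
noncomputable def copowerObj (t : 𝔠) : Profile 𝔠 ⥤ M where
  obj c := copower M (O.obj t c)
  map σ := copowerDesc fun x => copowerPt (O.map σ x)
  map_id c := generating_copower _ _ _ fun x => by
    rw [copowerPt_desc, O.map_id, Category.comp_id]
  map_comp σ τ := generating_copower _ _ _ fun x => by
    rw [copowerPt_desc, O.map_comp, ← Category.assoc, copowerPt_desc, copowerPt_desc]

/-- The summand of `O ⊗ I` given by an operation of `O`. -/
noncomputable def pt {t : 𝔠} {c : Profile 𝔠} (x : O.obj t c) : 𝟙_ M ⟶ (O.copowerObj M t).obj c :=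
  copowerPt x

theorem generating_pt (t : 𝔠) (c : Profile 𝔠) :
    Generating (fun x : O.obj t c => O.pt M x) :=
  generating_copower _

theorem pt_map {t : 𝔠} {c d : Profile 𝔠} (σ : c ⟶ d) (x : O.obj t c) :
    O.pt M x ≫ (O.copowerObj M t).map σ = O.pt M (O.map σ x) :=
  copowerPt_desc _ _

/-- The composition maps of `O ⊗ I`, given on the summands by the composition of `O`. -/
noncomputable def copowerComp (t : 𝔠) (a : Profile 𝔠) (b : Fin a.len → Profile 𝔠) :
    (O.copowerObj M t).obj a ⊗ tensorFin (fun i => (O.copowerObj M (a.col i)).obj (b i)) ⟶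
      (O.copowerObj M t).obj (Profile.concat b) :=
  copowerTensorDesc fun x => copowerFinDesc fun y => O.pt M (O.comp x y)

theorem pt_comp {t : 𝔠} {a : Profile 𝔠} {b : Fin a.len → Profile 𝔠} (x : O.obj t a)
    (y : ∀ i, O.obj (a.col i) (b i)) :
    ptTensor (O.pt M x) (ptFin fun i => O.pt M (y i)) ≫ O.copowerComp M t a b =
      O.pt M (O.comp x y) :=
  (pt_copowerTensorDesc _ _ _).trans (pt_copowerFinDesc _ _)

theorem hom_ext_comp {t : 𝔠} {a : Profile 𝔠} {b : Fin a.len → Profile 𝔠} {Y : M}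
    (f g : (O.copowerObj M t).obj a ⊗ tensorFin (fun i => (O.copowerObj M (a.col i)).obj (b i)) ⟶ Y)
    (h : ∀ (x : O.obj t a) (y : ∀ i, O.obj (a.col i) (b i)),
      ptTensor (O.pt M x) (ptFin fun i => O.pt M (y i)) ≫ f =
        ptTensor (O.pt M x) (ptFin fun i => O.pt M (y i)) ≫ g) : f = g :=
  ((O.generating_pt M t a).tensor (Generating.fin fun i => O.generating_pt M (a.col i) (b i))) f g
    fun x => h x.1 x.2

/-- Change of base: the `M`-valued colored operad `O ⊗ I` of a colored operad `O` in sets. -/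
noncomputable def baseChange : ColoredOperad M 𝔠 where
  obj t := O.copowerObj M t
  comp t a b := O.copowerComp M t a b
  one t := O.pt M (O.one t)
  comp_perm t a b σ := O.hom_ext_comp M _ _ fun x y => by
    have h1 := ptFin_perm (fun i => O.pt M (y i)) σ
    have h2 := O.pt_map M (a.permHom σ) x
    have h3 := O.pt_comp M (a := a.permute σ) (b := fun i => b (σ i)) (O.map (a.permHom σ) x)
      (fun i => y (σ i))
    refine (Category.assoc _ _ _).symm.trans (Eq.trans ?_ (Category.assoc _ _ _))
    refine (congrArg (· ≫ _) ((ptTensor_comp _ _ _ _).trans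
      (congrArg₂ ptTensor h2 h1))).trans (h3.trans ?_)
    exact (congrArg _ (O.comp_perm σ x y)).trans ((O.pt_map M _ _).symm.trans
      (congrArg (· ≫ _) (O.pt_comp M x y).symm))
  comp_blockSum t a b b' σ := O.hom_ext_comp M _ _ fun x y => by
    rw [← Category.assoc, ptTensor_whiskerLeft, ptFin_map, ← Category.assoc, O.pt_comp M x y,
      O.pt_map M, ← O.comp_blockSum, ← O.pt_comp M]
    congr 3
    exact funext fun i => O.pt_map M _ _
  assoc t a b c := by
    have hg := ((O.generating_pt M t a).tensor
      (Generating.fin fun i => O.generating_pt M (a.col i) (b i))).tensor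
      (Generating.fin (fun p : Fin (Profile.concat b).len => O.generating_pt M
        ((b (Profile.split b p).1).col (Profile.split b p).2)
            (c (Profile.split b p).1 (Profile.split b p).2)))
    refine hg _ _ ?_
    rintro ⟨⟨x, y⟩, z⟩
    obtain ⟨z, rfl⟩ : ∃ z' : ∀ i j, O.obj ((b i).col j) (c i j),
        z = fun p => z' (Profile.split b p).1 (Profile.split b p).2 := by
      refine ⟨fun i j => cast (by rw [Equiv.apply_symm_apply])
        (z ((Profile.split b).symm ⟨i, j⟩)), ?_⟩
      funext p
      apply eq_of_heq
      refine HEq.trans ?_ (cast_heq _ _).symm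
      have : (Profile.split b).symm ⟨(Profile.split b p).1, (Profile.split b p).2⟩ = p :=
        Equiv.symm_apply_apply _ _
      rw [this]
    have h1 := O.pt_comp M (a := Profile.concat b)
      (b := fun p => c (Profile.split b p).1 (Profile.split b p).2) (O.comp x y)
      (fun p => z (Profile.split b p).1 (Profile.split b p).2)
    have h2 := pt_unshuffle (M := M) (Profile.split b) (O.pt M x) (fun i => O.pt M (y i))
      (fun i j => O.pt M (z i j))
    have h3 := ptTensor_whiskerRight (ptTensor (O.pt M x) (ptFin fun i => O.pt M (y i)))
      (ptFin fun p => O.pt M (z (Profile.split b p).1 (Profile.split b p).2))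
      (O.copowerComp M t a b)
    rw [O.pt_comp M x y] at h3
    refine (Category.assoc _ _ _).symm.trans ((congrArg (· ≫ _) h3).trans ?_)
    refine (Category.assoc _ _ _).symm.trans ((congrArg (· ≫ _) h1).trans ?_)
    rw [O.pt_map M, O.assoc]
    refine Eq.trans ?_ ((congrArg (· ≫ _) h2.symm).trans (Category.assoc _ _ _))
    rw [← Category.assoc, ptTensor_whiskerLeft, ptFin_map, ← O.pt_comp M]
    congr 3
    exact funext fun i => (O.pt_comp M _ _).symm
  comp_one t a := by
    have hg := (O.generating_pt M t a).tensor
      (Generating.fin (fun _ : Fin a.len => generating_unit (M := M)))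
    refine hg _ _ fun x => ?_
    have h1 := pt_dropUnits (O.pt M x.1) a.len
    refine Eq.trans ?_ ((congrArg (· ≫ _) h1.symm).trans (Category.assoc _ _ _))
    rw [O.pt_map M, ← O.comp_one, ← O.pt_comp M, ← Category.assoc]
    refine congrArg (· ≫ _) ?_
    refine (ptTensor_whiskerLeft _ _ _).trans (congrArg _ ?_)
    refine (ptFin_map _ _).trans (congrArg _ ?_)
    exact funext fun i => Category.id_comp _
  one_comp t a := by
    have hg := (generating_unit (M := M)).tensor
      (Generating.fin (fun _ : Fin 1 => O.generating_pt M t a))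
    refine hg _ _ ?_
    rintro ⟨-, x⟩
    obtain ⟨x, rfl⟩ : ∃ y, x = fun _ => y := ⟨x 0, funext fun i => by rw [Subsingleton.elim i 0]⟩
    have h1 := pt_dropUnit (O.pt M x)
    refine Eq.trans ?_ ((congrArg (· ≫ _) h1.symm).trans (Category.assoc _ _ _))
    refine Eq.trans ?_ ((congrArg _ (O.one_comp x)).trans (O.pt_map M _ _).symm)
    refine (Category.assoc _ _ _).symm.trans ?_
    have h2 := O.pt_comp M (a := Profile.single t) (b := fun _ => a) (O.one t) fun _ => x
    refine Eq.trans (congrArg (· ≫ _) ?_) h2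
    exact (ptTensor_whiskerRight _ _ _).trans (congrArg (fun z => ptTensor z _) (Category.id_comp _))

end SetOperad

end BaseChange

section Naturality

variable {M : Type u} [Category.{v} M] [MonoidalCategory M]

/-- The action of a tensor expression on morphisms. -/
def wordMap {ι : Type w} {X Y : ι → M} (f : ∀ i, X i ⟶ Y i) :
    (a : TensorWord ι) → (a.eval X ⟶ a.eval Y)
  | .unit => 𝟙 (𝟙_ M)
  | .letter i => f i
  | .mul a b => wordMap f a ⊗ₘ wordMap f b
  | .nary _ a => tensorFinMap (fun i => wordMap f (a i))

/-- The action of `tensorList` on morphisms. -/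
def listMap {ι : Type w} {X Y : ι → M} (f : ∀ i, X i ⟶ Y i) :
    (l : List ι) → (tensorList X l ⟶ tensorList Y l)
  | [] => 𝟙 (𝟙_ M)
  | i :: l => f i ⊗ₘ listMap f l

theorem listMap_eqToHom {ι : Type w} {X Y : ι → M} (f : ∀ i, X i ⟶ Y i) {l l' : List ι}
    (h : l = l') (h1 : tensorList X l = tensorList X l') (h2 : tensorList Y l = tensorList Y l') :
    listMap f l ≫ eqToHom h2 = eqToHom h1 ≫ listMap f l' := by
  subst h
  simp

theorem listMap_append {ι : Type w} {X Y : ι → M} (f : ∀ i, X i ⟶ Y i) : (l l' : List ι) →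
    listMap f (l ++ l') ≫ (appendIso Y l l').hom =
      (appendIso X l l').hom ≫ (listMap f l ⊗ₘ listMap f l')
  | [], l' => by
    show listMap f l' ≫ (λ_ _).inv = (λ_ _).inv ≫ (𝟙 (𝟙_ M) ⊗ₘ listMap f l')
    simp
  | i :: l, l' => by
    show (f i ⊗ₘ listMap f (l ++ l')) ≫ (Y i ◁ (appendIso Y l l').hom) ≫ (α_ _ _ _).inv =
      ((X i ◁ (appendIso X l l').hom) ≫ (α_ _ _ _).inv) ≫ ((f i ⊗ₘ listMap f l) ⊗ₘ listMap f l')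
    rw [← Category.assoc, tensorHom_comp_whiskerLeft, listMap_append, Category.assoc,
      ← associator_inv_naturality, ← Category.assoc, whiskerLeft_comp_tensorHom]

theorem listMap_append_inv {ι : Type w} {X Y : ι → M} (f : ∀ i, X i ⟶ Y i) (l l' : List ι) :
    (listMap f l ⊗ₘ listMap f l') ≫ (appendIso Y l l').inv =
      (appendIso X l l').inv ≫ listMap f (l ++ l') := by
  rw [Iso.comp_inv_eq, Category.assoc, listMap_append, Iso.inv_hom_id_assoc]

theorem listMap_concat {ι : Type w} {X Y : ι → M} (f : ∀ i, X i ⟶ Y i) : {n : ℕ} →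
    (l : Fin n → List ι) →
    tensorFinMap (fun i => listMap f (l i)) ≫ (concatIso Y l).hom =
      (concatIso X l).hom ≫ listMap f (concatLists l)
  | 0, _ => rfl
  | _ + 1, l => by
    show (listMap f (l 0) ⊗ₘ tensorFinMap (fun i => listMap f (l (Fin.succ i)))) ≫
      (_ ◁ (concatIso Y (fun i => l (Fin.succ i))).hom) ≫ (appendIso Y _ _).inv =
      ((_ ◁ (concatIso X (fun i => l (Fin.succ i))).hom) ≫ (appendIso X _ _).inv) ≫
        listMap f (l 0 ++ concatLists (fun i => l (Fin.succ i)))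
    rw [← Category.assoc, tensorHom_comp_whiskerLeft, listMap_concat, Category.assoc,
      ← listMap_append_inv, ← Category.assoc, whiskerLeft_comp_tensorHom]

theorem wordMap_norm {ι : Type w} {X Y : ι → M} (f : ∀ i, X i ⟶ Y i) : (a : TensorWord ι) →
    wordMap f a ≫ (a.normIso Y).hom = (a.normIso X).hom ≫ listMap f a.letters
  | .unit => rfl
  | .letter i => by
    show f i ≫ (ρ_ _).inv = (ρ_ _).inv ≫ (f i ⊗ₘ 𝟙 (𝟙_ M))
    simp
  | .mul a b => by
    show (wordMap f a ⊗ₘ wordMap f b) ≫ ((a.normIso Y).hom ⊗ₘ (b.normIso Y).hom) ≫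
      (appendIso Y _ _).inv = (((a.normIso X).hom ⊗ₘ (b.normIso X).hom) ≫
      (appendIso X _ _).inv) ≫ listMap f (a.letters ++ b.letters)
    rw [← Category.assoc, tensorHom_comp_tensorHom, wordMap_norm f a, wordMap_norm f b,
      Category.assoc, ← listMap_append_inv, ← tensorHom_comp_tensorHom, Category.assoc]
  | .nary _ a => by
    show tensorFinMap (fun i => wordMap f (a i)) ≫ tensorFinMap (fun i => ((a i).normIso Y).hom) ≫
      (concatIso Y _).hom = (tensorFinMap (fun i => ((a i).normIso X).hom) ≫ (concatIso X _).hom) ≫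
        listMap f (concatLists fun i => (a i).letters)
    rw [← Category.assoc, ← tensorFinMap_comp, Category.assoc, ← listMap_concat, ← Category.assoc,
      ← tensorFinMap_comp]
    congr 2
    exact funext fun i => wordMap_norm f (a i)

variable [SymmetricCategory M]

theorem listMap_bring {ι : Type w} [DecidableEq ι] {X Y : ι → M} (f : ∀ i, X i ⟶ Y i) (i : ι) :
    (l : List ι) → (h : i ∈ l) →
    listMap f l ≫ (bringIso Y i l h).hom = (bringIso X i l h).hom ≫ (f i ⊗ₘ listMap f (l.erase i))
  | [], h => absurd h List.not_mem_nil
  | j :: l, h => by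
    by_cases e : j = i
    · subst e
      rw [bringIso, bringIso, dif_pos rfl, dif_pos rfl]
      exact listMap_eqToHom f (l := j :: l) (l' := j :: ((j :: l).erase j)) (by simp)
        (by simp) (by simp)
    · rw [bringIso, bringIso, dif_neg e, dif_neg e]
      have hE : ∀ Z : ι → M, Z i ⊗ Z j ⊗ tensorList Z (l.erase i) =
          Z i ⊗ tensorList Z ((j :: l).erase i) := fun Z => by
        rw [List.erase_cons_tail (by simpa using e)]; rfl
      show (f j ⊗ₘ listMap f l) ≫ (Y j ◁ (bringIso Y i l _).hom) ≫ (α_ _ _ _).inv ≫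
        ((β_ (Y j) (Y i)).hom ▷ _) ≫ (α_ _ _ _).hom ≫ eqToHom (hE Y) =
        ((X j ◁ (bringIso X i l _).hom) ≫ (α_ _ _ _).inv ≫
        ((β_ (X j) (X i)).hom ▷ _) ≫ (α_ _ _ _).hom ≫ eqToHom (hE X)) ≫ _
      have h5 := listMap_eqToHom f (l := i :: (j :: l.erase i)) (l' := i :: ((j :: l).erase i))
        (by rw [List.erase_cons_tail (by simpa using e)]) (hE X) (hE Y)
      have h5' : (f i ⊗ₘ f j ⊗ₘ listMap f (l.erase i)) ≫ eqToHom (hE Y) =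
        eqToHom (hE X) ≫ (f i ⊗ₘ listMap f ((j :: l).erase i)) := h5
      rw [← Category.assoc, tensorHom_comp_whiskerLeft, listMap_bring f i l]
      simp only [Category.assoc]
      rw [← h5', ← associator_naturality_assoc, ← tensorHom_id (β_ (X j) (X i)).hom,
        tensorHom_comp_tensorHom_assoc, ← BraidedCategory.braiding_naturality, Category.id_comp]
      have h6 : ((f j ⊗ₘ f i) ≫ (β_ (Y j) (Y i)).hom ⊗ₘ listMap f (l.erase i)) =
        ((f j ⊗ₘ f i) ⊗ₘ listMap f (l.erase i)) ≫ ((β_ (Y j) (Y i)).hom ▷ _) := by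
        rw [tensorHom_comp_whiskerRight]
      rw [h6, Category.assoc, ← associator_inv_naturality_assoc, whiskerLeft_comp_tensorHom_assoc]

theorem listMap_reorder {ι : Type w} [DecidableEq ι] {X Y : ι → M} (f : ∀ i, X i ⟶ Y i) :
    (l l' : List ι) → (h : l.Perm l') →
    listMap f l ≫ (reorderIso Y l l' h).hom = (reorderIso X l l' h).hom ≫ listMap f l'
  | l, [], h => listMap_eqToHom f (List.perm_nil.1 h) (by rw [List.perm_nil.1 h])
      (by rw [List.perm_nil.1 h])
  | l, i :: l', h => by
    rw [reorderIso, reorderIso]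
    show listMap f l ≫ (bringIso Y i l _).hom ≫ (Y i ◁ (reorderIso Y (l.erase i) l' _).hom) =
      ((bringIso X i l _).hom ≫ (X i ◁ (reorderIso X (l.erase i) l' _).hom)) ≫
        (f i ⊗ₘ listMap f l')
    rw [← Category.assoc, listMap_bring, Category.assoc, Category.assoc, tensorHom_comp_whiskerLeft,
      whiskerLeft_comp_tensorHom, listMap_reorder]

theorem wordMap_canon {ι : Type w} [DecidableEq ι] {X Y : ι → M} (f : ∀ i, X i ⟶ Y i)
    (a b : TensorWord ι) (h : a.letters.Perm b.letters) :
    wordMap f a ≫ (canonIso Y a b h).hom = (canonIso X a b h).hom ≫ wordMap f b := by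
  simp only [canonIso, Iso.trans_hom, Iso.symm_hom]
  rw [← Category.assoc, wordMap_norm, Category.assoc, ← Category.assoc (listMap f a.letters),
    listMap_reorder]
  simp only [Category.assoc]
  congr 2
  rw [Iso.comp_inv_eq, Category.assoc, wordMap_norm, Iso.inv_hom_id_assoc]

theorem unshuffle_natural {m N : ℕ} {k : Fin m → ℕ} (e : Fin N ≃ (i : Fin m) × Fin (k i))
    {P P' : M} {X X' : Fin m → M} {Y Y' : ∀ i, Fin (k i) → M} (p : P ⟶ P')
    (x : ∀ i, X i ⟶ X' i) (y : ∀ i j, Y i j ⟶ Y' i j) :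
    ((p ⊗ₘ tensorFinMap x) ⊗ₘ tensorFinMap (fun q => y (e q).1 (e q).2)) ≫ unshuffle e P' X' Y' =
      unshuffle e P X Y ≫ (p ⊗ₘ tensorFinMap (fun i => x i ⊗ₘ tensorFinMap (y i))) :=
  wordMap_canon (X := factor P X Y) (Y := factor P' X' Y')
    (fun n => match n with
      | .inl _ => p
      | .inr (.inl i) => x i
      | .inr (.inr z) => y z.1 z.2) (outerWord e) (innerWord k) (outerWord_perm e)

end Naturality

section Algebras

variable {M : Type u} [Category.{v} M] [MonoidalCategory M] [SymmetricCategory M]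

/-- An algebra over a colored operad `O`: an object `carrier t` for every color, and action maps
`act t a : O(t; a) ⊗ carrier (a 1) ⊗ ⋯ ⊗ carrier (a n) ⟶ carrier t` which are equivariant,
associative and unital. -/
structure OperadAlgebra {𝔠 : Type w} (O : ColoredOperad M 𝔠) where
  carrier : 𝔠 → M
  act : ∀ (t : 𝔠) (a : Profile 𝔠),
    (O.obj t).obj a ⊗ tensorFin (fun i => carrier (a.col i)) ⟶ carrier t
  act_perm : ∀ (t : 𝔠) (a : Profile 𝔠) (σ : Equiv.Perm (Fin a.len)),
    ((O.obj t).map (a.permHom σ) ⊗ₘ permFin (fun i => carrier (a.col i)) σ) ≫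
      act t (a.permute σ) = act t a
  act_comp : ∀ (t : 𝔠) (a : Profile 𝔠) (b : Fin a.len → Profile 𝔠),
    (O.comp t a b ▷ tensorFin (fun p : Fin (Profile.concat b).len =>
        carrier ((b (Profile.split b p).1).col (Profile.split b p).2))) ≫
        act t (Profile.concat b) =
      unshuffle (Profile.split b) ((O.obj t).obj a) (fun i => (O.obj (a.col i)).obj (b i))
          (fun i j => carrier ((b i).col j)) ≫
        ((O.obj t).obj a ◁ tensorFinMap (fun i => act (a.col i) (b i))) ≫ act t a
  act_one : ∀ t : 𝔠,
    (O.one t ▷ tensorFin (fun _ : Fin 1 => carrier t)) ≫ act t (Profile.single t) =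
      dropUnit (carrier t)

namespace OperadAlgebra

variable {𝔠 : Type w} {O : ColoredOperad M 𝔠}

/-- A morphism of algebras: a family of morphisms compatible with the actions. -/
@[ext]
structure Hom (A B : OperadAlgebra O) where
  app : ∀ t : 𝔠, A.carrier t ⟶ B.carrier t
  act_app : ∀ (t : 𝔠) (a : Profile 𝔠),
    A.act t a ≫ app t = ((O.obj t).obj a ◁ tensorFinMap (fun i => app (a.col i))) ≫ B.act t a

/-- The category of algebras over a colored operad. -/
instance category : Category (OperadAlgebra O) where
  Hom := Hom
  id A := ⟨fun t => 𝟙 (A.carrier t), fun t a => by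
    rw [tensorFinMap_id, MonoidalCategory.whiskerLeft_id, Category.id_comp, Category.comp_id]⟩
  comp f g := ⟨fun t => f.app t ≫ g.app t, fun t a => by
    rw [← Category.assoc, f.act_app, Category.assoc, g.act_app, tensorFinMap_comp,
      MonoidalCategory.whiskerLeft_comp, Category.assoc]⟩
  id_comp f := Hom.ext (funext fun t => Category.id_comp (f.app t))
  comp_id f := Hom.ext (funext fun t => Category.comp_id (f.app t))
  assoc f g h := Hom.ext (funext fun t => Category.assoc (f.app t) (g.app t) (h.app t))

theorem ext_of_act {A B : OperadAlgebra O} (h : A.carrier = B.carrier)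
    (h' : ∀ t a, HEq (A.act t a) (B.act t a)) : A = B := by
  obtain ⟨A, α, _, _, _⟩ := A
  obtain ⟨B, β, _, _, _⟩ := B
  dsimp only at h
  subst h
  have e : α = β := funext fun t => funext fun a => eq_of_heq (h' t a)
  subst e
  rfl

theorem hom_heq {A A' B B' : OperadAlgebra O} (hA : A = A') (hB : B = B') (f : A ⟶ B)
    (f' : A' ⟶ B') (h : ∀ t, HEq (Hom.app f t) (Hom.app f' t)) : HEq f f' := by
  subst hA hB
  exact heq_of_eq (Hom.ext (funext fun t => eq_of_heq (h t)))

end OperadAlgebra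

variable (M) in
/-- A colored operad with values in `M`, together with its set of colors. -/
structure OpCat where
  color : Type v
  operad : ColoredOperad M color

namespace OpCat

/-- A morphism of colored operads: a map of colors and a family of morphisms, compatible with
permutations, compositions and units. -/
structure Hom (O P : OpCat M) where
  onColor : O.color → P.color
  app : ∀ (t : O.color) (a : Profile O.color),
    (O.operad.obj t).obj a ⟶ (P.operad.obj (onColor t)).obj (a.mapColor onColor)
  naturality : ∀ (t : O.color) {a b : Profile O.color} (σ : a ⟶ b),
    (O.operad.obj t).map σ ≫ app t b =
      app t a ≫ (P.operad.obj (onColor t)).map (Profile.mapColorHom onColor σ)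
  comp_app : ∀ (t : O.color) (a : Profile O.color) (b : Fin a.len → Profile O.color),
    O.operad.comp t a b ≫ app t (Profile.concat b) =
      (app t a ⊗ₘ tensorFinMap (fun i => app (a.col i) (b i))) ≫
        P.operad.comp (onColor t) (a.mapColor onColor) (fun i => (b i).mapColor onColor)
  one_app : ∀ t : O.color,
    O.operad.one t ≫ app t (Profile.single t) = P.operad.one (onColor t)

theorem Hom.ext_of_app {O P : OpCat M} {F G : Hom O P} (h : F.onColor = G.onColor)
    (h' : ∀ t a, HEq (F.app t a) (G.app t a)) : F = G := by
  obtain ⟨f, φ, _, _, _⟩ := F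
  obtain ⟨g, ψ, _, _, _⟩ := G
  dsimp only at h
  subst h
  have e : φ = ψ := funext fun t => funext fun a => eq_of_heq (h' t a)
  subst e
  rfl

/-- The category of colored operads with values in `M`, with varying sets of colors. -/
instance category : Category (OpCat M) where
  Hom := Hom
  id O := 
    { onColor := fun t => t
      app := fun t a => 𝟙 ((O.operad.obj t).obj a)
      naturality := fun t a b σ => (Category.comp_id _).trans (Category.id_comp _).symm
      comp_app := fun t a b => by
        rw [tensorFinMap_id, id_tensorHom_id, Category.comp_id, Category.id_comp]
      one_app := fun t => Category.comp_id _ }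
  comp {O P Q} F G :=
    { onColor := fun t => G.onColor (F.onColor t)
      app := fun t a => F.app t a ≫ G.app (F.onColor t) (a.mapColor F.onColor)
      naturality := fun t a b σ => by
        rw [← Category.assoc, F.naturality, Category.assoc, G.naturality, Category.assoc]
        rfl
      comp_app := fun t a b => by
        rw [← Category.assoc, F.comp_app, Category.assoc, tensorFinMap_comp]
        have := G.comp_app (F.onColor t) (a.mapColor F.onColor) (fun i => (b i).mapColor F.onColor)
        refine (congrArg (_ ≫ ·) this).trans ?_
        refine (Category.assoc _ _ _).symm.trans (congrArg (· ≫ _) ?_)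
        exact tensorHom_comp_tensorHom _ _ _ _
      one_app := fun t => by
        rw [← Category.assoc, F.one_app]
        exact G.one_app _ }
  id_comp F := Hom.ext_of_app rfl fun t a => heq_of_eq (Category.id_comp _)
  comp_id F := Hom.ext_of_app rfl fun t a => heq_of_eq (Category.comp_id _)
  assoc F G H := Hom.ext_of_app rfl fun t a => heq_of_eq (Category.assoc _ _ _)

/-- Pullback of an algebra along a morphism of colored operads. -/
def pullbackObj {O P : OpCat M} (F : O ⟶ P) (A : OperadAlgebra P.operad) :
    OperadAlgebra O.operad where
  carrier t := A.carrier (F.onColor t)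
  act t a := (F.app t a ▷ _) ≫ A.act (F.onColor t) (a.mapColor F.onColor)
  act_perm t a σ := by
    have h := A.act_perm (F.onColor t) (a.mapColor F.onColor) σ
    refine Eq.trans ?_ (congrArg (_ ≫ ·) h)
    refine (Category.assoc _ _ _).symm.trans (Eq.trans (congrArg (· ≫ _) ?_) (Category.assoc _ _ _))
    refine (tensorHom_comp_whiskerRight _ _ _).trans (Eq.trans ?_ (whiskerRight_comp_tensorHom _ _ _).symm)
    exact congrArg (· ⊗ₘ _) (F.naturality t (a.permHom σ))
  act_comp t a b := by
    have h := A.act_comp (F.onColor t) (a.mapColor F.onColor) (fun i => (b i).mapColor F.onColor)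
    have h1 := unshuffle_natural (Profile.split b) (F.app t a) (fun i => F.app (a.col i) (b i))
      (fun i j => 𝟙 (A.carrier (F.onColor ((b i).col j))))
    simp only [tensorFinMap_id, tensorHom_id] at h1
    have h2 := F.comp_app t a b
    have h3 : (O.operad.comp t a b ▷ _) ≫ (F.app t (Profile.concat b) ▷ _) =
        ((F.app t a ⊗ₘ tensorFinMap (fun i => F.app (a.col i) (b i))) ▷ _) ≫
        (P.operad.comp (F.onColor t) (a.mapColor F.onColor)
          (fun i => (b i).mapColor F.onColor) ▷ tensorFin (fun p : Fin (Profile.concat b).len =>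
        A.carrier (F.onColor ((b (Profile.split b p).1).col (Profile.split b p).2)))) :=
      (comp_whiskerRight _ _ _).symm.trans ((congrArg (· ▷ _) h2).trans (comp_whiskerRight _ _ _))
    refine (Category.assoc _ _ _).symm.trans ((congrArg (· ≫ _) h3).trans ?_)
    refine (Category.assoc _ _ _).trans ((congrArg (_ ≫ ·) h).trans ?_)
    refine (Category.assoc _ _ _).symm.trans ((congrArg (· ≫ _) h1).trans ?_)
    refine (Category.assoc _ _ _).trans (congrArg (_ ≫ ·) ?_)
    rw [tensorFinMap_comp]
    refine (Category.assoc _ _ _).symm.trans (Eq.trans (congrArg (· ≫ _) ?_) (Category.assoc _ _ _))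
    rw [← id_tensorHom, ← tensorHom_id (F.app t a), tensorHom_comp_tensorHom, Category.comp_id]
    refine Eq.symm ((congrArg (· ≫ _) (id_tensorHom _ _).symm).trans ?_)
    refine (tensorHom_comp_tensorHom _ _ _ _).trans ?_
    rw [Category.comp_id, Category.id_comp]
  act_one t := by
    have h := A.act_one (F.onColor t)
    refine Eq.trans ?_ h
    refine (Category.assoc _ _ _).symm.trans (congrArg (· ≫ _) ?_)
    rw [← comp_whiskerRight]
    exact congrArg (· ▷ _) (F.one_app t)

/-- Pullback of algebras along a morphism of colored operads. -/
def pullback {O P : OpCat M} (F : O ⟶ P) : OperadAlgebra P.operad ⥤ OperadAlgebra O.operad where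
  obj A := pullbackObj F A
  map {A B} g :=
    { app := fun t => g.app (F.onColor t)
      act_app := fun t a => by
        have h := g.act_app (F.onColor t) (a.mapColor F.onColor)
        refine (Category.assoc _ _ _).trans ((congrArg (_ ≫ ·) h).trans ?_)
        refine (Category.assoc _ _ _).symm.trans (Eq.trans (congrArg (· ≫ _) ?_)
          (Category.assoc _ _ _))
        exact (whisker_exchange _ _).symm }
  map_id _ := rfl
  map_comp _ _ := rfl

theorem pullbackObj_id (O : OpCat M) (A : OperadAlgebra O.operad) : pullbackObj (𝟙 O) A = A :=
  OperadAlgebra.ext_of_act rfl fun t a => heq_of_eq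
    ((congrArg (· ≫ A.act t a) (id_whiskerRight _ _)).trans (Category.id_comp _))

theorem pullbackObj_comp {O P Q : OpCat M} (F : O ⟶ P) (G : P ⟶ Q)
    (A : OperadAlgebra Q.operad) : pullbackObj (F ≫ G) A = pullbackObj F (pullbackObj G A) :=
  OperadAlgebra.ext_of_act rfl fun _ _ => heq_of_eq
    ((congrArg (· ≫ _) (comp_whiskerRight _ _ _)).trans (Category.assoc _ _ _))

theorem pullback_id (O : OpCat M) : pullback (𝟙 O) = 𝟭 (OperadAlgebra O.operad) :=
  CategoryTheory.Functor.hext (fun A => pullbackObj_id O A) fun A B _ =>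
    OperadAlgebra.hom_heq (pullbackObj_id O A) (pullbackObj_id O B) _ _ fun _ => HEq.rfl

theorem pullback_comp {O P Q : OpCat M} (F : O ⟶ P) (G : P ⟶ Q) :
    pullback (F ≫ G) = pullback G ⋙ pullback F :=
  CategoryTheory.Functor.hext (fun A => pullbackObj_comp F G A) fun A B _ =>
    OperadAlgebra.hom_heq (pullbackObj_comp F G A) (pullbackObj_comp F G B) _ _ fun _ => HEq.rfl

variable (M) in
/-- The functor which assigns to a colored operad its category of algebras, and to a morphism of
colored operads the pullback of algebras. -/
def algebras : (OpCat.{v} M)ᵒᵖ ⥤ Cat.{v, max u v} where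
  obj O := Cat.of (OperadAlgebra O.unop.operad)
  map F := (pullback F.unop).toCatHom
  map_id O := Cat.Hom.ext (pullback_id O.unop)
  map_comp F G := Cat.Hom.ext (pullback_comp G.unop F.unop)

end OpCat

end Algebras

section OrthogonalCategories

/-- An orthogonal category: a small category with a set of pairs of orthogonal morphisms with a
common target, which is symmetric and stable under postcomposition and precomposition. -/
structure OrthCat : Type (v + 1) where
  carrier : Type v
  [category : SmallCategory carrier]
  orth : ∀ {c₁ c₂ c : carrier}, (c₁ ⟶ c) → (c₂ ⟶ c) → Prop
  symm : ∀ {c₁ c₂ c : carrier} (f₁ : c₁ ⟶ c) (f₂ : c₂ ⟶ c), orth f₁ f₂ → orth f₂ f₁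
  postcomp : ∀ {c₁ c₂ c d : carrier} (f₁ : c₁ ⟶ c) (f₂ : c₂ ⟶ c) (g : c ⟶ d),
    orth f₁ f₂ → orth (f₁ ≫ g) (f₂ ≫ g)
  precomp : ∀ {b₁ b₂ c₁ c₂ c : carrier} (h₁ : b₁ ⟶ c₁) (h₂ : b₂ ⟶ c₂) (f₁ : c₁ ⟶ c)
    (f₂ : c₂ ⟶ c), orth f₁ f₂ → orth (h₁ ≫ f₁) (h₂ ≫ f₂)

namespace OrthCat

attribute [instance] OrthCat.category

/-- An orthogonal functor: a functor which preserves orthogonal pairs. -/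
structure Hom (C D : OrthCat.{v}) where
  functor : C.carrier ⥤ D.carrier
  map_orth : ∀ {c₁ c₂ c : C.carrier} (f₁ : c₁ ⟶ c) (f₂ : c₂ ⟶ c), C.orth f₁ f₂ →
    D.orth (functor.map f₁) (functor.map f₂)

/-- The category of orthogonal categories and orthogonal functors. -/
instance catOrthCat : Category OrthCat.{v} where
  Hom := Hom
  id C := ⟨𝟭 C.carrier, fun _ _ h => h⟩
  comp F G := ⟨F.functor ⋙ G.functor, fun f₁ f₂ h => G.map_orth _ _ (F.map_orth f₁ f₂ h)⟩

end OrthCat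

/-- The operations of the operad `O_C`: pairs of a permutation and a family of morphisms with target
`t`. -/
@[ext]
structure PermOp (C : Type v) [SmallCategory C] (t : C) (c : Profile C) where
  perm : Equiv.Perm (Fin c.len)
  hom : ∀ i, c.col i ⟶ t

theorem Profile.len_eq {𝔠 : Type w} {c d : Profile 𝔠} (σ : c ⟶ d) : c.len = d.len := by
  simpa using (Fintype.card_congr (Profile.Hom.perm σ)).symm

theorem Profile.len_concat_perm {𝔠 : Type w} {m : ℕ} (b : Fin m → Profile 𝔠)
    (σ : Equiv.Perm (Fin m)) :
    (Profile.concat fun i => b (σ i)).len = (Profile.concat b).len :=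
  Equiv.sum_comp σ fun i => (b i).len

/-- The operadic composition of permutations `σ` and `τ 1, …, τ m`: the `j`-th entry of the `i`-th
block is sent to the `τ i j`-th entry of the `σ i`-th block, where the new blocks have the sizes
`k (σ⁻¹ 1), …, k (σ⁻¹ m)`. -/
def operadicPerm {𝔠 : Type w} {m : ℕ} (b : Fin m → Profile 𝔠) (σ : Equiv.Perm (Fin m))
    (τ : ∀ i, Equiv.Perm (Fin (b i).len)) : Equiv.Perm (Fin (Profile.concat b).len) :=
  (Profile.split b).trans ((Equiv.sigmaCongrRight τ).trans
    ((Equiv.sigmaCongrLeft (β := fun i => Fin (b i).len) σ.symm).symm.trans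
      ((Profile.split fun i => b (σ.symm i)).symm.trans
        (finCongr (Profile.len_concat_perm b σ.symm)))))

theorem fin_perm_ext {n : ℕ} {σ τ : Equiv.Perm (Fin n)} (h : ∀ i j, σ i < σ j ↔ τ i < τ j) :
    σ = τ := by
  have key : ∀ i, τ (σ.symm i) = i := by
    have mono : StrictMono (fun i => τ (σ.symm i)) := fun i j hij => by
      rw [← h]; simpa using hij
    intro i
    have := (Subsingleton.elim (OrderIso.refl (Fin n))
      (mono.orderIsoOfSurjective _ (τ.surjective.comp σ.symm.surjective)) )
    exact (congrArg (fun e : Fin n ≃o Fin n => e i) this).symm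
  ext i
  have := key (σ i)
  rw [Equiv.symm_apply_apply] at this
  rw [this]

theorem split_symm_lt {𝔠 : Type w} {m : ℕ} (b : Fin m → Profile 𝔠)
    (x y : (i : Fin m) × Fin (b i).len) :
    (Profile.split b).symm x < (Profile.split b).symm y ↔
      x.1 < y.1 ∨ (x.1 = y.1 ∧ (x.2 : ℕ) < y.2) := by
  let g : ℕ → ℕ := fun i => if h : i < m then (b ⟨i, h⟩).len else 0
  have hv : ∀ z : (i : Fin m) × Fin (b i).len,
      ((Profile.split b).symm z : ℕ) = ∑ i ∈ Finset.range z.1, g i + z.2 := by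
    intro z
    refine (finSigmaFinEquiv_apply z).trans (congrArg (· + (z.2 : ℕ)) ?_)
    rw [← Fin.sum_univ_eq_sum_range]
    refine Finset.sum_congr rfl fun i _ => ?_
    simp only [g]
    rw [dif_pos (lt_of_lt_of_le i.2 z.1.2.le)]
    rfl
  have key : ∀ z z' : (i : Fin m) × Fin (b i).len, z.1 < z'.1 →
      ((Profile.split b).symm z : ℕ) < (Profile.split b).symm z' := by
    intro z z' h
    rw [hv, hv]
    have h1 : g z.1 = (b z.1).len := by simp [g]
    have h2 : ∑ i ∈ Finset.range (z.1 + 1), g i ≤ ∑ i ∈ Finset.range z'.1, g i :=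
      Finset.sum_le_sum_of_subset (Finset.range_mono h)
    rw [Finset.sum_range_succ] at h2
    have := z.2.2
    omega
  rw [Fin.lt_def]
  rcases lt_trichotomy x.1 y.1 with h | h | h
  · exact ⟨fun _ => Or.inl h, fun _ => key _ _ h⟩
  · have e : ∑ i ∈ Finset.range (x.1 : ℕ), g i = ∑ i ∈ Finset.range (y.1 : ℕ), g i := by rw [h]
    rw [hv, hv, e]
    simp [h]
  · constructor
    · intro h'
      exact absurd (key _ _ h) (not_lt.2 h'.le)
    · rintro (h' | h')
      · exact absurd h (not_lt.2 h'.le)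
      · exact absurd h'.1 h.ne'

theorem operadicPerm_lt {𝔠 : Type w} {m : ℕ} (b : Fin m → Profile 𝔠) (σ : Equiv.Perm (Fin m))
    (τ : ∀ i, Equiv.Perm (Fin (b i).len)) (x y : (i : Fin m) × Fin (b i).len) :
    operadicPerm b σ τ ((Profile.split b).symm x) < operadicPerm b σ τ ((Profile.split b).symm y) ↔
      σ x.1 < σ y.1 ∨ (x.1 = y.1 ∧ (τ x.1 x.2 : ℕ) < τ y.1 y.2) := by
  have hf : ∀ {n n' : ℕ} (h : n = n') (p q : Fin n), finCongr h p < finCongr h q ↔ p < q :=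
    fun h p q => by subst h; rfl
  have hs : ∀ z : (i : Fin m) × Fin (b i).len,
      ((Equiv.sigmaCongrLeft (β := fun i => Fin (b i).len) σ.symm).symm z).1 = σ z.1 ∧
      (((Equiv.sigmaCongrLeft (β := fun i => Fin (b i).len) σ.symm).symm z).2 : ℕ) = z.2 := by
    intro z
    obtain ⟨y, rfl⟩ := (Equiv.sigmaCongrLeft (β := fun i => Fin (b i).len) σ.symm).surjective z
    rw [Equiv.symm_apply_apply]
    exact ⟨(σ.apply_symm_apply y.1).symm, rfl⟩
  simp only [operadicPerm, Equiv.trans_apply, Equiv.apply_symm_apply]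
  rw [hf, split_symm_lt]
  simp only [hs]
  show σ x.1 < σ y.1 ∨ (σ x.1 = σ y.1 ∧ _) ↔ _
  rw [σ.injective.eq_iff]
  rfl

namespace PermOp

variable {C : Type v} [SmallCategory C] {t : C}

/-- The right action of permutations: `(σ, f) σ' = (σ σ', f σ')`. -/
def map {c d : Profile C} (σ : c ⟶ d) (x : PermOp C t c) : PermOp C t d where
  perm := (Profile.Hom.perm σ).trans (x.perm.trans (finCongr (Profile.len_eq σ)))
  hom i := eqToHom (Profile.Hom.col_eq σ i) ≫ x.hom (Profile.Hom.perm σ i)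

/-- The operadic composition: permutations are composed operadically, and morphisms are composed in
the category. -/
def comp {a : Profile C} {b : Fin a.len → Profile C} (x : PermOp C t a)
    (y : ∀ i, PermOp C (a.col i) (b i)) : PermOp C t (Profile.concat b) where
  perm := operadicPerm b x.perm fun i => (y i).perm
  hom p := (y (Profile.split b p).1).hom (Profile.split b p).2 ≫ x.hom (Profile.split b p).1

/-- The operadic unit. -/
def one (t : C) : PermOp C t (Profile.single t) where
  perm := Equiv.refl _
  hom _ := 𝟙 t

theorem ext_of_lt {c : Profile C} {x y : PermOp C t c}
    (h : ∀ i j, x.perm i < x.perm j ↔ y.perm i < y.perm j) (h' : ∀ i, x.hom i = y.hom i) : x = y :=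
  PermOp.ext (fin_perm_ext h) (funext h')

theorem map_lt {c d : Profile C} (σ : c ⟶ d) (x : PermOp C t c) (i j : Fin d.len) :
    (map σ x).perm i < (map σ x).perm j ↔
      x.perm (Profile.Hom.perm σ i) < x.perm (Profile.Hom.perm σ j) := by
  have hf : ∀ {n n' : ℕ} (h : n = n') (p q : Fin n), finCongr h p < finCongr h q ↔ p < q :=
    fun h p q => by subst h; rfl
  exact hf (Profile.len_eq σ) _ _

theorem comp_lt {a : Profile C} {b : Fin a.len → Profile C} (x : PermOp C t a)
    (y : ∀ i, PermOp C (a.col i) (b i)) {p q : Fin (Profile.concat b).len}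
    {z w : (i : Fin a.len) × Fin (b i).len} (hp : Profile.split b p = z)
    (hq : Profile.split b q = w) :
    (comp x y).perm p < (comp x y).perm q ↔ x.perm z.1 < x.perm w.1 ∨
      (z.1 = w.1 ∧ ((y z.1).perm z.2 : ℕ) < (y w.1).perm w.2) := by
  subst hp hq
  have := operadicPerm_lt b x.perm (fun i => (y i).perm) (Profile.split b p) (Profile.split b q)
  rw [Equiv.symm_apply_apply, Equiv.symm_apply_apply] at this
  exact this

theorem eqToHom_hom {K : Type w} {c : K → C} (F : ∀ k, c k ⟶ t) {k l : K} (h : k = l)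
    (h' : c l = c k) : eqToHom h' ≫ F k = F l := by
  subst h
  simp

theorem split_sigmaHom {m m' : ℕ} (b : Fin m → Profile C) (b' : Fin m' → Profile C)
    (e : ((i : Fin m') × Fin (b' i).len) ≃ ((i : Fin m) × Fin (b i).len))
    (h : ∀ x, (b' x.1).col x.2 = (b (e x).1).col (e x).2) (p : Fin (Profile.concat b').len) :
    Profile.split b (Profile.Hom.perm (Profile.sigmaHom b b' e h) p) = e (Profile.split b' p) :=
  Equiv.apply_symm_apply _ _

theorem comp_hom {a : Profile C} {b : Fin a.len → Profile C} (x : PermOp C t a)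
    (y : ∀ i, PermOp C (a.col i) (b i)) (p : Fin (Profile.concat b).len)
    (z : (i : Fin a.len) × Fin (b i).len) (h : Profile.split b p = z)
    (h' : (b z.1).col z.2 = (Profile.concat b).col p) :
    eqToHom h' ≫ (comp x y).hom p = (y z.1).hom z.2 ≫ x.hom z.1 := by
  subst h
  exact Category.id_comp _

end PermOp

/-- The colored operad `O_C` in sets. -/
def permOperad (C : Type v) [SmallCategory C] : SetOperad.{v} C where
  obj t c := PermOp C t c
  map σ x := PermOp.map σ x
  map_id {t c} x := PermOp.ext_of_lt (fun i j => PermOp.map_lt _ _ _ _) fun i => Category.id_comp _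
  map_comp {t c d e} σ τ x := PermOp.ext_of_lt
    (fun i j => by rw [PermOp.map_lt, PermOp.map_lt, PermOp.map_lt]; rfl)
    fun i => by
      refine Eq.trans ?_ (Category.assoc _ _ _)
      refine Eq.trans ?_ (congrArg (· ≫ _) (eqToHom_trans _ _).symm)
      rfl
  comp x y := PermOp.comp x y
  one t := PermOp.one t
  comp_perm {t a b} σ x y := by
    have hs : ∀ p, Profile.split b (Profile.Hom.perm (Profile.blockPerm b σ) p) =
        ⟨σ (Profile.split (fun i => b (σ i)) p).1, (Profile.split (fun i => b (σ i)) p).2⟩ :=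
      fun p => PermOp.split_sigmaHom _ _ _ _ p
    refine PermOp.ext_of_lt (fun p q => ?_) fun p => ?_
    · rw [PermOp.map_lt, PermOp.comp_lt x y (hs p) (hs q)]
      refine (PermOp.comp_lt (a := a.permute σ) (b := fun i => b (σ i)) _ _ rfl rfl).trans ?_
      refine or_congr (PermOp.map_lt _ _ _ _) (and_congr ?_ Iff.rfl)
      exact σ.injective.eq_iff.symm
    · refine Eq.trans ?_ (PermOp.comp_hom x y _ _ (hs p) _).symm
      exact congrArg (_ ≫ ·) (Category.id_comp _)
  comp_blockSum {t a b b'} σ x y := by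
    have hs : ∀ p, Profile.split b (Profile.Hom.perm (Profile.blockSum σ) p) =
        ⟨(Profile.split b' p).1, Profile.Hom.perm (σ (Profile.split b' p).1)
          (Profile.split b' p).2⟩ :=
      fun p => PermOp.split_sigmaHom _ _ _ _ p
    refine PermOp.ext_of_lt (fun p q => ?_) fun p => ?_
    · rw [PermOp.map_lt, PermOp.comp_lt x y (hs p) (hs q), PermOp.comp_lt x _ rfl rfl]
      rfl
    · let G : ∀ z : (i : Fin a.len) × Fin (b i).len, (b z.1).col z.2 ⟶ t := fun z =>
        (y z.1).hom z.2 ≫ x.hom z.1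
      have h1 := PermOp.eqToHom_hom G (hs p)
        (((Profile.Hom.col_eq (σ (Profile.split b' p).1) (Profile.split b' p).2).symm.trans
          (Profile.Hom.col_eq (Profile.blockSum σ) p)))
      have h2 : (PermOp.map (Profile.blockSum σ) (PermOp.comp x y)).hom p =
          eqToHom (Profile.Hom.col_eq (Profile.blockSum σ) p) ≫
            G (Profile.split b (Profile.Hom.perm (Profile.blockSum σ) p)) := rfl
      refine Eq.trans ?_ h2.symm
      refine (Category.assoc _ _ _).trans ((congrArg (_ ≫ ·) h1.symm).trans ?_)
      exact eqToHom_trans_assoc _ _ _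
  assoc {t a b c} x y z := by
    let K := (u : (i : Fin a.len) × Fin (b i).len) × Fin (c u.1 u.2).len
    let cc : Fin (Profile.concat b).len → Profile C :=
      fun p => c (Profile.split b p).1 (Profile.split b p).2
    let Z : Fin (Profile.concat cc).len → K := fun q =>
      ⟨Profile.split b (Profile.split cc q).1, (Profile.split cc q).2⟩
    let W : ((i : Fin a.len) × Fin (Profile.concat (c i)).len) → K := fun r =>
      ⟨⟨r.1, (Profile.split (c r.1) r.2).1⟩, (Profile.split (c r.1) r.2).2⟩
    let sp := Profile.split fun i => Profile.concat (c i)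
    have hs : ∀ p, Z (Profile.Hom.perm (Profile.assocHom b c) p) = W (sp p) := fun p =>
      (congrArg (fun r : (q : Fin (Profile.concat b).len) × Fin (cc q).len =>
        (⟨Profile.split b r.1, r.2⟩ : K)) (PermOp.split_sigmaHom cc _ _ _ p)).trans
          (Profile.assocEquiv_spec b c _)
    refine PermOp.ext_of_lt (fun p q => ?_) fun p => ?_
    · let Pr : K → K → Prop := fun u v =>
        (x.perm u.1.1 < x.perm v.1.1 ∨ (u.1.1 = v.1.1 ∧
          ((y u.1.1).perm u.1.2 : ℕ) < (y v.1.1).perm v.1.2)) ∨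
        (u.1 = v.1 ∧ ((z u.1.1 u.1.2).perm u.2 : ℕ) < (z v.1.1 v.1.2).perm v.2)
      have h1 : ∀ p q, (PermOp.comp (a := Profile.concat b) (b := cc) (PermOp.comp x y)
          (fun p => z (Profile.split b p).1 (Profile.split b p).2)).perm p <
          (PermOp.comp (a := Profile.concat b) (b := cc) (PermOp.comp x y)
          (fun p => z (Profile.split b p).1 (Profile.split b p).2)).perm q ↔ Pr (Z p) (Z q) := by
        intro p q
        refine (PermOp.comp_lt (a := Profile.concat b) (b := cc) _ _ rfl rfl).trans ?_
        exact or_congr (PermOp.comp_lt x y rfl rfl)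
          (and_congr (Profile.split b).injective.eq_iff.symm Iff.rfl)
      rw [PermOp.map_lt, PermOp.comp_lt x (fun i => PermOp.comp (y i) (z i)) rfl rfl]
      refine (h1 _ _).trans ?_
      rw [hs, hs]
      change Pr (W (sp p)) (W (sp q)) ↔ x.perm (sp p).1 < x.perm (sp q).1 ∨ (sp p).1 = (sp q).1 ∧
        ((PermOp.comp (y (sp p).1) (z (sp p).1)).perm (sp p).2 : ℕ) <
          (PermOp.comp (y (sp q).1) (z (sp q).1)).perm (sp q).2
      generalize sp p = u
      generalize sp q = v
      obtain ⟨i, r⟩ := u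
      obtain ⟨i', r'⟩ := v
      by_cases e : i = i'
      · subst e
        have h2 := PermOp.comp_lt (y i) (z i) (p := r) (q := r') rfl rfl
        rw [Fin.lt_def] at h2
        simp only [h2, lt_self_iff_false, false_or, true_and, Pr, W, Sigma.mk.injEq, heq_eq_eq]
        rfl
      · simp [Pr, W, e]
    · have h1 := PermOp.comp_hom (a := Profile.concat b) (b := cc) (PermOp.comp x y)
          (fun p => z (Profile.split b p).1 (Profile.split b p).2)
      let G : ∀ u : K, (c u.1.1 u.1.2).col u.2 ⟶ t := fun u =>
        (z u.1.1 u.1.2).hom u.2 ≫ (y u.1.1).hom u.1.2 ≫ x.hom u.1.1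
      refine (PermOp.eqToHom_hom G (hs p) _).trans ?_
      exact (Category.assoc _ _ _).symm
  comp_one {t a} x := by
    have hs : ∀ p, Profile.split (fun i => Profile.single (a.col i)) p = 
      ⟨Profile.Hom.perm a.singlesHom p, 0⟩ := fun p =>
        Sigma.ext rfl (heq_of_eq (Subsingleton.elim (α := Fin 1) _ _))
    refine PermOp.ext_of_lt (fun p q => ?_) fun p => ?_
    · rw [PermOp.map_lt, PermOp.comp_lt x _ (hs p) (hs q)]
      exact ⟨fun h => h.resolve_right fun h => lt_irrefl _ h.2, Or.inl⟩
    · rfl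
  one_comp {t a} x := by
    refine PermOp.ext_of_lt (fun p q => ?_) fun p => ?_
    · rw [PermOp.map_lt]
      refine (PermOp.comp_lt (a := Profile.single t) (b := fun _ => a) _ _ rfl rfl).trans ?_
      exact ⟨fun h => (h.resolve_left fun h => absurd h (Subsingleton.elim (α := Fin 1) _ _).not_lt).2, fun h => Or.inr ⟨Subsingleton.elim (α := Fin 1) _ _, h⟩⟩
    · exact (Category.comp_id _).trans (Category.id_comp _).symm

end OrthogonalCategories

section Quotient

/-- One step of the relation `∼⊥`: two adjacent morphisms of `f σ⁻¹`, at the positions `p` and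
`q = p + 1`, are transposed; they are required to be orthogonal. -/
inductive PermOp.Step (C : OrthCat.{v}) {t : C.carrier} {c : Profile C.carrier} :
    PermOp C.carrier t c → PermOp C.carrier t c → Prop
  | swap (x : PermOp C.carrier t c) (p q : Fin c.len) (hpq : (p : ℕ) + 1 = q)
      (h : C.orth (x.hom (x.perm.symm p)) (x.hom (x.perm.symm q))) :
      PermOp.Step C x ⟨x.perm.trans (Equiv.swap p q), x.hom⟩

/-- The relation `∼⊥`: `(σ, f) ∼⊥ (σ', f)` if `f σ'⁻¹` is obtained from `f σ⁻¹` by finitely many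
transpositions of adjacent orthogonal pairs. -/
def PermOp.Rel (C : OrthCat.{v}) {t : C.carrier} {c : Profile C.carrier}
    (x y : PermOp C.carrier t c) : Prop :=
  Relation.ReflTransGen (PermOp.Step C) x y

theorem swap_adjacent {n : ℕ} {p q u v : Fin n} (hpq : (p : ℕ) + 1 = q) (huv : u < v)
    (h : Equiv.swap p q v < Equiv.swap p q u) : u = p ∧ v = q := by
  simp only [Equiv.swap_apply_def] at h
  simp only [Fin.ext_iff, Fin.lt_def] at *
  split_ifs at h <;> omega

theorem fin_ascent {n : ℕ} (f : Equiv.Perm (Fin n))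
    (h : ∀ p q : Fin n, (p : ℕ) + 1 = q → f p < f q) (i j : Fin n) (hij : i < j) : f i < f j := by
  cases n with
  | zero => exact i.elim0
  | succ n =>
    exact (Fin.strictMono_iff_lt_succ.2 fun k => h k.castSucc k.succ rfl) hij

namespace PermOp

variable {C : OrthCat.{v}} {t : C.carrier} {c : Profile C.carrier}

theorem Rel.spec {x y : PermOp C.carrier t c} (h : Rel C x y) : x.hom = y.hom ∧
    ∀ i j, x.perm i < x.perm j → y.perm j < y.perm i → C.orth (x.hom i) (x.hom j) := by
  induction h with
  | refl => exact ⟨rfl, fun i j h h' => absurd h (not_lt.2 h'.le)⟩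
  | tail h s ih =>
    cases s with
    | swap p q hpq o =>
      rename_i y
      refine ⟨ih.1, fun i j h1 h2 => ?_⟩
      have hij : i ≠ j := fun e => by subst e; exact lt_irrefl _ h1
      rcases lt_or_gt_of_ne (fun e => hij (y.perm.injective e)) with h3 | h3
      · obtain ⟨rfl, rfl⟩ := swap_adjacent hpq h3 h2
        rw [Equiv.symm_apply_apply, Equiv.symm_apply_apply] at o
        rw [ih.1]
        exact o
      · exact ih.2 i j h1 h3

theorem rel_of_spec_aux (n : ℕ) : ∀ (x y : PermOp C.carrier t c), x.hom = y.hom →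
    (∀ i j, x.perm i < x.perm j → y.perm j < y.perm i → C.orth (x.hom i) (x.hom j)) →
    (Finset.univ.filter fun u : Fin c.len × Fin c.len =>
      x.perm u.1 < x.perm u.2 ∧ y.perm u.2 < y.perm u.1).card = n → Rel C x y := by
  induction n using Nat.strong_induction_on with
  | _ n ih =>
    intro x y hxy h hn
    by_cases e : ∀ p q : Fin c.len, (p : ℕ) + 1 = q → y.perm (x.perm.symm p) < y.perm (x.perm.symm q)
    · have hm := fin_ascent (x.perm.symm.trans y.perm) e
      have : x = y := by
        refine ext_of_lt (fun i j => ?_) fun i => congrFun hxy i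
        have mono : StrictMono (x.perm.symm.trans y.perm) := fun i j hij => hm i j hij
        have := mono.lt_iff_lt (a := x.perm i) (b := x.perm j)
        simpa using this.symm
      subst this
      exact Relation.ReflTransGen.refl
    · push Not at e
      obtain ⟨p, q, hpq, hle⟩ := e
      have hne : p ≠ q := fun e => by subst e; omega
      have hlt : y.perm (x.perm.symm q) < y.perm (x.perm.symm p) :=
        lt_of_le_of_ne hle fun e => hne (x.perm.symm.injective (y.perm.injective e)).symm
      have hplt : p < q := by rw [Fin.lt_def]; omega
      have o := h (x.perm.symm p) (x.perm.symm q) (by simpa using hplt) hlt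
      have hsub : ∀ i j, Equiv.swap p q (x.perm i) < Equiv.swap p q (x.perm j) →
          y.perm j < y.perm i → x.perm i < x.perm j := by
        intro i j h1 h2
        by_contra h3
        have hij : i ≠ j := fun e => by subst e; exact lt_irrefl _ h1
        have h4 : x.perm j < x.perm i := lt_of_le_of_ne (not_lt.1 h3) fun e =>
          hij (x.perm.injective e).symm
        obtain ⟨rfl, rfl⟩ := swap_adjacent hpq h4 h1
        rw [Equiv.symm_apply_apply, Equiv.symm_apply_apply] at hlt
        exact absurd h2 (not_lt.2 hlt.le)
      refine Relation.ReflTransGen.head (Step.swap x p q hpq o) (ih _ ?_ _ y hxy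
        (fun i j h1 h2 => h i j (hsub i j h1 h2) h2) rfl)
      rw [← hn]
      refine Finset.card_lt_card (Finset.ssubset_iff_of_subset ?_ |>.2
        ⟨(x.perm.symm p, x.perm.symm q), ?_, ?_⟩)
      · intro u hu
        simp only [Finset.mem_filter, Finset.mem_univ, true_and] at hu ⊢
        exact ⟨hsub _ _ hu.1 hu.2, hu.2⟩
      · simp [hplt, hlt]
      · intro hu
        have h5 := (Finset.mem_filter.1 hu).2.1
        simp only [Equiv.trans_apply, Equiv.apply_symm_apply, Equiv.swap_apply_left,
          Equiv.swap_apply_right] at h5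
        exact lt_asymm hplt h5

theorem rel_iff {x y : PermOp C.carrier t c} : Rel C x y ↔ x.hom = y.hom ∧
    ∀ i j, x.perm i < x.perm j → y.perm j < y.perm i → C.orth (x.hom i) (x.hom j) :=
  ⟨Rel.spec, fun h => rel_of_spec_aux _ x y h.1 h.2 rfl⟩

variable (C t c) in
/-- The relation `∼⊥` is an equivalence relation. -/
def setoid : Setoid (PermOp C.carrier t c) where
  r := Rel C
  iseqv :=
    { refl := fun _ => Relation.ReflTransGen.refl
      symm := fun {x y} h => by
        rw [rel_iff] at h ⊢
        refine ⟨h.1.symm, fun i j h1 h2 => ?_⟩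
        rw [← h.1]
        exact C.symm _ _ (h.2 j i h2 h1)
      trans := fun h h' => Relation.ReflTransGen.trans h h' }

theorem Rel.map {d : Profile C.carrier} (σ : c ⟶ d) {x y : PermOp C.carrier t c} (h : Rel C x y) :
    Rel C (PermOp.map σ x) (PermOp.map σ y) := by
  rw [rel_iff] at h ⊢
  refine ⟨funext fun i => congrArg (_ ≫ ·) (congrFun h.1 _), fun i j h1 h2 => ?_⟩
  rw [map_lt] at h1 h2
  exact C.precomp _ _ _ _ (h.2 _ _ h1 h2)

theorem Rel.comp {b : Fin c.len → Profile C.carrier} {x x' : PermOp C.carrier t c}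
    {y y' : ∀ i, PermOp C.carrier (c.col i) (b i)} (h : Rel C x x') (h' : ∀ i, Rel C (y i) (y' i)) :
    Rel C (PermOp.comp x y) (PermOp.comp x' y') := by
  have h' := fun i => rel_iff.1 (h' i)
  rw [rel_iff] at h ⊢
  have hx := h.1
  refine ⟨funext fun p => ?_, fun p q h1 h2 => ?_⟩
  · show (y _).hom _ ≫ x.hom _ = (y' _).hom _ ≫ x'.hom _
    rw [h.1, (h' _).1]
  · rw [comp_lt x y rfl rfl] at h1
    rw [comp_lt x' y' rfl rfl] at h2
    show C.orth ((y (Profile.split b p).1).hom (Profile.split b p).2 ≫ x.hom (Profile.split b p).1)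
      ((y (Profile.split b q).1).hom (Profile.split b q).2 ≫ x.hom (Profile.split b q).1)
    revert h1 h2
    generalize Profile.split b p = u
    generalize Profile.split b q = v
    obtain ⟨i, j⟩ := u
    obtain ⟨i', j'⟩ := v
    intro h1 h2
    by_cases e : i = i'
    · subst e
      simp only [lt_self_iff_false, true_and, false_or] at h1 h2
      exact C.postcomp _ _ _ ((h' i).2 j j' h1 h2)
    · exact C.precomp _ _ _ _ (h.2 i i' (h1.resolve_right fun h => e h.1)
        (h2.resolve_right fun h => e h.1.symm))

end PermOp

/-- A congruence on a colored operad in sets: a family of equivalence relations which is compatible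
with permutations and compositions. -/
structure SetOperad.Congruence {𝔠 : Type v} (O : SetOperad.{v} 𝔠) where
  r : ∀ t c, Setoid (O.obj t c)
  map : ∀ {t : 𝔠} {c d : Profile 𝔠} (σ : c ⟶ d) {x y : O.obj t c}, (r t c).r x y →
    (r t d).r (O.map σ x) (O.map σ y)
  comp : ∀ {t : 𝔠} {a : Profile 𝔠} {b : Fin a.len → Profile 𝔠} {x x' : O.obj t a}
    {y y' : ∀ i, O.obj (a.col i) (b i)}, (r t a).r x x' → (∀ i, (r _ _).r (y i) (y' i)) →
    (r _ _).r (O.comp x y) (O.comp x' y')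

namespace SetOperad.Congruence

variable {𝔠 : Type v} {O : SetOperad.{v} 𝔠} (R : O.Congruence)

/-- The operations of the quotient operad. -/
abbrev Obj (t : 𝔠) (c : Profile 𝔠) : Type v := Quotient (R.r t c)

/-- The class of an operation. -/
abbrev cls {t : 𝔠} {c : Profile 𝔠} (x : O.obj t c) : R.Obj t c := Quotient.mk (R.r t c) x

/-- The action of permutations on classes. -/
def qmap {t : 𝔠} {c d : Profile 𝔠} (σ : c ⟶ d) : R.Obj t c → R.Obj t d :=
  Quotient.map (O.map σ) fun _ _ h => R.map σ h

/-- The composition of classes, computed on representatives. -/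
noncomputable def qcomp {t : 𝔠} {a : Profile 𝔠} {b : Fin a.len → Profile 𝔠} (x : R.Obj t a)
    (y : ∀ i, R.Obj (a.col i) (b i)) : R.Obj t (Profile.concat b) :=
  R.cls (O.comp x.out fun i => (y i).out)

theorem qcomp_mk {t : 𝔠} {a : Profile 𝔠} {b : Fin a.len → Profile 𝔠} (x : O.obj t a)
    (y : ∀ i, O.obj (a.col i) (b i)) :
    R.qcomp (R.cls x) (fun i => R.cls (y i)) = R.cls (O.comp x y) :=
  Quotient.sound (R.comp (Quotient.mk_out (s := R.r _ _) x)
    fun i => Quotient.mk_out (s := R.r _ _) (y i))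

theorem exists_rep {t : 𝔠} {c : Profile 𝔠} (q : R.Obj t c) : ∃ x, q = R.cls x :=
  ⟨q.out, (Quotient.out_eq q).symm⟩

theorem exists_reps {n : ℕ} {s : Fin n → 𝔠} {c : Fin n → Profile 𝔠}
    (q : ∀ i, R.Obj (s i) (c i)) : ∃ x : ∀ i, O.obj (s i) (c i), q = fun i => R.cls (x i) :=
  ⟨fun i => (q i).out, funext fun i => (Quotient.out_eq (q i)).symm⟩

/-- The quotient of a colored operad in sets by a congruence. -/
noncomputable def quotient : SetOperad.{v} 𝔠 where
  obj t c := R.Obj t c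
  map σ := R.qmap σ
  map_id x := by
    obtain ⟨x, rfl⟩ := R.exists_rep x
    exact congrArg R.cls (O.map_id x)
  map_comp σ τ x := by
    obtain ⟨x, rfl⟩ := R.exists_rep x
    exact congrArg R.cls (O.map_comp σ τ x)
  comp x y := R.qcomp x y
  one t := R.cls (O.one t)
  comp_perm {t a b} σ x y := by
    obtain ⟨x, rfl⟩ := R.exists_rep x
    obtain ⟨y, rfl⟩ := R.exists_reps y
    refine (R.qcomp_mk (a := a.permute σ) (b := fun i => b (σ i)) (O.map (a.permHom σ) x)
      fun i => y (σ i)).trans ?_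
    rw [R.qcomp_mk]
    exact congrArg R.cls (O.comp_perm σ x y)
  comp_blockSum σ x y := by
    obtain ⟨x, rfl⟩ := R.exists_rep x
    obtain ⟨y, rfl⟩ := R.exists_reps y
    refine (R.qcomp_mk x fun i => O.map (σ i) (y i)).trans ?_
    rw [R.qcomp_mk]
    exact congrArg R.cls (O.comp_blockSum σ x y)
  assoc {t a b c} x y z := by
    obtain ⟨x, rfl⟩ := R.exists_rep x
    obtain ⟨y, rfl⟩ := R.exists_reps y
    obtain ⟨z, rfl⟩ : ∃ z' : ∀ i j, O.obj ((b i).col j) (c i j), z = fun i j => R.cls (z' i j) :=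
      ⟨fun i j => (z i j).out, funext fun i => funext fun j => (Quotient.out_eq (z i j)).symm⟩
    have h1 : (fun i => R.qcomp (R.cls (y i)) fun j => R.cls (z i j)) =
        fun i => R.cls (O.comp (y i) (z i)) := funext fun i => R.qcomp_mk (y i) (z i)
    rw [h1, R.qcomp_mk, R.qcomp_mk]
    have h2 := R.qcomp_mk (a := Profile.concat b)
      (b := fun p => c (Profile.split b p).1 (Profile.split b p).2) (O.comp x y)
      (fun p => z (Profile.split b p).1 (Profile.split b p).2)
    exact (congrArg (R.qmap (Profile.assocHom b c)) h2).trans (congrArg R.cls (O.assoc x y z))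
  comp_one {t a} x := by
    obtain ⟨x, rfl⟩ := R.exists_rep x
    exact (R.qcomp_mk x fun i => O.one (a.col i)).trans (congrArg R.cls (O.comp_one x))
  one_comp {t a} x := by
    obtain ⟨x, rfl⟩ := R.exists_rep x
    exact (R.qcomp_mk (a := Profile.single t) (b := fun _ => a) (O.one t) fun _ => x).trans
      (congrArg R.cls (O.one_comp x))

end SetOperad.Congruence

/-- The relation `∼⊥` is a congruence on the operad `O_C`. -/
def OrthCat.congruence (C : OrthCat.{v}) : (permOperad C.carrier).Congruence where
  r t c := PermOp.setoid C t c
  map σ _ _ h := PermOp.Rel.map σ h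
  comp h h' := PermOp.Rel.comp h h'

/-- The colored operad `O_C / ∼⊥` in sets of an orthogonal category. -/
noncomputable def OrthCat.setOperad (C : OrthCat.{v}) : SetOperad.{v} C.carrier :=
  C.congruence.quotient

end Quotient

section Naturality

/-- A morphism of colored operads in sets, over a map of colors. -/
structure SetOperad.Hom {𝔠 𝔡 : Type v} (O : SetOperad.{v} 𝔠) (P : SetOperad.{v} 𝔡) (f : 𝔠 → 𝔡) where
  app : ∀ {t : 𝔠} {a : Profile 𝔠}, O.obj t a → P.obj (f t) (a.mapColor f)
  app_map : ∀ {t : 𝔠} {a b : Profile 𝔠} (σ : a ⟶ b) (x : O.obj t a),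
    app (O.map σ x) = P.map (Profile.mapColorHom f σ) (app x)
  app_comp : ∀ {t : 𝔠} {a : Profile 𝔠} {b : Fin a.len → Profile 𝔠} (x : O.obj t a)
    (y : ∀ i, O.obj (a.col i) (b i)),
    app (O.comp x y) = P.comp (a := a.mapColor f) (b := fun i => (b i).mapColor f) (app x)
      fun i => app (y i)
  app_one : ∀ t : 𝔠, app (O.one t) = P.one (f t)

variable (M : Type u) [Category.{v} M] [MonoidalCategory M] [SymmetricCategory M]
  [MonoidalClosed M] [HasColimits M]

/-- Change of base for morphisms of colored operads. -/
noncomputable def SetOperad.Hom.baseChange {𝔠 𝔡 : Type v} {O : SetOperad.{v} 𝔠}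
    {P : SetOperad.{v} 𝔡} {f : 𝔠 → 𝔡} (F : SetOperad.Hom O P f) :
    OpCat.Hom (M := M) ⟨𝔠, O.baseChange M⟩ ⟨𝔡, P.baseChange M⟩ where
  onColor := f
  app t a := copowerDesc fun x => P.pt M (F.app x)
  naturality t a b σ := O.generating_pt M _ _ _ _ fun x => by
    have h1 := fun {t : 𝔠} {a : Profile 𝔠} => copowerPt_desc (fun x : O.obj t a => P.pt M (F.app x))
    refine (Category.assoc _ _ _).symm.trans ((congrArg (· ≫ _) (O.pt_map M σ x)).trans ?_)
    refine (h1 _).trans ?_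
    refine Eq.trans ?_ ((congrArg (· ≫ _) (h1 x).symm).trans (Category.assoc _ _ _))
    exact (congrArg (P.pt M) (F.app_map σ x)).trans (P.pt_map M _ _).symm
  comp_app t a b := O.hom_ext_comp M _ _ fun x y => by
    have h1 := fun {t : 𝔠} {a : Profile 𝔠} => copowerPt_desc (fun x : O.obj t a => P.pt M (F.app x))
    refine (Category.assoc _ _ _).symm.trans ((congrArg (· ≫ _) (O.pt_comp M x y)).trans ?_)
    refine (h1 _).trans ?_
    refine Eq.trans ?_ (Category.assoc _ _ _)
    have h3 := (ptTensor_comp (O.pt M x) (ptFin fun i => O.pt M (y i)) _ _).trans (congrArg₂ ptTensor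
      (h1 x) ((ptFin_map _ _).trans (congrArg ptFin (funext fun i => h1 (y i)))))
    have h2 := P.pt_comp M (a := a.mapColor f) (b := fun i => (b i).mapColor f) (F.app x)
      fun i => F.app (y i)
    rw [← F.app_comp] at h2
    exact h2.symm.trans (congrArg (· ≫ _) h3.symm)
  one_app t := (copowerPt_desc _ _).trans (congrArg (P.pt M) (F.app_one t))

theorem SetOperad.Hom.pt_baseChange {𝔠 𝔡 : Type v} {O : SetOperad.{v} 𝔠}
    {P : SetOperad.{v} 𝔡} {f : 𝔠 → 𝔡} (F : SetOperad.Hom O P f) {t : 𝔠} {a : Profile 𝔠}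
    (x : O.obj t a) : O.pt M x ≫ (F.baseChange M).app t a = P.pt M (F.app x) :=
  copowerPt_desc _ _

variable {C D : OrthCat.{v}}

/-- The action of a functor on operations. -/
def PermOp.functorMap (F : C ⟶ D) {t : C.carrier} {a : Profile C.carrier}
    (x : PermOp C.carrier t a) :
    PermOp D.carrier (F.functor.obj t) (a.mapColor F.functor.obj) where
  perm := x.perm
  hom i := F.functor.map (x.hom i)

theorem PermOp.functorMap_rel (F : C ⟶ D) {t : C.carrier} {a : Profile C.carrier}
    {x y : PermOp C.carrier t a} (h : PermOp.Rel C x y) :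
    PermOp.Rel D (PermOp.functorMap F x) (PermOp.functorMap F y) := by
  rw [rel_iff] at h ⊢
  exact ⟨funext fun i => congrArg F.functor.map (congrFun h.1 i),
    fun i j h1 h2 => F.map_orth _ _ (h.2 i j h1 h2)⟩

/-- The morphism of colored operads in sets given by an orthogonal functor. -/
def OrthCat.setOperadHom (F : C ⟶ D) :
    SetOperad.Hom C.setOperad D.setOperad F.functor.obj where
  app {t a} := Quotient.map (sa := PermOp.setoid C t a) (PermOp.functorMap F)
    fun _ _ h => PermOp.functorMap_rel F h
  app_map {t a b} σ x := by
    obtain ⟨x, rfl⟩ := C.congruence.exists_rep x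
    refine congrArg D.congruence.cls (PermOp.ext rfl (funext fun i => ?_))
    exact (F.functor.map_comp _ _).trans (congrArg (· ≫ _) (eqToHom_map _ _))
  app_comp {t a b} x y := by
    obtain ⟨x, rfl⟩ := C.congruence.exists_rep x
    obtain ⟨y, rfl⟩ := C.congruence.exists_reps y
    have h1 := C.congruence.qcomp_mk x y
    refine (congrArg _ h1).trans ?_
    refine Eq.trans ?_ (D.congruence.qcomp_mk (a := a.mapColor F.functor.obj)
      (b := fun i => (b i).mapColor F.functor.obj) (PermOp.functorMap F x)
      (fun i => PermOp.functorMap F (y i))).symm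
    exact congrArg D.congruence.cls (PermOp.ext rfl (funext fun p => F.functor.map_comp _ _))
  app_one t := congrArg D.congruence.cls
    (PermOp.ext (x := PermOp.functorMap F (PermOp.one t))
      (y := PermOp.one (F.functor.obj t)) rfl (funext fun _ => F.functor.map_id t))

/-- The colored operad `O_C ⊗ I` with values in `M` of an orthogonal category. -/
noncomputable def OrthCat.operad (C : OrthCat.{v}) : OpCat.{v} M :=
  ⟨C.carrier, C.setOperad.baseChange M⟩

/-- The functor which assigns to an orthogonal category its colored operad with values in `M`. -/
noncomputable def operadFunctor : OrthCat.{v} ⥤ OpCat.{v} M where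
  obj C := C.operad M
  map F := (OrthCat.setOperadHom F).baseChange M
  map_id C := OpCat.Hom.ext_of_app rfl fun t a => heq_of_eq <|
    C.setOperad.generating_pt M _ _ _ _ fun x => by
      obtain ⟨x, rfl⟩ := C.congruence.exists_rep x
      exact (copowerPt_desc _ _).trans (Category.comp_id _).symm
  map_comp {C D E} F G := OpCat.Hom.ext_of_app rfl fun t a => heq_of_eq <|
    C.setOperad.generating_pt M _ _ _ _ fun x => by
      obtain ⟨x, rfl⟩ := C.congruence.exists_rep x
      have h1 := (OrthCat.setOperadHom (F ≫ G)).pt_baseChange M (C.congruence.cls x)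
      have h2 := (OrthCat.setOperadHom F).pt_baseChange M (C.congruence.cls x)
      have h3 := (OrthCat.setOperadHom G).pt_baseChange M
        ((OrthCat.setOperadHom F).app (C.congruence.cls x))
      refine h1.trans (Eq.trans ?_ (Category.assoc _ _ _))
      exact h3.symm.trans (congrArg (· ≫ _) h2.symm)

/-- The functor which assigns to an orthogonal category the category of algebras over its colored
operad, and to an orthogonal functor the pullback of algebras. -/
noncomputable def algebraFunctor : OrthCat.{v}ᵒᵖ ⥤ Cat.{v, max u v} :=
  (operadFunctor M).op ⋙ OpCat.algebras M

end Naturality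

section FieldTheories

variable (M : Type u) [Category.{v} M] [MonoidalCategory M] [SymmetricCategory M]

/-- A functor from an orthogonal category to monoids in `M` is `⊥`-commutative if the images of
orthogonal morphisms commute. -/
def IsOrthCommutative (C : OrthCat.{v}) : ObjectProperty (C.carrier ⥤ Mon M) := fun A =>
  ∀ ⦃c₁ c₂ c : C.carrier⦄ (f₁ : c₁ ⟶ c) (f₂ : c₂ ⟶ c), C.orth f₁ f₂ →
    ((A.map f₁).hom ⊗ₘ (A.map f₂).hom) ≫ MonObj.mul (X := (A.obj c).X) =
      ((A.map f₁).hom ⊗ₘ (A.map f₂).hom) ≫ (β_ (A.obj c).X (A.obj c).X).hom ≫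
        MonObj.mul (X := (A.obj c).X)

/-- The category of quantum field theories on an orthogonal category: the full subcategory of
`⊥`-commutative functors to monoids in `M`. -/
abbrev FieldTheory (C : OrthCat.{v}) : Type (max u v) :=
  (IsOrthCommutative M C).FullSubcategory

/-- Pullback of quantum field theories along an orthogonal functor. -/
def FieldTheory.pullback {C D : OrthCat.{v}} (F : C ⟶ D) : FieldTheory M D ⥤ FieldTheory M C :=
  (IsOrthCommutative M C).lift ((IsOrthCommutative M D).ι ⋙ (Functor.whiskeringLeft _ _ _).obj F.functor)
    fun A _ _ _ f₁ f₂ h => A.property _ _ (F.map_orth f₁ f₂ h)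

/-- The functor which assigns to an orthogonal category the category of its quantum field theories,
and to an orthogonal functor the precomposition with it. -/
def fieldTheoryFunctor : OrthCat.{v}ᵒᵖ ⥤ Cat.{v, max u v} where
  obj C := Cat.of (FieldTheory M C.unop)
  map F := (FieldTheory.pullback M F.unop).toCatHom
  map_id _ := Cat.Hom.ext rfl
  map_comp _ _ := Cat.Hom.ext rfl

end FieldTheories

end AQFT

namespace AQFT

/-! ### Rebracketing over concatenated lists -/

section Append

variable {M : Type u} [Category.{v} M] [MonoidalCategory M] {ι : Type w} {X : ι → M}

/-! Since `M` is closed, a morphism out of a copower of the unit tensored with any object can be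
prescribed, and is determined, by its values at the summands (`atPt_copowerTensorDesc`,
`Generating.ext_atPt`). Hence an algebra over `O ⊗ I` amounts to one morphism for each single
operation of the set operad `O`, subject to equivariance, a composition law and a unit law
(`OperadAlgebra.ofOp`, `OperadAlgebra.ext_of_op`).

For the operad of an orthogonal category these data shrink further. Equivariance reduces `[σ, f]` to
the operation `[e, f σ⁻¹]` with identity permutation (`OperadAlgebra.op_cls`). Operadic composition
builds all operations with identity permutation from three kinds: the nullary one, the binary `[e,
(id, id)]` and the unary `[e, f]`. They give a unit, a multiplication and a functorial action, and
the composition law makes these into a functor to monoids. One step of `∼⊥` identifies the two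
orders of multiplying the images of an orthogonal pair, which is `⊥`-commutativity
(`OperadAlgebra.unary_mult_of_orth`).

Conversely, on a `⊥`-commutative functor `[σ, f]` acts by permuting the tensor factors by `σ⁻¹`,
applying the functor to the morphisms, and multiplying (`FieldTheory.opRep`). By `PermOp.rel_iff`,
representatives of one class differ only in the order of orthogonal pairs, whose images commute, so
this is well defined (`FieldTheory.opRep_eq_of_rel`). Both passages keep the underlying objects and
morphisms, so they are inverse to each other on the nose. They are strictly natural because an
orthogonal functor carries the three generating kinds of operations to operations of the same kind.

The main technical burden is coherence. `canonIso` is one particular algorithm, which normalises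
brackets and then sorts letter by letter, whereas the axioms equate composites of several such
isomorphisms. `Structural.unique` settles this: all composites of associators, unitors and braidings
between two expressions with distinct letters agree. After rebracketing, each of them is a
`Reordering`, a deterministic relation whose closure under composition rests on the Yang–Baxter
equation and on symmetry. The same normal form shows that products in a monoid along two expressions
agree as soon as the pairs of letters in opposite order commute (`Structural.wordProd_eq`). -/

theorem appendIso_nil_hom (m : List ι) :
    (appendIso X [] m).hom = (λ_ (tensorList X m)).inv := rfl

theorem appendIso_nil_inv (m : List ι) :
    (appendIso X [] m).inv = (λ_ (tensorList X m)).hom := rfl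

theorem appendIso_cons_hom (i : ι) (l m : List ι) : (appendIso X (i :: l) m).hom =
    X i ◁ (appendIso X l m).hom ≫ (α_ (X i) (tensorList X l) (tensorList X m)).inv := rfl

theorem appendIso_cons_inv (i : ι) (l m : List ι) : (appendIso X (i :: l) m).inv =
    (α_ (X i) (tensorList X l) (tensorList X m)).hom ≫ X i ◁ (appendIso X l m).inv := rfl

end Append

/-! ### Symmetric coherence: sorting tensor factors one letter at a time -/

section Coherence

variable {M : Type u} [Category.{v} M] [MonoidalCategory M] [SymmetricCategory M]

/-- The symmetry of the first two factors of a right-bracketed triple tensor product. -/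
def cross (A B T : M) : A ⊗ B ⊗ T ⟶ B ⊗ A ⊗ T :=
  (α_ A B T).inv ≫ (β_ A B).hom ▷ T ≫ (α_ B A T).hom

theorem cross_naturality_right (A B : M) {T T' : M} (f : T ⟶ T') :
    A ◁ B ◁ f ≫ cross A B T' = cross A B T ≫ B ◁ A ◁ f := by
  simp only [cross, Category.assoc]
  rw [associator_inv_naturality_right_assoc, whisker_exchange_assoc, associator_naturality_right]

theorem cross_naturality_right_assoc (A B : M) {T T' Z : M} (f : T ⟶ T') (h : B ⊗ A ⊗ T' ⟶ Z) :
    A ◁ B ◁ f ≫ cross A B T' ≫ h = cross A B T ≫ B ◁ A ◁ f ≫ h := by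
  rw [← Category.assoc, cross_naturality_right, Category.assoc]

/-- This is the symmetry axiom of the braiding. It is needed when two letters that have been
exchanged are exchanged back, in `Extraction.swap`. -/
theorem cross_cross (A B T : M) : cross A B T ≫ cross B A T = 𝟙 _ := by
  simp [cross, ← comp_whiskerRight_assoc]

/-- The Yang–Baxter equation, whiskered by the remaining factor `T`. It allows two extractions to be
exchanged behind a third letter. -/
theorem cross_hexagon (A B C T : M) :
    cross A B (C ⊗ T) ≫ B ◁ cross A C T ≫ cross B C (A ⊗ T) =
      A ◁ cross B C T ≫ cross A C (B ⊗ T) ≫ C ◁ cross A B T := by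
  have h := congrArg (· ▷ T) (BraidedCategory.yang_baxter A B C)
  calc _ = 𝟙 _ ⊗≫ ((α_ A B C).inv ≫ (β_ A B).hom ▷ C ≫ (α_ B A C).hom ≫
        B ◁ (β_ A C).hom ≫ (α_ B C A).inv ≫ (β_ B C).hom ▷ A ≫ (α_ C B A).hom) ▷ T ⊗≫ 𝟙 _ := by
        unfold cross; monoidal
    _ = _ := by rw [h]; unfold cross; monoidal

/-- A hexagon axiom: a letter can be carried past a block one factor of the block at a time. -/
theorem cross_tensor_left (A L B T : M) :
    A ◁ cross L B T ≫ cross A B (L ⊗ T) =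
      (α_ A L (B ⊗ T)).inv ≫ cross (A ⊗ L) B T ≫ B ◁ (α_ A L T).hom := by
  simp only [cross, BraidedCategory.braiding_tensor_left_hom]
  monoidal

/-- The other hexagon axiom: a block can be carried past a product one factor of that product at a
time. -/
theorem cross_braiding (L A T : M) :
    cross L A T ≫ A ◁ (β_ L T).hom = (β_ L (A ⊗ T)).hom ≫ (α_ A T L).hom := by
  simp only [cross, BraidedCategory.braiding_tensor_right_hom]
  monoidal

theorem cross_unit (A T : M) : (λ_ (A ⊗ T)).inv ≫ cross (𝟙_ M) A T ≫ A ◁ (λ_ T).hom = 𝟙 _ := by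
  simp only [cross, braiding_tensorUnit_left]
  monoidal

variable {ι : Type w} (X : ι → M)

/-- `Extraction X i l l' f` says that `l'` is obtained from `l` by removal of the first occurrence
of `i`, and that `f` moves the corresponding tensor factor to the front. -/
inductive Extraction (i : ι) : (l l' : List ι) → (tensorList X l ⟶ X i ⊗ tensorList X l') → Prop
  | head (l : List ι) : Extraction i (i :: l) l (𝟙 (X i ⊗ tensorList X l))
  | tail {j : ι} (h : j ≠ i) {l l' : List ι} {f : tensorList X l ⟶ X i ⊗ tensorList X l'} :
      Extraction i l l' f →
      Extraction i (j :: l) (j :: l') (X j ◁ f ≫ cross (X j) (X i) (tensorList X l'))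

/-- `Reordering X l l' f` says that `f` permutes the tensor factors named by `l` into the order in
which they occur in `l'`. -/
inductive Reordering : (l l' : List ι) → (tensorList X l ⟶ tensorList X l') → Prop
  | nil : Reordering [] [] (𝟙 (𝟙_ M))
  | cons {i : ι} {l l₁ l' : List ι} {f : tensorList X l ⟶ X i ⊗ tensorList X l₁}
      {g : tensorList X l₁ ⟶ tensorList X l'} :
      Extraction X i l l₁ f → Reordering l₁ l' g → Reordering l (i :: l') (f ≫ X i ◁ g)

variable {X}

theorem Extraction.congr {i : ι} {l l' : List ι} {f g : tensorList X l ⟶ X i ⊗ tensorList X l'}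
    (hf : Extraction X i l l' f) (h : f = g) : Extraction X i l l' g := h ▸ hf

theorem Reordering.congr {l l' : List ι} {f g : tensorList X l ⟶ tensorList X l'}
    (hf : Reordering X l l' f) (h : f = g) : Reordering X l l' g := h ▸ hf

theorem Extraction.perm {i : ι} {l l' : List ι} {f : tensorList X l ⟶ X i ⊗ tensorList X l'}
    (h : Extraction X i l l' f) : l.Perm (i :: l') := by
  induction h with
  | head => exact List.Perm.refl _
  | tail _ _ ih => exact (ih.cons _).trans (List.Perm.swap _ _ _)

theorem Reordering.perm {l l' : List ι} {f : tensorList X l ⟶ tensorList X l'}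
    (h : Reordering X l l' f) : l.Perm l' := by
  induction h with
  | nil => exact List.Perm.refl _
  | cons h _ ih => exact h.perm.trans (ih.cons _)

/-- The condition `j ≠ i` in `tail` leaves only one applicable constructor at every stage, so
extraction is deterministic. The equality is heterogeneous because the remaining list is part of the
conclusion. -/
theorem Extraction.unique {i : ι} {l l₁ : List ι} {f : tensorList X l ⟶ X i ⊗ tensorList X l₁}
    (hf : Extraction X i l l₁ f) : ∀ {l₂ : List ι} {g : tensorList X l ⟶ X i ⊗ tensorList X l₂},
    Extraction X i l l₂ g → l₁ = l₂ ∧ HEq f g := by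
  induction hf with
  | head l =>
    intro l₂ g hg
    cases hg with
    | head => exact ⟨rfl, HEq.rfl⟩
    | tail h => exact absurd rfl h
  | tail h _ ih =>
    intro l₂ g hg
    cases hg with
    | head => exact absurd rfl h
    | tail _ hg =>
      obtain ⟨rfl, e⟩ := ih hg
      obtain rfl := eq_of_heq e
      exact ⟨rfl, HEq.rfl⟩

/-- The head of the target list dictates which letter to extract next, so selection sort leaves no
choice. Coherence reduces to this fact once every structural morphism is known to be a reordering.
-/
theorem Reordering.unique {l l' : List ι} {f : tensorList X l ⟶ tensorList X l'}
    (hf : Reordering X l l' f) : ∀ {g : tensorList X l ⟶ tensorList X l'},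
    Reordering X l l' g → f = g := by
  induction hf with
  | nil =>
    intro g hg
    cases hg
    rfl
  | cons h _ ih =>
    intro g hg
    cases hg with
    | cons h' hg =>
      obtain ⟨rfl, e⟩ := h.unique h'
      obtain rfl := eq_of_heq e
      rw [ih hg]

theorem Reordering.refl : (l : List ι) → Reordering X l l (𝟙 (tensorList X l))
  | [] => .nil
  | i :: l => (Reordering.cons (.head l) (Reordering.refl l)).congr (by
      rw [MonoidalCategory.whiskerLeft_id]; exact Category.id_comp _)

/-- Two different letters may be taken out in either order. Where the letters themselves meet this
is symmetry, and behind a third letter it is the Yang–Baxter equation. -/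
theorem Extraction.swap {i j : ι} (hij : j ≠ i) {l l₁ : List ι}
    {f : tensorList X l ⟶ X j ⊗ tensorList X l₁} (hf : Extraction X j l l₁ f) :
    ∀ {l₂ : List ι} {g : tensorList X l₁ ⟶ X i ⊗ tensorList X l₂}, Extraction X i l₁ l₂ g →
    ∃ (l₃ : List ι) (f' : tensorList X l ⟶ X i ⊗ tensorList X l₃)
      (g' : tensorList X l₃ ⟶ X j ⊗ tensorList X l₂), Extraction X i l l₃ f' ∧
      Extraction X j l₃ l₂ g' ∧
      f ≫ X j ◁ g ≫ cross (X j) (X i) (tensorList X l₂) = f' ≫ X i ◁ g' := by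
  induction hf with
  | head l =>
    intro l₂ g hg
    refine ⟨_, _, _, .tail hij hg, .head _, ?_⟩
    exact (Category.id_comp _).trans ((congrArg _ (MonoidalCategory.whiskerLeft_id _ _)).trans
      (Category.comp_id _)).symm
  | tail hk hf ih =>
    intro l₂ g hg
    rename_i k l l' f
    cases hg with
    | head =>
      -- Here `i` heads the list. Taking it out first leaves the given extraction of `j`, and the
      -- two crossings of `i` with `j` cancel.
      refine ⟨_, _, _, .head _, hf, ?_⟩
      refine Eq.trans ?_ (Category.id_comp _).symm
      refine (congrArg (fun z => (X _ ◁ f ≫ cross _ _ _) ≫ z ≫ cross _ _ _)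
        (MonoidalCategory.whiskerLeft_id _ _)).trans ?_
      rw [Category.id_comp, Category.assoc, cross_cross, Category.comp_id]
    | tail hk' hg =>
      rename_i g
      obtain ⟨l₃, f', g', hf', hg', e⟩ := ih hg
      refine ⟨_, _, _, .tail hk' hf', .tail hk hg', ?_⟩
      -- A third letter `k` heads the list: the exchange in the tail is whiskered by `k`, which then
      -- has to pass both `i` and `j`.
      have e' := congrArg (fun z => X k ◁ z ≫ cross (X k) (X i) _ ≫ X i ◁ cross (X k) (X j) _) e
      dsimp only [tensorList] at e' ⊢
      simp only [MonoidalCategory.whiskerLeft_comp, Category.assoc] at e' ⊢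
      rw [← cross_naturality_right_assoc, cross_hexagon, e', ← cross_naturality_right_assoc]

/-- An extraction that follows a sorting can be carried out before it, by exchanging it in turn with
each extraction of the sorting. This is the inductive step for composing two sortings. -/
theorem Reordering.extract {l l' : List ι} {f : tensorList X l ⟶ tensorList X l'}
    (hf : Reordering X l l' f) : ∀ {i : ι} {l₁ : List ι}
    {g : tensorList X l' ⟶ X i ⊗ tensorList X l₁}, Extraction X i l' l₁ g →
    ∃ (l₂ : List ι) (g' : tensorList X l ⟶ X i ⊗ tensorList X l₂)
      (f' : tensorList X l₂ ⟶ tensorList X l₁), Extraction X i l l₂ g' ∧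
      Reordering X l₂ l₁ f' ∧ f ≫ g = g' ≫ X i ◁ f' := by
  induction hf with
  | nil =>
    intro i l₁ g hg
    cases hg
  | cons hb hs ih =>
    rename_i j l l₁ l' b s
    intro i m g hg
    cases hg with
    | head => exact ⟨_, _, _, hb, hs, Category.comp_id _⟩
    | tail hij hg =>
      rename_i m g
      obtain ⟨l₂, g', s', hg', hs', e⟩ := ih hg
      obtain ⟨l₃, b', g'', hb', hg'', e'⟩ := Extraction.swap hij hb hg'
      refine ⟨_, _, _, hb', .cons hg'' hs', ?_⟩
      dsimp only [tensorList]
      rw [MonoidalCategory.whiskerLeft_comp, ← reassoc_of% e', ← cross_naturality_right,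
        ← MonoidalCategory.whiskerLeft_comp_assoc, ← e]
      simp

theorem Reordering.trans {l l' l'' : List ι} {f : tensorList X l ⟶ tensorList X l'}
    {g : tensorList X l' ⟶ tensorList X l''} (hf : Reordering X l l' f)
    (hg : Reordering X l' l'' g) : Reordering X l l'' (f ≫ g) := by
  induction hg generalizing l with
  | nil => exact hf.congr (Category.comp_id _).symm
  | cons hb _ ih =>
    obtain ⟨l₂, g', f', hg', hf', e⟩ := hf.extract hb
    refine (Reordering.cons hg' (ih hf')).congr ?_
    dsimp only [tensorList]
    rw [← Category.assoc, e, MonoidalCategory.whiskerLeft_comp, Category.assoc]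

/-- The first occurrence of `i` in `l` is also its first occurrence in `l ++ m`, so the tail `m`
remains passive. -/
theorem Extraction.append {i : ι} {l l₁ : List ι} {f : tensorList X l ⟶ X i ⊗ tensorList X l₁}
    (hf : Extraction X i l l₁ f) (m : List ι) : Extraction X i (l ++ m) (l₁ ++ m)
      ((appendIso X l m).hom ≫ f ▷ tensorList X m ≫ (α_ _ _ _).hom ≫
        X i ◁ (appendIso X l₁ m).inv) := by
  induction hf with
  | head l =>
    refine (Extraction.head (l ++ m)).congr ?_
    rw [appendIso_cons_hom]
    refine Eq.symm ((congrArg (_ ≫ · ≫ _) (id_whiskerRight _ _)).trans ?_)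
    dsimp only [tensorList, List.cons_append, List.nil_append]
    rw [Category.id_comp, Category.assoc, Iso.inv_hom_id_assoc,
      ← MonoidalCategory.whiskerLeft_comp, Iso.hom_inv_id, MonoidalCategory.whiskerLeft_id]
  | tail hj hf ih =>
    rename_i j l l' f
    refine (Extraction.tail hj ih).congr ?_
    rw [appendIso_cons_hom, appendIso_cons_inv]
    dsimp only [tensorList, List.cons_append, List.nil_append]
    simp only [MonoidalCategory.whiskerLeft_comp, Category.assoc, comp_whiskerRight]
    rw [cross_naturality_right]
    refine congrArg (_ ≫ ·) ?_
    simp only [cross]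
    monoidal

/-- The front block is sorted first with the back block as a passive tail. The sorting of the back
block takes over when the front is exhausted. -/
theorem Reordering.tensor {l l' : List ι} {f : tensorList X l ⟶ tensorList X l'}
    (hf : Reordering X l l' f) {m m' : List ι} {g : tensorList X m ⟶ tensorList X m'}
    (hg : Reordering X m m' g) : Reordering X (l ++ m) (l' ++ m')
      ((appendIso X l m).hom ≫ (f ⊗ₘ g) ≫ (appendIso X l' m').inv) := by
  induction hf with
  | nil =>
    refine hg.congr ?_
    rw [appendIso_nil_hom, appendIso_nil_inv]
    refine Eq.symm ((congrArg (_ ≫ · ≫ _) (id_tensorHom _ _)).trans ?_)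
    simp
  | cons hb _ ih =>
    rename_i i _ l l₁ f s _
    refine (Reordering.cons (hb.append m) ih).congr ?_
    rw [appendIso_cons_inv]
    dsimp only [tensorList, List.cons_append, List.nil_append]
    simp only [MonoidalCategory.whiskerLeft_comp, Category.assoc]
    rw [← MonoidalCategory.whiskerLeft_comp_assoc, Iso.inv_hom_id, MonoidalCategory.whiskerLeft_id,
      Category.id_comp, tensorHom_def (f ≫ X i ◁ s) g, tensorHom_def s g]
    simp

/-- Unitors and associators move no letter, so here and for `Reordering.append_assoc` every
extraction takes the head. -/
theorem Reordering.append_nil : (l : List ι) →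
    Reordering X (l ++ []) l ((appendIso X l []).hom ≫ (ρ_ (tensorList X l)).hom)
  | [] => Reordering.nil.congr (by
      rw [appendIso_nil_hom]
      exact ((congrArg (_ ≫ ·) unitors_equal.symm).trans (Iso.inv_hom_id (λ_ (𝟙_ M)))).symm)
  | i :: l => (Reordering.cons (.head _) (Reordering.append_nil l)).congr (by
      rw [appendIso_cons_hom]
      refine (Category.id_comp _).trans ?_
      dsimp only [tensorList, List.cons_append, List.nil_append]
      rw [MonoidalCategory.whiskerLeft_comp, Category.assoc, rightUnitor_tensor_hom,
        Iso.inv_hom_id_assoc])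

theorem Reordering.append_assoc (m n : List ι) : (l : List ι) →
    Reordering X ((l ++ m) ++ n) (l ++ (m ++ n))
      ((appendIso X (l ++ m) n).hom ≫ (appendIso X l m).hom ▷ _ ≫ (α_ _ _ _).hom ≫
        _ ◁ (appendIso X m n).inv ≫ (appendIso X l (m ++ n)).inv)
  | [] => (Reordering.refl (m ++ n)).congr (by
      rw [appendIso_nil_hom, appendIso_nil_inv]
      dsimp only [tensorList, List.cons_append, List.nil_append]
      simp)
  | i :: l => (Reordering.cons (.head _) (Reordering.append_assoc m n l)).congr (by
      refine (Category.id_comp _).trans ?_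
      rw [appendIso_cons_hom, appendIso_cons_inv]
      refine Eq.trans ?_ (congrArg (· ≫ _) (appendIso_cons_hom i (l ++ m) n).symm)
      dsimp only [tensorList, List.cons_append, List.nil_append]
      simp only [MonoidalCategory.whiskerLeft_comp, Category.assoc]
      refine congrArg (_ ≫ ·) ?_
      monoidal)

/-- Because `i` does not occur in `l`, its first occurrence is the one behind `l`. The letters of
`l` are crossed one by one, and `cross_tensor_left` collects these crossings into one crossing of
the block. -/
theorem Extraction.middle {i : ι} (m : List ι) : (l : List ι) → i ∉ l →
    Extraction X i (l ++ i :: m) (l ++ m)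
      ((appendIso X l (i :: m)).hom ≫ cross (tensorList X l) (X i) (tensorList X m) ≫
        X i ◁ (appendIso X l m).inv)
  | [], _ => (Extraction.head m).congr (cross_unit (X i) (tensorList X m)).symm
  | j :: l, h => (Extraction.tail (fun e => h (List.mem_cons.2 (Or.inl e.symm)))
      (Extraction.middle m l fun h' => h (List.mem_cons_of_mem _ h'))).congr (by
      rw [appendIso_cons_hom, appendIso_cons_inv]
      dsimp only [tensorList, List.cons_append, List.nil_append]
      simp only [MonoidalCategory.whiskerLeft_comp, Category.assoc]
      rw [cross_naturality_right, ← Category.assoc (_ ◁ cross _ _ _), cross_tensor_left]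
      simp only [Category.assoc])

/-- The letters of `m` are pulled in turn through the whole of `l`. Disjointness makes the
occurrences that are pulled the first ones. This is where coherence uses that letters are distinct:
the braiding of a factor with itself need not be the identity. -/
theorem Reordering.braiding (l : List ι) : (m : List ι) → List.Disjoint l m →
    Reordering X (l ++ m) (m ++ l)
      ((appendIso X l m).hom ≫ (β_ _ _).hom ≫ (appendIso X m l).inv)
  | [], _ => (Reordering.append_nil l).congr (by
      rw [appendIso_nil_inv]
      exact congrArg (_ ≫ ·) (braiding_leftUnitor _).symm)
  | i :: m, h => (Reordering.cons (Extraction.middle m l fun h' => h h' List.mem_cons_self)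
      (Reordering.braiding l m fun _ h₁ h₂ => h h₁ (List.mem_cons_of_mem _ h₂))).congr (by
      rw [appendIso_cons_inv]
      dsimp only [tensorList, List.cons_append, List.nil_append]
      simp only [MonoidalCategory.whiskerLeft_comp, Category.assoc]
      rw [← MonoidalCategory.whiskerLeft_comp_assoc, Iso.inv_hom_id, MonoidalCategory.whiskerLeft_id,
        Category.id_comp, reassoc_of% cross_braiding])

theorem Extraction.of_bringIso [DecidableEq ι] (i : ι) : (l : List ι) → (h : i ∈ l) →
    Extraction X i l (l.erase i) (bringIso X i l h).hom
  | [], h => absurd h List.not_mem_nil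
  | j :: l, h => by
    -- `bringIso` transports along equations for `List.erase`. This absorbs the transport into the
    -- list that remains after an extraction.
    have key : ∀ {l₀ l₁ : List ι} {f : tensorList X l₀ ⟶ X i ⊗ tensorList X l₁}
        (_ : Extraction X i l₀ l₁ f) {l₂ : List ι} (_ : l₁ = l₂)
        (h' : X i ⊗ tensorList X l₁ = X i ⊗ tensorList X l₂),
        Extraction X i l₀ l₂ (f ≫ eqToHom h') := by
      rintro l₀ l₁ f hf _ rfl h'
      exact hf.congr (Category.comp_id _).symm
    by_cases e : j = i
    · subst e
      rw [bringIso, dif_pos rfl]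
      exact (key (.head l) (by simp) (by simp)).congr (Category.id_comp _)
    · rw [bringIso, dif_neg e]
      refine (key (.tail e (Extraction.of_bringIso i l
        ((List.mem_cons.1 h).resolve_left (Ne.symm e)))) (l₂ := (j :: l).erase i)
        (by rw [List.erase_cons_tail (by simpa using e)])
        (by rw [List.erase_cons_tail (by simpa using e)])).congr ?_
      dsimp only [tensorList]
      simp only [cross, Category.assoc, Iso.trans_hom, whiskerLeftIso_hom, Iso.symm_hom,
        whiskerRightIso_hom, eqToIso.hom]

theorem Reordering.of_reorderIso [DecidableEq ι] : (l l' : List ι) → (h : l.Perm l') →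
    Reordering X l l' (reorderIso X l l' h).hom
  | l, [], h => by
    obtain rfl := List.perm_nil.1 h
    rw [reorderIso]
    exact Reordering.nil
  | l, i :: l', h => by
    rw [reorderIso]
    exact Reordering.cons (Extraction.of_bringIso i l _) (Reordering.of_reorderIso _ _ _)

/-- Sorting `l'` back into `l` gives, after `e.hom`, a reordering of `l` into itself. By uniqueness
it is the identity, so the backward sorting is `e.inv`. -/
theorem Reordering.symm {l l' : List ι} {e : tensorList X l ≅ tensorList X l'}
    (h : Reordering X l l' e.hom) : Reordering X l' l e.inv := by
  classical
  have h' := Reordering.of_reorderIso (X := X) l' l h.perm.symm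
  refine h'.congr ((Iso.hom_comp_eq_id e).1 ?_)
  exact (h.trans h').unique (Reordering.refl l)

end Coherence

end AQFT

namespace AQFT

/-! ### Normal forms of finite products by induction on the number of factors -/

section Letters

variable {M : Type u} [Category.{v} M] [MonoidalCategory M] {ι : Type w} {X : ι → M}

theorem normIso_nary_succ {n : ℕ} (a : Fin (n + 1) → TensorWord ι) :
    ((TensorWord.nary (n + 1) a).normIso X).hom =
      ((TensorWord.mul (a 0) (.nary n fun i => a i.succ)).normIso X).hom := by
  show (((a 0).normIso X).hom ⊗ₘ tensorFinMap (fun i => ((a (Fin.succ i)).normIso X).hom)) ≫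
    (_ ◁ (concatIso X (fun i => (a (Fin.succ i)).letters)).hom) ≫ (appendIso X _ _).inv =
    (((a 0).normIso X).hom ⊗ₘ (tensorFinMap (fun i => ((a (Fin.succ i)).normIso X).hom) ≫
      (concatIso X (fun i => (a (Fin.succ i)).letters)).hom)) ≫ (appendIso X _ _).inv
  rw [← Category.assoc, tensorHom_comp_whiskerLeft]

end Letters

/-! ### Structural morphisms between tensor expressions and their uniqueness -/

section Structural

variable {M : Type u} [Category.{v} M] [MonoidalCategory M] [SymmetricCategory M]
  {ι : Type w}

/-- The structural morphisms between tensor expressions: those which are composed of associators,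
unitors and braidings by means of composition and tensor product. -/
inductive Structural (X : ι → M) : (a b : TensorWord ι) → (a.eval X ⟶ b.eval X) → Prop
  | id (a : TensorWord ι) : Structural X a a (𝟙 (a.eval X))
  | comp {a b c : TensorWord ι} {f : a.eval X ⟶ b.eval X} {g : b.eval X ⟶ c.eval X} :
      Structural X a b f → Structural X b c g → Structural X a c (f ≫ g)
  | inv {a b : TensorWord ι} (e : a.eval X ≅ b.eval X) :
      Structural X a b e.hom → Structural X b a e.inv
  | tensor {a a' b b' : TensorWord ι} {f : a.eval X ⟶ a'.eval X} {g : b.eval X ⟶ b'.eval X} :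
      Structural X a a' f → Structural X b b' g →
        Structural X (.mul a b) (.mul a' b') (f ⊗ₘ g)
  | assoc (a b c : TensorWord ι) : Structural X (.mul (.mul a b) c) (.mul a (.mul b c))
      (α_ (a.eval X) (b.eval X) (c.eval X)).hom
  | leftUnitor (a : TensorWord ι) : Structural X (.mul .unit a) a (λ_ (a.eval X)).hom
  | rightUnitor (a : TensorWord ι) : Structural X (.mul a .unit) a (ρ_ (a.eval X)).hom
  | braiding (a b : TensorWord ι) : Structural X (.mul a b) (.mul b a)
      (β_ (a.eval X) (b.eval X)).hom
  | naryZero (a : Fin 0 → TensorWord ι) : Structural X (.nary 0 a) .unit (𝟙 (𝟙_ M))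
  | narySucc {n : ℕ} (a : Fin (n + 1) → TensorWord ι) :
      Structural X (.nary (n + 1) a) (.mul (a 0) (.nary n fun i => a i.succ))
        (𝟙 ((TensorWord.nary (n + 1) a).eval X))

variable {X : ι → M}

theorem Structural.congr {a b : TensorWord ι} {f g : a.eval X ⟶ b.eval X}
    (hf : Structural X a b f) (h : f = g) : Structural X a b g := h ▸ hf

theorem Structural.whiskerLeft (a : TensorWord ι) {b b' : TensorWord ι}
    {g : b.eval X ⟶ b'.eval X} (hg : Structural X b b' g) :
    Structural X (.mul a b) (.mul a b') (a.eval X ◁ g) :=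
  ((Structural.id a).tensor hg).congr (id_tensorHom _ _)

theorem Structural.whiskerRight (a : TensorWord ι) {b b' : TensorWord ι}
    {g : b.eval X ⟶ b'.eval X} (hg : Structural X b b' g) :
    Structural X (.mul b a) (.mul b' a) (g ▷ a.eval X) :=
  (hg.tensor (Structural.id a)).congr (tensorHom_id _ _)

theorem Structural.naryZero_inv (a : Fin 0 → TensorWord ι) :
    Structural X .unit (.nary 0 a) (𝟙 (𝟙_ M)) :=
  .inv (a := .nary 0 a) (b := .unit) (Iso.refl (𝟙_ M)) (.naryZero a)

theorem Structural.narySucc_inv {n : ℕ} (a : Fin (n + 1) → TensorWord ι) :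
    Structural X (.mul (a 0) (.nary n fun i => a i.succ)) (.nary (n + 1) a)
        (𝟙 ((TensorWord.nary (n + 1) a).eval X)) :=
  .inv (a := .nary (n + 1) a) (b := .mul (a 0) (.nary n fun i => a i.succ))
    (Iso.refl ((TensorWord.nary (n + 1) a).eval X)) (.narySucc a)

theorem Structural.nary : {n : ℕ} → {a b : Fin n → TensorWord ι} →
    {f : ∀ i, (a i).eval X ⟶ (b i).eval X} → (∀ i, Structural X (a i) (b i) (f i)) →
    Structural X (.nary n a) (.nary n b) (tensorFinMap f)
  | 0, a, b, _, _ => ((Structural.naryZero a).comp (.naryZero_inv b)).congr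
      (Category.id_comp (𝟙 (𝟙_ M)))
  | _ + 1, a, b, _, h => (((Structural.narySucc a).comp
      ((h 0).tensor (Structural.nary fun i => h i.succ))).comp (.narySucc_inv b)).congr
      ((Category.comp_id _).trans (Category.id_comp _))

theorem Structural.leftUnitor_inv (a : TensorWord ι) :
    Structural X a (.mul .unit a) (λ_ (a.eval X)).inv :=
  .inv (a := .mul .unit a) (b := a) (λ_ (a.eval X)) (.leftUnitor a)

theorem Structural.rightUnitor_inv (a : TensorWord ι) :
    Structural X a (.mul a .unit) (ρ_ (a.eval X)).inv :=
  .inv (a := .mul a .unit) (b := a) (ρ_ (a.eval X)) (.rightUnitor a)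

theorem Structural.assoc_inv (a b c : TensorWord ι) :
    Structural X (.mul a (.mul b c)) (.mul (.mul a b) c)
      (α_ (a.eval X) (b.eval X) (c.eval X)).inv :=
  .inv (a := .mul (.mul a b) c) (b := .mul a (.mul b c))
    (α_ (a.eval X) (b.eval X) (c.eval X)) (.assoc a b c)

theorem Structural.cross (a b c : TensorWord ι) :
    Structural X (.mul a (.mul b c)) (.mul b (.mul a c))
      (AQFT.cross (a.eval X) (b.eval X) (c.eval X)) :=
  (Structural.assoc_inv a b c).comp
    (((Structural.braiding a b).whiskerRight c).comp (.assoc b a c))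

/-- The tensor expression of a list of letters, bracketed from the right. -/
def listWord : List ι → TensorWord ι
  | [] => .unit
  | i :: l => .mul (.letter i) (listWord l)

/-- The value of `listWord l` is `tensorList X l`. -/
def listWordIso (X : ι → M) : (l : List ι) → ((listWord l).eval X ≅ tensorList X l)
  | [] => Iso.refl (𝟙_ M)
  | i :: l => whiskerLeftIso (X i) (listWordIso X l)

/-- `Structural` speaks only of values of tensor expressions, and `tensorList` is not literally one.
Morphisms of lists are therefore conjugated by `listWordIso`, which is built from identities. -/
theorem structural_appendIso (m : List ι) : (l : List ι) →
    Structural X (listWord (l ++ m)) (.mul (listWord l) (listWord m))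
      ((listWordIso X (l ++ m)).hom ≫ (appendIso X l m).hom ≫
        ((listWordIso X l).inv ⊗ₘ (listWordIso X m).inv))
  | [] => (Structural.leftUnitor_inv (listWord m)).congr (by
      show _ = (listWordIso X m).hom ≫ (λ_ _).inv ≫ (𝟙 (𝟙_ M) ⊗ₘ (listWordIso X m).inv)
      simp)
  | i :: l => ((Structural.whiskerLeft (.letter i) (structural_appendIso m l)).comp
      (.assoc_inv (.letter i) (listWord l) (listWord m))).congr (by
      show X i ◁ _ ≫ _ = X i ◁ (listWordIso X (l ++ m)).hom ≫
        (X i ◁ (appendIso X l m).hom ≫ (α_ _ _ _).inv) ≫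
        ((X i ◁ (listWordIso X l).inv) ⊗ₘ (listWordIso X m).inv)
      dsimp only [TensorWord.eval]
      simp only [MonoidalCategory.whiskerLeft_comp, Category.assoc]
      rw [← id_tensorHom (X i) (_ ⊗ₘ _), ← id_tensorHom (X i) (listWordIso X l).inv,
        associator_inv_naturality])

theorem structural_normIso : (a : TensorWord ι) →
    Structural X a (listWord a.letters) ((a.normIso X).hom ≫ (listWordIso X a.letters).inv)
  | .unit => (Structural.id .unit).congr (Category.id_comp (𝟙 (𝟙_ M))).symm
  | .letter i => (Structural.rightUnitor_inv (.letter i)).congr (by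
      refine ((congrArg (_ ≫ ·) ?_).trans (Category.comp_id (ρ_ (X i)).inv)).symm
      exact MonoidalCategory.whiskerLeft_id (X i) (𝟙_ M))
  | .mul a b => structural_mul (structural_normIso a) (structural_normIso b)
  | .nary n a => structural_nary a fun i => structural_normIso (a i)
where
  structural_mul {a b : TensorWord ι}
      (ha : Structural X a (listWord a.letters) ((a.normIso X).hom ≫ (listWordIso X a.letters).inv))
      (hb : Structural X b (listWord b.letters) ((b.normIso X).hom ≫ (listWordIso X b.letters).inv)) :
      Structural X (.mul a b) (listWord (a.letters ++ b.letters))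
        (((TensorWord.mul a b).normIso X).hom ≫ (listWordIso X (a.letters ++ b.letters)).inv) := by
    have h := Structural.inv (a := listWord (a.letters ++ b.letters))
      (b := .mul (listWord a.letters) (listWord b.letters))
      (listWordIso X (a.letters ++ b.letters) ≪≫ appendIso X a.letters b.letters ≪≫
        ((listWordIso X a.letters).symm ⊗ᵢ (listWordIso X b.letters).symm))
      (structural_appendIso b.letters a.letters)
    refine ((ha.tensor hb).comp h).congr ?_
    show (((a.normIso X).hom ≫ (listWordIso X a.letters).inv) ⊗ₘ
      ((b.normIso X).hom ≫ (listWordIso X b.letters).inv)) ≫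
      (((listWordIso X a.letters).hom ⊗ₘ (listWordIso X b.letters).hom) ≫
        (appendIso X a.letters b.letters).inv) ≫ (listWordIso X (a.letters ++ b.letters)).inv =
      (((a.normIso X).hom ⊗ₘ (b.normIso X).hom) ≫ (appendIso X a.letters b.letters).inv) ≫
        (listWordIso X (a.letters ++ b.letters)).inv
    rw [← Category.assoc, ← Category.assoc, tensorHom_comp_tensorHom]
    simp
  structural_nary : {n : ℕ} → (a : Fin n → TensorWord ι) →
      (∀ i, Structural X (a i) (listWord (a i).letters)
        (((a i).normIso X).hom ≫ (listWordIso X (a i).letters).inv)) →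
      Structural X (.nary n a) (listWord (TensorWord.nary n a).letters)
        (((TensorWord.nary n a).normIso X).hom ≫
          (listWordIso X (TensorWord.nary n a).letters).inv)
  | 0, a, _ => (Structural.naryZero a).congr
      ((congrArg (· ≫ _) (Category.id_comp (𝟙 (𝟙_ M)))).trans (Category.id_comp (𝟙 (𝟙_ M)))).symm
  | n + 1, a, h => ((Structural.narySucc a).comp (structural_mul (h 0)
      (structural_nary (fun i => a i.succ) fun i => h i.succ))).congr
        ((Category.id_comp _).trans (congrArg (· ≫ _) (normIso_nary_succ a).symm))

theorem Extraction.structural {i : ι} {l l' : List ι} {f : tensorList X l ⟶ X i ⊗ tensorList X l'}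
    (h : Extraction X i l l' f) : Structural X (listWord l) (.mul (.letter i) (listWord l'))
      ((listWordIso X l).hom ≫ f ≫ X i ◁ (listWordIso X l').inv) := by
  induction h with
  | head l =>
    refine (Structural.id (listWord (i :: l))).congr ?_
    show 𝟙 _ = X i ◁ (listWordIso X l).hom ≫ 𝟙 _ ≫ X i ◁ (listWordIso X l).inv
    rw [Category.id_comp, ← MonoidalCategory.whiskerLeft_comp, Iso.hom_inv_id,
      MonoidalCategory.whiskerLeft_id]
  | tail h _ ih =>
    rename_i j l l' f _
    refine ((ih.whiskerLeft (.letter j)).comp (.cross (.letter j) (.letter i) (listWord l'))).congr ?_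
    show X j ◁ _ ≫ AQFT.cross (X j) (X i) _ = X j ◁ (listWordIso X l).hom ≫
      (X j ◁ f ≫ AQFT.cross (X j) (X i) (tensorList X l')) ≫ X i ◁ X j ◁ (listWordIso X l').inv
    dsimp only [TensorWord.eval]
    simp only [MonoidalCategory.whiskerLeft_comp, Category.assoc]
    rw [cross_naturality_right]

theorem Reordering.structural {l l' : List ι} {f : tensorList X l ⟶ tensorList X l'}
    (h : Reordering X l l' f) : Structural X (listWord l) (listWord l')
      ((listWordIso X l).hom ≫ f ≫ (listWordIso X l').inv) := by
  induction h with
  | nil =>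
    refine (Structural.id .unit).congr ?_
    show 𝟙 (𝟙_ M) = 𝟙 (𝟙_ M) ≫ 𝟙 (𝟙_ M) ≫ 𝟙 (𝟙_ M)
    simp
  | cons h _ ih =>
    rename_i i l l₁ l' f g _
    refine (h.structural.comp (ih.whiskerLeft (.letter i))).congr ?_
    show (_ ≫ f ≫ X i ◁ _) ≫ X i ◁ (_ ≫ g ≫ _) = _ ≫ (f ≫ X i ◁ g) ≫ X i ◁ (listWordIso X l').inv
    simp only [MonoidalCategory.whiskerLeft_comp, Category.assoc]
    rw [← MonoidalCategory.whiskerLeft_comp_assoc, Iso.inv_hom_id, MonoidalCategory.whiskerLeft_id,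
      Category.id_comp]

/-- Normalisation, sorting and inverse normalisation are each structural. This makes the uniqueness
theorem applicable to every isomorphism that occurs in the operad axioms. -/
theorem structural_canonIso [DecidableEq ι] (a b : TensorWord ι) (h : a.letters.Perm b.letters) :
    Structural X a b (canonIso X a b h).hom := by
  have hb := Structural.inv (b.normIso X ≪≫ (listWordIso X b.letters).symm) (structural_normIso b)
  refine (((structural_normIso a).comp
    (Reordering.of_reorderIso (X := X) a.letters b.letters h).structural).comp hb).congr ?_
  simp [canonIso]

/-- In normal form each generator is a reordering, and reorderings are closed under composition,
inversion and tensor product. Distinctness of the letters is carried through the induction for the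
sake of the braiding alone. -/
theorem Structural.reordering {a b : TensorWord ι} {f : a.eval X ⟶ b.eval X}
    (h : Structural X a b f) : a.letters.Nodup → Reordering X a.letters b.letters
      ((a.normIso X).inv ≫ f ≫ (b.normIso X).hom) := by
  -- Composites and inverses pass through other expressions, whose letters must be known to be
  -- distinct before the inductive hypothesis applies.
  have perm : ∀ {a b : TensorWord ι} {f : a.eval X ⟶ b.eval X},
      Structural X a b f → a.letters.Perm b.letters := by
    intro a b f h
    induction h with
    | id => exact .refl _
    | comp _ _ h₁ h₂ => exact h₁.trans h₂
    | inv _ _ h => exact h.symm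
    | tensor _ _ h₁ h₂ => exact h₁.append h₂
    | assoc a b c => exact .of_eq (List.append_assoc _ _ _)
    | leftUnitor => exact .refl _
    | rightUnitor a => exact .of_eq (List.append_nil _)
    | braiding a b => exact List.perm_append_comm
    | naryZero => exact .refl _
    | narySucc => exact .refl _
  induction h with
  | id a =>
    intro _
    exact (Reordering.refl a.letters).congr (by simp)
  | comp h₁ _ ih₁ ih₂ =>
    intro hn
    exact ((ih₁ hn).trans (ih₂ ((perm h₁).nodup_iff.1 hn))).congr (by simp)
  | inv e h ih =>
    intro hn
    rename_i a b
    exact Reordering.symm (e := (a.normIso X).symm ≪≫ e ≪≫ b.normIso X)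
      (ih ((perm h).nodup_iff.2 hn)) |>.congr (by simp)
  | tensor h₁ h₂ ih₁ ih₂ =>
    intro hn
    rename_i a a' b b' f g
    have hn' := List.nodup_append'.1 hn
    refine ((ih₁ hn'.1).tensor (ih₂ hn'.2.1)).congr ?_
    show _ = ((appendIso X a.letters b.letters).hom ≫ ((a.normIso X).inv ⊗ₘ (b.normIso X).inv)) ≫
      (f ⊗ₘ g) ≫ ((a'.normIso X).hom ⊗ₘ (b'.normIso X).hom) ≫
        (appendIso X a'.letters b'.letters).inv
    rw [← tensorHom_comp_tensorHom, ← tensorHom_comp_tensorHom]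
    simp only [Category.assoc]
  | assoc a b c =>
    intro _
    refine (Reordering.append_assoc b.letters c.letters a.letters).congr ?_
    show _ = ((appendIso X (a.letters ++ b.letters) c.letters).hom ≫
      (((appendIso X a.letters b.letters).hom ≫ ((a.normIso X).inv ⊗ₘ (b.normIso X).inv)) ⊗ₘ
        (c.normIso X).inv)) ≫ (α_ _ _ _).hom ≫
      ((a.normIso X).hom ⊗ₘ (((b.normIso X).hom ⊗ₘ (c.normIso X).hom) ≫
        (appendIso X b.letters c.letters).inv)) ≫
        (appendIso X a.letters (b.letters ++ c.letters)).inv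
    have h₁ : ((appendIso X a.letters b.letters).hom ≫ ((a.normIso X).inv ⊗ₘ (b.normIso X).inv)) ⊗ₘ
        (c.normIso X).inv = (appendIso X a.letters b.letters).hom ▷ _ ≫
          (((a.normIso X).inv ⊗ₘ (b.normIso X).inv) ⊗ₘ (c.normIso X).inv) := by
      rw [whiskerRight_comp_tensorHom]
    have h₂ : (a.normIso X).hom ⊗ₘ (((b.normIso X).hom ⊗ₘ (c.normIso X).hom) ≫
        (appendIso X b.letters c.letters).inv) = ((a.normIso X).hom ⊗ₘ
        ((b.normIso X).hom ⊗ₘ (c.normIso X).hom)) ≫ _ ◁ (appendIso X b.letters c.letters).inv := by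
      rw [tensorHom_comp_whiskerLeft]
    rw [h₁, h₂]
    simp only [Category.assoc]
    rw [associator_naturality_assoc, tensorHom_comp_tensorHom_assoc, tensorHom_comp_tensorHom]
    simp
  | leftUnitor a =>
    intro _
    refine (Reordering.refl a.letters).congr ?_
    show _ = ((λ_ _).inv ≫ (𝟙 (𝟙_ M) ⊗ₘ (a.normIso X).inv)) ≫ (λ_ _).hom ≫ (a.normIso X).hom
    simp
  | rightUnitor a =>
    intro _
    refine (Reordering.append_nil a.letters).congr ?_
    show _ = ((appendIso X a.letters []).hom ≫ ((a.normIso X).inv ⊗ₘ 𝟙 (𝟙_ M))) ≫ (ρ_ _).hom ≫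
      (a.normIso X).hom
    dsimp only [tensorList]
    rw [tensorHom_id, Category.assoc, rightUnitor_naturality_assoc, Iso.inv_hom_id,
      Category.comp_id]
  | braiding a b =>
    intro hn
    refine (Reordering.braiding a.letters b.letters (List.nodup_append'.1 hn).2.2).congr ?_
    show _ = ((appendIso X a.letters b.letters).hom ≫ ((a.normIso X).inv ⊗ₘ (b.normIso X).inv)) ≫
      (β_ _ _).hom ≫ ((b.normIso X).hom ⊗ₘ (a.normIso X).hom) ≫
        (appendIso X b.letters a.letters).inv
    rw [Category.assoc, BraidedCategory.braiding_naturality_assoc, tensorHom_comp_tensorHom_assoc]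
    simp
  | naryZero a =>
    intro _
    refine Reordering.nil.congr ?_
    show 𝟙 (𝟙_ M) = (𝟙 (𝟙_ M) ≫ 𝟙 (𝟙_ M)) ≫ 𝟙 (𝟙_ M) ≫ 𝟙 (𝟙_ M)
    simp
  | narySucc a =>
    intro _
    refine (Reordering.refl _).congr ?_
    rw [← normIso_nary_succ]
    exact ((congrArg (_ ≫ ·) (Category.id_comp _)).trans (Iso.inv_hom_id _)).symm

theorem Structural.perm {a b : TensorWord ι} {f : a.eval X ⟶ b.eval X} (h : Structural X a b f)
    (hn : a.letters.Nodup) : a.letters.Perm b.letters :=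
  (h.reordering hn).perm

/-- Coherence: two structural morphisms between tensor expressions without repeated letters are
equal. -/
theorem Structural.unique {a b : TensorWord ι} {f g : a.eval X ⟶ b.eval X}
    (hf : Structural X a b f) (hg : Structural X a b g) (hn : a.letters.Nodup) : f = g := by
  have h := (hf.reordering hn).unique (hg.reordering hn)
  rwa [Iso.cancel_iso_inv_left, Iso.cancel_iso_hom_right] at h

/-- Substitution of tensor expressions for the letters of a tensor expression. -/
def TensorWord.bind {κ : Type*} : TensorWord ι → (ι → TensorWord κ) → TensorWord κ
  | .unit, _ => .unit
  | .letter i, s => s i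
  | .mul a b, s => .mul (a.bind s) (b.bind s)
  | .nary n a, s => .nary n fun i => (a i).bind s

/-- The value of a tensor expression after substitution. -/
def bindIso {κ : Type*} {X : ι → M} {Y : κ → M} {s : ι → TensorWord κ}
    (φ : ∀ i, (s i).eval Y ≅ X i) : (a : TensorWord ι) → ((a.bind s).eval Y ≅ a.eval X)
  | .unit => Iso.refl (𝟙_ M)
  | .letter i => φ i
  | .mul a b => bindIso φ a ⊗ᵢ bindIso φ b
  | .nary _ a => tensorFinIso fun i => bindIso φ (a i)

/-- Substitution takes each generator to a generator of the same kind, so no distinctness is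
required. This allows a permutation of factors to be reused when the factors are themselves products
or units. -/
theorem Structural.bind {κ : Type*} {Y : κ → M} {s : ι → TensorWord κ}
    (φ : ∀ i, (s i).eval Y ≅ X i) {a b : TensorWord ι} {f : a.eval X ⟶ b.eval X}
    (h : Structural X a b f) :
    Structural Y (a.bind s) (b.bind s) ((bindIso φ a).hom ≫ f ≫ (bindIso φ b).inv) := by
  induction h with
  | id a => exact (Structural.id _).congr (by simp)
  | comp _ _ h₁ h₂ => exact (h₁.comp h₂).congr (by simp)
  | inv e _ ih =>
    rename_i a b _
    exact (Structural.inv (bindIso φ a ≪≫ e ≪≫ (bindIso φ b).symm) ih).congr (by simp)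
  | tensor _ _ ih₁ ih₂ =>
    rename_i a a' b b' f g _ _
    refine (ih₁.tensor ih₂).congr ?_
    show _ = ((bindIso φ a).hom ⊗ₘ (bindIso φ b).hom) ≫ (f ⊗ₘ g) ≫
      ((bindIso φ a').inv ⊗ₘ (bindIso φ b').inv)
    rw [tensorHom_comp_tensorHom, tensorHom_comp_tensorHom]
  | assoc a b c =>
    refine (Structural.assoc _ _ _).congr ?_
    show _ = (((bindIso φ a).hom ⊗ₘ (bindIso φ b).hom) ⊗ₘ (bindIso φ c).hom) ≫
      (α_ _ _ _).hom ≫ ((bindIso φ a).inv ⊗ₘ ((bindIso φ b).inv ⊗ₘ (bindIso φ c).inv))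
    rw [associator_naturality_assoc, tensorHom_comp_tensorHom, tensorHom_comp_tensorHom]
    simp
  | leftUnitor a =>
    refine (Structural.leftUnitor _).congr ?_
    show _ = (𝟙 (𝟙_ M) ⊗ₘ (bindIso φ a).hom) ≫ (λ_ _).hom ≫ (bindIso φ a).inv
    simp
  | rightUnitor a =>
    refine (Structural.rightUnitor _).congr ?_
    show _ = ((bindIso φ a).hom ⊗ₘ 𝟙 (𝟙_ M)) ≫ (ρ_ _).hom ≫ (bindIso φ a).inv
    simp
  | braiding a b =>
    refine (Structural.braiding _ _).congr ?_
    show _ = ((bindIso φ a).hom ⊗ₘ (bindIso φ b).hom) ≫ (β_ _ _).hom ≫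
      ((bindIso φ b).inv ⊗ₘ (bindIso φ a).inv)
    rw [BraidedCategory.braiding_naturality_assoc, tensorHom_comp_tensorHom]
    simp
  | naryZero a =>
    refine (Structural.naryZero _).congr ?_
    show 𝟙 (𝟙_ M) = 𝟙 (𝟙_ M) ≫ 𝟙 (𝟙_ M) ≫ 𝟙 (𝟙_ M)
    simp
  | narySucc a =>
    refine (Structural.narySucc _).congr ?_
    exact ((congrArg (_ ≫ ·) (Category.id_comp _)).trans (Iso.hom_inv_id _)).symm

end Structural

end AQFT

namespace AQFT

/-! ### Products in a monoid along tensor expressions -/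

section Products

variable {M : Type u} [Category.{v} M] [MonoidalCategory M] {ι : Type w}

/-- The product of a finite sequence of morphisms to a monoid. -/
def prodFin {A : M} [MonObj A] : {n : ℕ} → {X : Fin n → M} → (∀ i, X i ⟶ A) → (tensorFin X ⟶ A)
  | 0, _, _ => MonObj.one (X := A)
  | _ + 1, _, g => (g 0 ⊗ₘ prodFin fun i => g i.succ) ≫ MonObj.mul (X := A)

/-- The product of morphisms to a monoid, taken along a list of letters. -/
def listProd {A : M} [MonObj A] {X : ι → M} (g : ∀ i, X i ⟶ A) :
    (l : List ι) → (tensorList X l ⟶ A)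
  | [] => MonObj.one (X := A)
  | i :: l => (g i ⊗ₘ listProd g l) ≫ MonObj.mul (X := A)

/-- The product of morphisms to a monoid, taken along a tensor expression. -/
def wordProd {A : M} [MonObj A] {X : ι → M} (g : ∀ i, X i ⟶ A) :
    (a : TensorWord ι) → (a.eval X ⟶ A)
  | .unit => MonObj.one (X := A)
  | .letter i => g i
  | .mul a b => (wordProd g a ⊗ₘ wordProd g b) ≫ MonObj.mul (X := A)
  | .nary _ a => prodFin fun i => wordProd g (a i)

variable {A : M} [MonObj A]

theorem mul_tensor_mul {X Y Z : M} (f : X ⟶ A) (g : Y ⟶ A) (h : Z ⟶ A) :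
    (f ⊗ₘ ((g ⊗ₘ h) ≫ MonObj.mul (X := A))) ≫ MonObj.mul (X := A) =
      (α_ X Y Z).inv ≫ (((f ⊗ₘ g) ≫ MonObj.mul (X := A)) ⊗ₘ h) ≫ MonObj.mul (X := A) := by
  have h₁ : f ⊗ₘ ((g ⊗ₘ h) ≫ MonObj.mul (X := A)) =
      (f ⊗ₘ (g ⊗ₘ h)) ≫ A ◁ MonObj.mul (X := A) := by rw [tensorHom_comp_whiskerLeft]
  have h₂ : ((f ⊗ₘ g) ≫ MonObj.mul (X := A)) ⊗ₘ h =
      ((f ⊗ₘ g) ⊗ₘ h) ≫ MonObj.mul (X := A) ▷ A := by rw [tensorHom_comp_whiskerRight]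
  rw [h₁, h₂, Category.assoc, Category.assoc, MonObj.mul_assoc, associator_naturality_assoc,
    Iso.inv_hom_id_assoc]

theorem one_tensor_mul {X : M} (f : X ⟶ A) :
    (MonObj.one (X := A) ⊗ₘ f) ≫ MonObj.mul (X := A) = (λ_ X).hom ≫ f := by
  rw [MonoidalCategory.tensorHom_def', Category.assoc, MonObj.one_mul, leftUnitor_naturality]

theorem tensor_one_mul {X : M} (f : X ⟶ A) :
    (f ⊗ₘ MonObj.one (X := A)) ≫ MonObj.mul (X := A) = (ρ_ X).hom ≫ f := by
  rw [MonoidalCategory.tensorHom_def, Category.assoc, MonObj.mul_one, rightUnitor_naturality]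

theorem listProd_append {X : ι → M} (g : ∀ i, X i ⟶ A) (m : List ι) : (l : List ι) →
    listProd g (l ++ m) = (appendIso X l m).hom ≫ (listProd g l ⊗ₘ listProd g m) ≫
      MonObj.mul (X := A)
  | [] => by
    show _ = (λ_ _).inv ≫ (MonObj.one (X := A) ⊗ₘ listProd g m) ≫ MonObj.mul (X := A)
    rw [one_tensor_mul, Iso.inv_hom_id_assoc]
    rfl
  | i :: l => by
    show (g i ⊗ₘ listProd g (l ++ m)) ≫ MonObj.mul (X := A) =
      (X i ◁ (appendIso X l m).hom ≫ (α_ _ _ _).inv) ≫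
        (((g i ⊗ₘ listProd g l) ≫ MonObj.mul (X := A)) ⊗ₘ listProd g m) ≫ MonObj.mul (X := A)
    rw [Category.assoc, ← mul_tensor_mul, listProd_append g m l, whiskerLeft_comp_tensorHom_assoc]

/-- General associativity together with the unit laws: brackets and units do not affect a product,
only the order of its letters does. -/
theorem wordProd_eq_listProd {X : ι → M} (g : ∀ i, X i ⟶ A) : (a : TensorWord ι) →
    wordProd g a = (a.normIso X).hom ≫ listProd g a.letters
  | .unit => (Category.id_comp (MonObj.one (X := A))).symm
  | .letter i => by
    show g i = (ρ_ (X i)).inv ≫ (g i ⊗ₘ MonObj.one (X := A)) ≫ MonObj.mul (X := A)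
    rw [tensor_one_mul, Iso.inv_hom_id_assoc]
  | .mul a b => wordProd_mul (wordProd_eq_listProd g a) (wordProd_eq_listProd g b)
  | .nary n a => wordProd_nary a fun i => wordProd_eq_listProd g (a i)
where
  wordProd_mul {a b : TensorWord ι} (ha : wordProd g a = (a.normIso X).hom ≫ listProd g a.letters)
      (hb : wordProd g b = (b.normIso X).hom ≫ listProd g b.letters) :
      wordProd g (.mul a b) = ((TensorWord.mul a b).normIso X).hom ≫
        listProd g (a.letters ++ b.letters) := by
    show (wordProd g a ⊗ₘ wordProd g b) ≫ MonObj.mul (X := A) =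
      (((a.normIso X).hom ⊗ₘ (b.normIso X).hom) ≫ (appendIso X a.letters b.letters).inv) ≫ _
    rw [listProd_append, ha, hb, Category.assoc, Iso.inv_hom_id_assoc,
      tensorHom_comp_tensorHom_assoc]
  wordProd_nary : {n : ℕ} → (a : Fin n → TensorWord ι) →
      (∀ i, wordProd g (a i) = ((a i).normIso X).hom ≫ listProd g (a i).letters) →
      wordProd g (.nary n a) = ((TensorWord.nary n a).normIso X).hom ≫
        listProd g (TensorWord.nary n a).letters
  | 0, a, _ => by
    show MonObj.one (X := A) = (𝟙 (𝟙_ M) ≫ 𝟙 (𝟙_ M)) ≫ MonObj.one (X := A)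
    simp
  | n + 1, a, h => (wordProd_mul (h 0) (wordProd_nary (fun i => a i.succ) fun i => h i.succ)).trans
      (congrArg (· ≫ _) (normIso_nary_succ a).symm)

theorem tensorFinMap_prodFin : {n : ℕ} → {X Y : Fin n → M} → (f : ∀ i, X i ⟶ Y i) →
    (g : ∀ i, Y i ⟶ A) → tensorFinMap f ≫ prodFin g = prodFin fun i => f i ≫ g i
  | 0, _, _, _, _ => Category.id_comp (MonObj.one (X := A))
  | _ + 1, X, Y, f, g => by
    show (f 0 ⊗ₘ tensorFinMap fun i => f (Fin.succ i)) ≫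
      (g 0 ⊗ₘ prodFin fun i => g (Fin.succ i)) ≫ MonObj.mul (X := A) =
        ((f 0 ≫ g 0) ⊗ₘ prodFin fun i => f (Fin.succ i) ≫ g (Fin.succ i)) ≫ MonObj.mul (X := A)
    rw [tensorHom_comp_tensorHom_assoc, tensorFinMap_prodFin]

theorem wordProd_comp {A' : M} [MonObj A'] (h : A ⟶ A') [IsMonHom h] {X : ι → M}
    (g : ∀ i, X i ⟶ A) : (a : TensorWord ι) → wordProd g a ≫ h = wordProd (fun i => g i ≫ h) a
  | .unit => IsMonHom.one_hom h
  | .letter _ => rfl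
  | .mul a b => wordProd_mul (wordProd_comp h g a) (wordProd_comp h g b)
  | .nary n a => wordProd_nary a fun i => wordProd_comp h g (a i)
where
  wordProd_mul {X Y : M} {f : X ⟶ A} {f' : X ⟶ A'} {g : Y ⟶ A} {g' : Y ⟶ A'} (hf : f ≫ h = f')
      (hg : g ≫ h = g') :
      ((f ⊗ₘ g) ≫ MonObj.mul (X := A)) ≫ h = (f' ⊗ₘ g') ≫ MonObj.mul (X := A') := by
    rw [Category.assoc, IsMonHom.mul_hom, tensorHom_comp_tensorHom_assoc, hf, hg]
  wordProd_nary : {n : ℕ} → (a : Fin n → TensorWord ι) →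
      (∀ i, wordProd g (a i) ≫ h = wordProd (fun i => g i ≫ h) (a i)) →
      wordProd g (.nary n a) ≫ h = wordProd (fun i => g i ≫ h) (.nary n a)
  | 0, _, _ => IsMonHom.one_hom h
  | n + 1, a, ha => wordProd_mul (ha 0) (wordProd_nary (fun i => a i.succ) fun i => ha i.succ)

variable [SymmetricCategory M]

/-- Two morphisms to a monoid commute. -/
def Commutes {X Y : M} (f : X ⟶ A) (g : Y ⟶ A) : Prop :=
  (f ⊗ₘ g) ≫ MonObj.mul (X := A) = (β_ X Y).hom ≫ (g ⊗ₘ f) ≫ MonObj.mul (X := A)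

theorem Commutes.symm {X Y : M} {f : X ⟶ A} {g : Y ⟶ A} (h : Commutes f g) : Commutes g f := by
  unfold Commutes at *
  rw [h, SymmetricCategory.symmetry_assoc]

theorem Commutes.cross {X Y Z : M} {f : X ⟶ A} {g : Y ⟶ A} (h : Commutes f g) (p : Z ⟶ A) :
    AQFT.cross X Y Z ≫ (g ⊗ₘ ((f ⊗ₘ p) ≫ MonObj.mul (X := A))) ≫ MonObj.mul (X := A) =
      (f ⊗ₘ ((g ⊗ₘ p) ≫ MonObj.mul (X := A))) ≫ MonObj.mul (X := A) := by
  rw [mul_tensor_mul, mul_tensor_mul, h, AQFT.cross]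
  simp only [Category.assoc, Iso.hom_inv_id_assoc]
  rw [whiskerRight_comp_tensorHom_assoc]

/-- The letter `i` crosses only the letters in front of it, so only these have to commute with it.
-/
theorem Extraction.listProd {X : ι → M} (g : ∀ i, X i ⟶ A) {i : ι} {l l' : List ι}
    {f : tensorList X l ⟶ X i ⊗ tensorList X l'} (h : Extraction X i l l' f)
    (hc : ∀ j, j ≠ i → [j, i].Sublist l → Commutes (g j) (g i)) :
    f ≫ (g i ⊗ₘ AQFT.listProd g l') ≫ MonObj.mul (X := A) = AQFT.listProd g l := by
  induction h with
  | head l => exact Category.id_comp _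
  | tail hj h ih =>
    rename_i j l l' f
    have ih := ih fun k hk hs => hc k hk (hs.cons j)
    have hcj := hc j hj ((List.singleton_sublist.2 (h.perm.mem_iff.2 List.mem_cons_self)).cons_cons j)
    show (X j ◁ f ≫ AQFT.cross (X j) (X i) (tensorList X l')) ≫
      (g i ⊗ₘ ((g j ⊗ₘ AQFT.listProd g l') ≫ MonObj.mul (X := A))) ≫ MonObj.mul (X := A) =
        (g j ⊗ₘ AQFT.listProd g l) ≫ MonObj.mul (X := A)
    rw [Category.assoc, hcj.cross, whiskerLeft_comp_tensorHom_assoc, ih]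

theorem Extraction.sublist {X : ι → M} {i : ι} {l l' : List ι}
    {f : tensorList X l ⟶ X i ⊗ tensorList X l'} (h : Extraction X i l l' f) : l'.Sublist l := by
  induction h with
  | head l => exact List.sublist_cons_self i l
  | tail _ _ ih => exact ih.cons_cons _

/-- Selection sort crosses a pair of different letters only if their order is reversed in the
target. Commutation of the inverted pairs therefore suffices. -/
theorem Reordering.listProd {X : ι → M} (g : ∀ i, X i ⟶ A) {l l' : List ι}
    {f : tensorList X l ⟶ tensorList X l'} (h : Reordering X l l' f)
    (hc : ∀ i j, i ≠ j → [i, j].Sublist l → [j, i].Sublist l' → Commutes (g i) (g j)) :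
    f ≫ AQFT.listProd g l' = AQFT.listProd g l := by
  induction h with
  | nil => exact Category.id_comp _
  | cons hb hs ih =>
    rename_i i l l₁ l' f s
    have ih := ih fun a b hab h₁ h₂ => hc a b hab (h₁.trans hb.sublist) (h₂.cons i)
    have hl := hb.listProd g fun j hj hjl => hc j i hj hjl (by
      -- A letter `j` that is passed by `i` stays behind in `l₁` and so follows `i` in the target:
      -- the pair is inverted.
      have : j ∈ l₁ := (List.mem_cons.1 (hb.perm.mem_iff.1
        (hjl.subset List.mem_cons_self))).resolve_left hj
      exact (List.singleton_sublist.2 (hs.perm.mem_iff.1 this)).cons_cons i)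
    show (f ≫ X i ◁ s) ≫ (g i ⊗ₘ AQFT.listProd g l') ≫ MonObj.mul (X := A) = _
    rw [Category.assoc, whiskerLeft_comp_tensorHom_assoc, ih, hl]

theorem Structural.wordProd {X : ι → M} (g : ∀ i, X i ⟶ A) {a b : TensorWord ι}
    {f : a.eval X ⟶ b.eval X} (h : Structural X a b f) (hn : a.letters.Nodup)
    (hc : ∀ i j, i ≠ j → [i, j].Sublist a.letters → [j, i].Sublist b.letters →
      Commutes (g i) (g j)) :
    f ≫ AQFT.wordProd g b = AQFT.wordProd g a := by
  have := (h.reordering hn).listProd g hc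
  rw [wordProd_eq_listProd g a, wordProd_eq_listProd g b, ← this]
  simp

/-- Two products along tensor expressions agree if all pairs of letters which occur in different
orders commute. -/
theorem Structural.wordProd_eq {X : ι → M} (g : ∀ i, X i ⟶ A) {a b b' : TensorWord ι}
    {f : a.eval X ⟶ b.eval X} {f' : a.eval X ⟶ b'.eval X} (h : Structural X a b f)
    (h' : Structural X a b' f') (hn : a.letters.Nodup)
    (hc : ∀ i j, i ≠ j → [i, j].Sublist b.letters → [j, i].Sublist b'.letters →
      Commutes (g i) (g j)) :
    f ≫ AQFT.wordProd g b = f' ≫ AQFT.wordProd g b' := by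
  classical
  -- The canonical morphism from `b` to `b'` compares the two products. By coherence, `f` followed
  -- by it is `f'`.
  have hp := (h.perm hn).symm.trans (h'.perm hn)
  have hs := structural_canonIso (X := X) b b' hp
  rw [← hs.wordProd g ((h.perm hn).nodup_iff.1 hn) hc, ← Category.assoc,
    (h.comp hs).unique h' hn]

end Products

end AQFT

namespace AQFT

/-! ### Evaluation at points -/

section Values

variable {M : Type u} [Category.{v} M] [MonoidalCategory M]

/-- The value of a morphism `P ⊗ Z ⟶ Y` at a point of `P`. -/
def atPt {P Z Y : M} (p : 𝟙_ M ⟶ P) (f : P ⊗ Z ⟶ Y) : Z ⟶ Y :=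
  (λ_ Z).inv ≫ p ▷ Z ≫ f

theorem atPt_comp {P Z Y Y' : M} (p : 𝟙_ M ⟶ P) (f : P ⊗ Z ⟶ Y) (h : Y ⟶ Y') :
    atPt p (f ≫ h) = atPt p f ≫ h := by
  simp [atPt]

theorem atPt_whiskerRight {P P' Z Y : M} (p : 𝟙_ M ⟶ P) (q : P ⟶ P') (f : P' ⊗ Z ⟶ Y) :
    atPt p (q ▷ Z ≫ f) = atPt (p ≫ q) f := by
  simp [atPt]

theorem atPt_whiskerLeft {P Z Z' Y : M} (p : 𝟙_ M ⟶ P) (h : Z ⟶ Z') (f : P ⊗ Z' ⟶ Y) :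
    atPt p (P ◁ h ≫ f) = h ≫ atPt p f := by
  rw [atPt, ← whisker_exchange_assoc, ← leftUnitor_inv_naturality_assoc]
  rfl

theorem atPt_tensor {P P' Z Z' Y : M} (p : 𝟙_ M ⟶ P) (q : P ⟶ P') (h : Z ⟶ Z') (f : P' ⊗ Z' ⟶ Y) :
    atPt p ((q ⊗ₘ h) ≫ f) = h ≫ atPt (p ≫ q) f := by
  rw [MonoidalCategory.tensorHom_def', Category.assoc, atPt_whiskerLeft, atPt_whiskerRight]

end Values

/-! ### The shuffle of an algebra axiom with its operations fixed -/

section Words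

variable {M : Type u} [Category.{v} M] [MonoidalCategory M] [SymmetricCategory M]

theorem structural_permFin {n : ℕ} (X : Fin n → M) (σ : Equiv.Perm (Fin n)) :
    Structural X (permWord (Equiv.refl _)) (permWord σ) (permFin X σ) :=
  structural_canonIso _ _ _

theorem structural_ptFin {ι : Type w} (X : ι → M) : (m : ℕ) →
    Structural X .unit (.nary m fun _ => .unit) (ptFin fun _ : Fin m => 𝟙 (𝟙_ M))
  | 0 => .naryZero_inv _
  | m + 1 => (((Structural.leftUnitor_inv .unit).comp
      ((Structural.id .unit).tensor (structural_ptFin X m))).comp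
        (.narySucc_inv fun _ => .unit)).congr (Category.comp_id _)

/-- `unshuffle` is canonical for words that also contain letters for the operations. Substituting
the unit for those letters leaves a structural morphism in the arguments alone. -/
theorem structural_unshuffle {m N : ℕ} {k : Fin m → ℕ} (e : Fin N ≃ (i : Fin m) × Fin (k i))
    (Y : (i : Fin m) × Fin (k i) → M) :
    Structural Y
      (.mul (.mul .unit (.nary m fun _ => .unit)) (.nary N fun p => .letter (e p)))
      (.mul .unit (.nary m fun i => .mul .unit (.nary (k i) fun j => .letter ⟨i, j⟩)))
      (unshuffle e (𝟙_ M) (fun _ => 𝟙_ M) fun i j => Y ⟨i, j⟩) := by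
  let X : FactorName m k → M := factor (𝟙_ M) (fun _ => 𝟙_ M) fun i j => Y ⟨i, j⟩
  let s : FactorName m k → TensorWord ((i : Fin m) × Fin (k i))
    | .inl _ => .unit
    | .inr (.inl _) => .unit
    | .inr (.inr z) => .letter z
  let φ : ∀ n, (s n).eval Y ≅ X n := fun n => match n with
    | .inl _ => Iso.refl (𝟙_ M)
    | .inr (.inl _) => Iso.refl (𝟙_ M)
    | .inr (.inr z) => Iso.refl (Y z)
  have h := (structural_canonIso (X := X) (outerWord e) (innerWord k) (outerWord_perm e)).bind φ
  have h₁ : (bindIso φ (outerWord e)).hom = 𝟙 _ := by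
    show (𝟙 (𝟙_ M) ⊗ₘ tensorFinMap fun _ : Fin m => 𝟙 (𝟙_ M)) ⊗ₘ
      tensorFinMap (fun p => 𝟙 (Y (e p))) = 𝟙 _
    rw [tensorFinMap_id, tensorFinMap_id, id_tensorHom_id, id_tensorHom_id]
  have h₂ : (bindIso φ (innerWord k)).inv = 𝟙 _ := by
    show 𝟙 (𝟙_ M) ⊗ₘ tensorFinMap (fun i : Fin m => 𝟙 (𝟙_ M) ⊗ₘ
      tensorFinMap fun j : Fin (k i) => 𝟙 (Y ⟨i, j⟩)) = 𝟙 _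
    simp only [tensorFinMap_id, id_tensorHom_id]
  rw [h₁, h₂] at h
  exact h.congr ((Category.id_comp _).trans (Category.comp_id _))

/-- The canonical morphism from the tensor product over all pairs `(i, j)` to the iterated tensor
product. -/
def regroup {m N : ℕ} {k : Fin m → ℕ} (e : Fin N ≃ (i : Fin m) × Fin (k i))
    (Y : ∀ i, Fin (k i) → M) :
    tensorFin (fun p => Y (e p).1 (e p).2) ⟶ tensorFin fun i => tensorFin (Y i) :=
  (λ_ _).inv ≫ ptTensor (𝟙 (𝟙_ M)) (ptFin fun _ : Fin m => 𝟙 (𝟙_ M)) ▷ _ ≫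
    unshuffle e (𝟙_ M) (fun _ => 𝟙_ M) Y ≫ (λ_ _).hom ≫ tensorFinMap fun _ => (λ_ _).hom

theorem structural_regroup {m N : ℕ} {k : Fin m → ℕ} (e : Fin N ≃ (i : Fin m) × Fin (k i))
    (Y : (i : Fin m) × Fin (k i) → M) :
    Structural Y (.nary N fun p => .letter (e p))
      (.nary m fun i => .nary (k i) fun j => .letter ⟨i, j⟩) (regroup e fun i j => Y ⟨i, j⟩) := by
  refine (Structural.leftUnitor_inv _).comp (Structural.comp (Structural.whiskerRight _ ?_)
    ((structural_unshuffle e Y).comp ((Structural.leftUnitor _).comp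
      (Structural.nary fun i => Structural.leftUnitor _))))
  exact (Structural.leftUnitor_inv .unit).comp ((Structural.id .unit).tensor (structural_ptFin Y m))

/-- The points of the operations factor through the unit, so naturality of `unshuffle` replaces all
operation factors by units, and `regroup` remains. This turns the associativity axiom of an algebra
into a law for individual operations. -/
theorem atPt_unshuffle {m N : ℕ} {k : Fin m → ℕ} (e : Fin N ≃ (i : Fin m) × Fin (k i))
    {P Z : M} {X W : Fin m → M} {Y : ∀ i, Fin (k i) → M} (p : 𝟙_ M ⟶ P) (x : ∀ i, 𝟙_ M ⟶ X i)
    (g : ∀ i, X i ⊗ tensorFin (Y i) ⟶ W i) (f : P ⊗ tensorFin W ⟶ Z) :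
    atPt (ptTensor p (ptFin x)) (unshuffle e P X Y ≫ P ◁ tensorFinMap g ≫ f) =
      regroup e Y ≫ tensorFinMap (fun i => atPt (x i) (g i)) ≫ atPt p f := by
  have h₁ : ptTensor p (ptFin x) =
      ptTensor (𝟙 (𝟙_ M)) (ptFin fun _ : Fin m => 𝟙 (𝟙_ M)) ≫ (p ⊗ₘ tensorFinMap x) := by
    rw [ptTensor_comp, ptFin_map]
    simp
  have h₂ := unshuffle_natural e p x (fun i j => 𝟙 (Y i j))
  simp only [tensorFinMap_id, tensorHom_id] at h₂
  have h₃ : tensorFinMap (fun i => atPt (x i) (g i)) =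
      tensorFinMap (fun i => (λ_ (tensorFin (Y i))).inv) ≫ tensorFinMap (fun i => x i ▷ _ ≫ g i) :=
    tensorFinMap_comp _ _
  have h₄ : tensorFinMap (fun i => (λ_ (tensorFin (Y i))).hom) ≫
      tensorFinMap (fun i => (λ_ (tensorFin (Y i))).inv) = 𝟙 _ := by
    rw [← tensorFinMap_comp]
    simp [tensorFinMap_id]
  rw [h₁, ← atPt_whiskerRight, reassoc_of% h₂, h₃, regroup]
  simp only [atPt, Category.assoc]
  rw [reassoc_of% h₄, tensorHom_comp_whiskerLeft_assoc, ← tensorFinMap_comp,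
    leftUnitor_inv_naturality_assoc, Iso.hom_inv_id_assoc, whisker_exchange_assoc,
    MonoidalCategory.tensorHom_def, Category.assoc]

end Words

/-! ### Algebras over a copower operad, described by single operations -/

section Operations

variable {M : Type u} [Category.{v} M] [MonoidalCategory M] [SymmetricCategory M]
  [MonoidalClosed M]

/-- Currying makes a generating family remain jointly epimorphic after tensoring. The braiding first
moves `P` to the side on which `Generating.whisker` applies. -/
theorem Generating.ext_atPt {K : Type w} {P Z Y : M} {p : K → (𝟙_ M ⟶ P)} (hp : Generating p)
    {f g : P ⊗ Z ⟶ Y} (h : ∀ k, atPt (p k) f = atPt (p k) g) : f = g := by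
  rw [← cancel_epi (β_ Z P).hom]
  refine hp.whisker _ _ fun k => ?_
  have h := h k
  simp only [atPt, Iso.cancel_iso_inv_left] at h
  rw [BraidedCategory.braiding_naturality_right_assoc, h,
    BraidedCategory.braiding_naturality_right_assoc]

variable [HasColimits M]

theorem atPt_copowerTensorDesc {S : Type v} {Z Y : M} (g : S → (Z ⟶ Y)) (s : S) :
    atPt (copowerPt s) (copowerTensorDesc g) = g s := by
  rw [atPt, copowerTensorDesc, BraidedCategory.braiding_naturality_left_assoc,
    ← MonoidalClosed.uncurry_natural_left, copowerPt_desc, MonoidalClosed.uncurry_curry]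
  simp

namespace OperadAlgebra

variable {𝔠 : Type v} {O : SetOperad.{v} 𝔠}

/-- The action of a single operation. -/
noncomputable def op (A : OperadAlgebra (O.baseChange M)) {t : 𝔠} {a : Profile 𝔠} (x : O.obj t a) :
    tensorFin (fun i => A.carrier (a.col i)) ⟶ A.carrier t :=
  atPt (O.pt M x) (A.act t a)

/-- The next three laws are the axioms of an algebra evaluated at the summands of the copowers.
Since these summands generate, the laws conversely imply the axioms, as `ofOp` shows. -/
theorem op_perm (A : OperadAlgebra (O.baseChange M)) {t : 𝔠} {a : Profile 𝔠} (x : O.obj t a)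
    (σ : Equiv.Perm (Fin a.len)) :
    permFin (fun i => A.carrier (a.col i)) σ ≫ A.op (O.map (a.permHom σ) x) = A.op x := by
  refine Eq.trans ?_ (congrArg (atPt (O.pt M x)) (A.act_perm t a σ))
  refine Eq.trans ?_ (atPt_tensor _ _ _ _).symm
  exact congrArg (fun q => permFin (fun i => A.carrier (a.col i)) σ ≫ atPt q (A.act t (a.permute σ)))
    (O.pt_map M (a.permHom σ) x).symm

theorem op_comp (A : OperadAlgebra (O.baseChange M)) {t : 𝔠} {a : Profile 𝔠}
    {b : Fin a.len → Profile 𝔠} (x : O.obj t a) (y : ∀ i, O.obj (a.col i) (b i)) :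
    A.op (O.comp x y) = regroup (Profile.split b) (fun i j => A.carrier ((b i).col j)) ≫
      tensorFinMap (fun i => A.op (y i)) ≫ A.op x := by
  refine Eq.trans ?_ ((congrArg (atPt (ptTensor (O.pt M x) (ptFin fun i => O.pt M (y i))))
    (A.act_comp t a b)).trans (atPt_unshuffle _ _ _ _ _))
  refine Eq.trans ?_ (atPt_whiskerRight _ _ _).symm
  exact congrArg (fun q => atPt q (A.act t (Profile.concat b))) (O.pt_comp M x y).symm

theorem op_one (A : OperadAlgebra (O.baseChange M)) (t : 𝔠) :
    A.op (O.one t) = (ρ_ (A.carrier t)).hom := by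
  have h := congrArg (atPt (𝟙 (𝟙_ M))) (A.act_one t)
  refine Eq.trans ?_ (h.trans ?_)
  · refine Eq.trans ?_ (atPt_whiskerRight _ _ _).symm
    exact congrArg (fun q => atPt q (A.act t (Profile.single t))) (Category.id_comp _).symm
  · show (λ_ _).inv ≫ 𝟙 (𝟙_ M) ▷ _ ≫ (λ_ (A.carrier t ⊗ 𝟙_ M)).hom ≫ (ρ_ (A.carrier t)).hom = _
    rw [id_whiskerRight, Category.id_comp]
    exact Iso.inv_hom_id_assoc _ _

theorem ext_of_op {A B : OperadAlgebra (O.baseChange M)} (h : A.carrier = B.carrier)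
    (h' : ∀ {t a} (x : O.obj t a), HEq (A.op x) (B.op x)) : A = B := by
  obtain ⟨A, α, h₁, h₂, h₃⟩ := A
  obtain ⟨B, β, h₄, h₅, h₆⟩ := B
  dsimp only at h
  subst h
  have e : α = β := funext fun t => funext fun a =>
    (O.generating_pt M t a).ext_atPt fun x => eq_of_heq (h' x)
  subst e
  rfl

/-- An algebra over `O ⊗ I`, given by the actions of the operations of `O`. -/
noncomputable def ofOp (X : 𝔠 → M)
    (op : ∀ {t : 𝔠} {a : Profile 𝔠}, O.obj t a → (tensorFin (fun i => X (a.col i)) ⟶ X t))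
    (op_perm : ∀ {t : 𝔠} {a : Profile 𝔠} (x : O.obj t a) (σ : Equiv.Perm (Fin a.len)),
      permFin (fun i => X (a.col i)) σ ≫ op (O.map (a.permHom σ) x) = op x)
    (op_comp : ∀ {t : 𝔠} {a : Profile 𝔠} {b : Fin a.len → Profile 𝔠} (x : O.obj t a)
      (y : ∀ i, O.obj (a.col i) (b i)), op (O.comp x y) =
        regroup (Profile.split b) (fun i j => X ((b i).col j)) ≫
          tensorFinMap (fun i => op (y i)) ≫ op x)
    (op_one : ∀ t, op (O.one t) = (ρ_ (X t)).hom) : OperadAlgebra (O.baseChange M) where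
  carrier := X
  act t a := copowerTensorDesc fun x => op x
  act_perm t a σ := (O.generating_pt M t a).ext_atPt fun x => by
    refine (atPt_tensor _ _ _ _).trans ?_
    refine (congrArg (fun q => permFin _ σ ≫ atPt q _) (O.pt_map M (a.permHom σ) x)).trans ?_
    refine (congrArg (permFin _ σ ≫ ·) (atPt_copowerTensorDesc _ _)).trans ?_
    exact (op_perm x σ).trans (atPt_copowerTensorDesc _ _).symm
  -- The composition axiom starts from a tensor product of copowers, which is generated by the
  -- tensors of an outer operation `x` with inner operations `y i`.
  act_comp t a b := ((O.generating_pt M t a).tensor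
      (Generating.fin fun i => O.generating_pt M (a.col i) (b i))).ext_atPt fun z => by
    obtain ⟨x, y⟩ := z
    refine (atPt_whiskerRight _ _ _).trans ?_
    refine (congrArg (fun q => atPt q _) (O.pt_comp M x y)).trans ?_
    refine (atPt_copowerTensorDesc _ _).trans ((op_comp x y).trans ?_)
    refine Eq.trans ?_ (atPt_unshuffle (Profile.split b) (O.pt M x) (fun i => O.pt M (y i))
      (fun i => copowerTensorDesc fun z => op z) (copowerTensorDesc fun z => op z)).symm
    refine congrArg (_ ≫ ·) (congrArg₂ (· ≫ ·) ?_ (atPt_copowerTensorDesc _ _).symm)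
    exact congrArg tensorFinMap (funext fun i => (atPt_copowerTensorDesc _ _).symm)
  act_one t := (generating_unit (M := M)).ext_atPt fun _ : PUnit.{1} => by
    refine (atPt_whiskerRight _ _ _).trans ?_
    refine (congrArg (fun q => atPt q _) (Category.id_comp _)).trans ?_
    refine (atPt_copowerTensorDesc _ _).trans ((op_one t).trans ?_)
    show _ = (λ_ _).inv ≫ 𝟙 (𝟙_ M) ▷ _ ≫ (λ_ (X t ⊗ 𝟙_ M)).hom ≫ (ρ_ (X t)).hom
    rw [id_whiskerRight, Category.id_comp]
    exact (Iso.inv_hom_id_assoc _ _).symm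

theorem op_hom {A B : OperadAlgebra (O.baseChange M)} (f : A ⟶ B) {t : 𝔠} {a : Profile 𝔠}
    (x : O.obj t a) : A.op x ≫ Hom.app f t = tensorFinMap (fun i => Hom.app f (a.col i)) ≫ B.op x :=
  (atPt_comp _ _ _).symm.trans ((congrArg (atPt (O.pt M x)) (Hom.act_app f t a)).trans
    (atPt_whiskerLeft _ _ _))

/-- A morphism of algebras over `O ⊗ I`, given by a family of morphisms which commute with the
actions of the operations of `O`. -/
def homOfOp {A B : OperadAlgebra (O.baseChange M)} (f : ∀ t, A.carrier t ⟶ B.carrier t)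
    (h : ∀ {t : 𝔠} {a : Profile 𝔠} (x : O.obj t a),
      A.op x ≫ f t = tensorFinMap (fun i => f (a.col i)) ≫ B.op x) : A ⟶ B :=
  Hom.mk f fun t a => (O.generating_pt M t a).ext_atPt fun x =>
    (atPt_comp _ _ _).trans ((h x).trans (atPt_whiskerLeft _ _ _).symm)

end OperadAlgebra

end Operations

end AQFT

namespace AQFT

/-! ### Order of letters in concatenated sequences -/

section Lists

variable {ι : Type w}

theorem concatLists_singleton : {n : ℕ} → (s : Fin n → ι) →
    concatLists (fun k => [s k]) = List.ofFn s
  | 0, _ => rfl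
  | _ + 1, s => by
    rw [concatLists, concatLists_singleton, List.ofFn_succ]
    rfl

theorem map_concatLists {κ : Type*} (r : ι → κ) : {n : ℕ} → (l : Fin n → List ι) →
    (concatLists l).map r = concatLists fun i => (l i).map r
  | 0, _ => rfl
  | _ + 1, l => by
    rw [concatLists, concatLists, List.map_append, map_concatLists]

theorem pairwise_concatLists {R : ι → ι → Prop} : {n : ℕ} → (l : Fin n → List ι) →
    (∀ i, (l i).Pairwise R) → (∀ i j, i < j → ∀ x ∈ l i, ∀ y ∈ l j, R x y) →
    (concatLists l).Pairwise R
  | 0, _, _, _ => List.Pairwise.nil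
  | _ + 1, l, h, h' => by
    rw [concatLists, List.pairwise_append]
    refine ⟨h 0, pairwise_concatLists _ (fun i => h i.succ) fun i j hij =>
      h' _ _ (Fin.succ_lt_succ_iff.2 hij), fun x hx y hy => ?_⟩
    obtain ⟨j, hj⟩ := (mem_concatLists _ y).1 hy
    exact h' 0 j.succ (Fin.succ_pos j) x hx y hj

/-- Both lists are strictly increasing for the order that `split` transports from the positions,
which is lexicographic, and both contain every pair. A finite set has only one such list. -/
theorem ofFn_split {𝔠 : Type*} {m : ℕ} (b : Fin m → Profile 𝔠) :
    List.ofFn (Profile.split b) = concatLists fun i => List.ofFn fun j => ⟨i, j⟩ := by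
  let R : ((i : Fin m) × Fin (b i).len) → ((i : Fin m) × Fin (b i).len) → Prop :=
    fun x y => (Profile.split b).symm x < (Profile.split b).symm y
  have h₁ : (List.ofFn (Profile.split b)).Pairwise R := by
    rw [List.pairwise_ofFn]
    intro p q hpq
    simpa [R] using hpq
  have h₂ : (concatLists fun i => List.ofFn fun j : Fin (b i).len =>
      (⟨i, j⟩ : (i : Fin m) × Fin (b i).len)).Pairwise R := by
    refine pairwise_concatLists _ (fun i => ?_) fun i j hij x hx y hy => ?_
    · rw [List.pairwise_ofFn]
      exact fun j k hjk => (split_symm_lt b _ _).2 (Or.inr ⟨rfl, hjk⟩)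
    · obtain ⟨x, rfl⟩ := (List.mem_ofFn' _ _).1 hx
      obtain ⟨y, rfl⟩ := (List.mem_ofFn' _ _).1 hy
      exact (split_symm_lt b _ _).2 (Or.inl hij)
  have hR : ∀ x y, R x y → x ≠ y := by
    rintro x _ h rfl
    exact lt_irrefl _ h
  refine List.Perm.eq_of_pairwise (fun x y _ _ h h' => absurd h' (lt_asymm h)) h₁ h₂ ?_
  refine (List.perm_ext_iff_of_nodup (h₁.imp (hR _ _)) (h₂.imp (hR _ _))).2 fun x => ?_
  refine ⟨fun _ => (mem_concatLists _ _).2 ⟨x.1, (List.mem_ofFn' _ _).2 ⟨x.2, rfl⟩⟩, fun _ => ?_⟩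
  exact (List.mem_ofFn' _ _).2 ⟨(Profile.split b).symm x, Equiv.apply_symm_apply _ _⟩

/-- The tensor expression of a finite sequence of letters. -/
def seqWord {n : ℕ} (s : Fin n → ι) : TensorWord ι :=
  .nary n fun k => .letter (s k)

theorem letters_seqWord {n : ℕ} (s : Fin n → ι) : (seqWord s).letters = List.ofFn s :=
  concatLists_singleton s

theorem letters_seqWord_get (l : List ι) : (seqWord l.get).letters = l := by
  rw [letters_seqWord, List.ofFn_get]

end Lists

/-! ### Regrouping a sequence of arbitrary letters -/

section SequenceWords

variable {M : Type u} [Category.{v} M] [MonoidalCategory M] [SymmetricCategory M] {ι : Type w}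

theorem structural_regroup_seqWord {m N : ℕ} {k : Fin m → ℕ}
    (e : Fin N ≃ (i : Fin m) × Fin (k i)) (X : ι → M) (r : ∀ i, Fin (k i) → ι) :
    Structural X (seqWord fun p => r (e p).1 (e p).2) (.nary m fun i => seqWord (r i))
      (regroup e fun i j => X (r i j)) := by
  let φ : ∀ z : (i : Fin m) × Fin (k i),
      (TensorWord.letter (r z.1 z.2)).eval X ≅ X (r z.1 z.2) := fun z => Iso.refl _
  have h := (structural_regroup e fun z => X (r z.1 z.2)).bind φ
  have h₁ : (bindIso φ (.nary N fun p => .letter (e p))).hom = 𝟙 _ :=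
    tensorFinMap_id fun p => X (r (e p).1 (e p).2)
  have h₂ : (bindIso φ (.nary m fun i => .nary (k i) fun j => .letter ⟨i, j⟩)).inv = 𝟙 _ :=
    (congrArg tensorFinMap (funext fun i => tensorFinMap_id fun j => X (r i j))).trans
      (tensorFinMap_id _)
  rw [h₁, h₂] at h
  exact h.congr ((Category.id_comp _).trans (Category.comp_id _))

end SequenceWords

section Unitors

variable {M : Type u} [Category.{v} M] [MonoidalCategory M]

theorem rightUnitor_inv_tensor_comp {X A B : M} (f : X ⟶ A) (q : A ⊗ 𝟙_ M ⟶ B) :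
    (ρ_ X).inv ≫ (f ⊗ₘ 𝟙 (𝟙_ M)) ≫ q = f ≫ (ρ_ A).inv ≫ q := by
  rw [tensorHom_id, ← rightUnitor_inv_naturality_assoc]

theorem whiskerLeft_rightUnitor_inv_tensor_comp {X Y A A' B : M} (f : X ⟶ A) (g : Y ⟶ A')
    (q : A ⊗ A' ⊗ 𝟙_ M ⟶ B) :
    X ◁ (ρ_ Y).inv ≫ (f ⊗ₘ (g ⊗ₘ 𝟙 (𝟙_ M))) ≫ q = (f ⊗ₘ g) ≫ A ◁ (ρ_ A').inv ≫ q := by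
  rw [whiskerLeft_comp_tensorHom_assoc, tensorHom_id, ← rightUnitor_inv_naturality,
    tensorHom_comp_whiskerLeft_assoc]

end Unitors

/-! ### Operations with the identity permutation -/

section OrderedOperations

variable {C : OrthCat.{v}}

/-- The class of an operation in the operad `O_C / ∼⊥`. -/
def OrthCat.cls (C : OrthCat.{v}) {t : C.carrier} {c : Profile C.carrier}
    (x : PermOp C.carrier t c) : C.setOperad.obj t c :=
  C.congruence.cls x

theorem OrthCat.cls_comp (C : OrthCat.{v}) {t : C.carrier} {a : Profile C.carrier}
    {b : Fin a.len → Profile C.carrier} (x : PermOp C.carrier t a)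
    (y : ∀ i, PermOp C.carrier (a.col i) (b i)) :
    C.setOperad.comp (C.cls x) (fun i => C.cls (y i)) = C.cls (PermOp.comp x y) :=
  C.congruence.qcomp_mk x y

/-- The operation given by the identity permutation and a sequence of morphisms. -/
def PermOp.ordered {t : C.carrier} {c : Profile C.carrier} (f : ∀ i, c.col i ⟶ t) :
    PermOp C.carrier t c where
  perm := Equiv.refl _
  hom := f

/-- A permutation of `Fin n` is determined by the order it induces. For identity permutations the
induced order on the blocks is the lexicographic one, which is that of the positions themselves. -/
theorem operadicPerm_refl {𝔠 : Type w} {m : ℕ} (b : Fin m → Profile 𝔠) :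
    operadicPerm b (Equiv.refl _) (fun _ => Equiv.refl _) = Equiv.refl _ :=
  fin_perm_ext fun p q => by
    have h := operadicPerm_lt b (Equiv.refl _) (fun _ => Equiv.refl _) (Profile.split b p)
      (Profile.split b q)
    have h' := split_symm_lt b (Profile.split b p) (Profile.split b q)
    rw [Equiv.symm_apply_apply, Equiv.symm_apply_apply] at h h'
    exact h.trans h'.symm

theorem PermOp.comp_ordered {t : C.carrier} {a : Profile C.carrier}
    {b : Fin a.len → Profile C.carrier} (f : ∀ i, a.col i ⟶ t) (g : ∀ i j, (b i).col j ⟶ a.col i) :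
    PermOp.comp (ordered f) (fun i => ordered (g i)) = ordered (c := Profile.concat b) fun p =>
      g (Profile.split b p).1 (Profile.split b p).2 ≫ f (Profile.split b p).1 :=
  PermOp.ext (operadicPerm_refl b) rfl

end OrderedOperations

namespace OperadAlgebra

/-! ### Evaluating tensor expressions in an algebra -/

section Evaluation

variable {M : Type u} [Category.{v} M] [MonoidalCategory M] [SymmetricCategory M]
  [MonoidalClosed M] [HasColimits M] {C : OrthCat.{v}}
  (A : OperadAlgebra (C.setOperad.baseChange M)) {ι : Type w} {col : ι → C.carrier}
  {t t' : C.carrier}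

/-- The action of the operation with the identity permutation on a sequence of morphisms. -/
noncomputable def opSeq (f : ∀ i, col i ⟶ t) {n : ℕ} (s : Fin n → ι) :
    (seqWord s).eval (fun i => A.carrier (col i)) ⟶ A.carrier t :=
  A.op (a := ⟨n, fun k => col (s k)⟩) (C.cls (PermOp.ordered fun k => f (s k)))

/-- The two sequences are the same, although their lengths need not be definitionally equal. After
identifying them, coherence forces the structural endomorphism to be the identity. -/
theorem opSeq_structural (f : ∀ i, col i ⟶ t) {n n' : ℕ} {s : Fin n → ι} {s' : Fin n' → ι}
    (h : List.ofFn s = List.ofFn s') (hn : (List.ofFn s).Nodup)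
    {φ : (seqWord s).eval (fun i => A.carrier (col i)) ⟶
      (seqWord s').eval fun i => A.carrier (col i)}
    (hφ : Structural (fun i => A.carrier (col i)) (seqWord s) (seqWord s') φ) :
    φ ≫ A.opSeq f s' = A.opSeq f s := by
  obtain ⟨rfl, h⟩ := Sigma.mk.inj (List.ofFn_inj'.1 h)
  obtain rfl := eq_of_heq h
  obtain rfl := hφ.unique (.id _) (by rwa [letters_seqWord])
  exact Category.id_comp _

variable [DecidableEq ι]

/-- The evaluation of a tensor expression by means of the operations with the identity
permutation. -/
noncomputable def evalWord (f : ∀ i, col i ⟶ t) (a : TensorWord ι) :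
    a.eval (fun i => A.carrier (col i)) ⟶ A.carrier t :=
  (canonIso (fun i => A.carrier (col i)) a (seqWord a.letters.get)
    (.of_eq (letters_seqWord_get _).symm)).hom ≫ A.opSeq f a.letters.get

/-- By coherence, any structural path from a word to the row of its letters may replace the
canonical one in the definition of `evalWord`. -/
theorem evalWord_eq (f : ∀ i, col i ⟶ t) {a : TensorWord ι} (hn : a.letters.Nodup) {n : ℕ}
    {s : Fin n → ι} (h : a.letters = List.ofFn s)
    {φ : a.eval (fun i => A.carrier (col i)) ⟶ (seqWord s).eval fun i => A.carrier (col i)}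
    (hφ : Structural (fun i => A.carrier (col i)) a (seqWord s) φ) :
    A.evalWord f a = φ ≫ A.opSeq f s := by
  have hl : (seqWord s).letters = a.letters := (letters_seqWord s).trans h.symm
  have hψ := structural_canonIso (X := fun i => A.carrier (col i)) (seqWord s)
    (seqWord a.letters.get) (.of_eq (hl.trans (letters_seqWord_get _).symm))
  rw [← A.opSeq_structural f (by rw [← h, List.ofFn_get]) (h ▸ hn) hψ, ← Category.assoc,
    (hφ.comp hψ).unique (structural_canonIso _ _ (.of_eq (letters_seqWord_get _).symm)) hn]
  rfl

/-- Evaluation depends only on the order of the letters, since both words are brought to the same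
row. This is the source of the monoid axioms. -/
theorem evalWord_structural (f : ∀ i, col i ⟶ t) {a b : TensorWord ι} (hn : a.letters.Nodup)
    (h : a.letters = b.letters)
    {φ : a.eval (fun i => A.carrier (col i)) ⟶ b.eval fun i => A.carrier (col i)}
    (hφ : Structural (fun i => A.carrier (col i)) a b φ) :
    φ ≫ A.evalWord f b = A.evalWord f a := by
  rw [A.evalWord_eq f hn (h.trans (List.ofFn_get _).symm) (hφ.comp
    (structural_canonIso b (seqWord b.letters.get) (.of_eq (letters_seqWord_get _).symm))),
    Category.assoc]
  rfl

/-- Composing operations with identity permutations concatenates their sequences of morphisms. The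
composition law of the algebra thus evaluates a product of words by evaluating each word and then
applying one outer operation. -/
theorem evalWord_comp_nary (f : ∀ i, col i ⟶ t) (h : t ⟶ t') {m : ℕ} (a : Fin m → TensorWord ι)
    (hn : (TensorWord.nary m a).letters.Nodup) :
    A.evalWord (fun i => f i ≫ h) (.nary m a) = tensorFinMap (fun i => A.evalWord f (a i)) ≫
      A.op (a := ⟨m, fun _ => t⟩) (C.cls (PermOp.ordered fun _ => h)) := by
  let b : Fin m → Profile C.carrier := fun i =>
    ⟨(a i).letters.length, fun j => col ((a i).letters.get j)⟩
  let X : ι → M := fun i => A.carrier (col i)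
  let r : ∀ i, Fin (b i).len → ι := fun i j => (a i).letters.get j
  -- The letters of the whole product must be indexed by the positions of the concatenated profile,
  -- which is the arity of the composed operation.
  let s : Fin (Profile.concat b).len → ι := fun p => r (Profile.split b p).1 (Profile.split b p).2
  have hl : (TensorWord.nary m a).letters = List.ofFn s := by
    have h₁ := congrArg (List.map fun z : (i : Fin m) × Fin (b i).len => r z.1 z.2) (ofFn_split b)
    rw [List.map_ofFn, map_concatLists] at h₁
    refine Eq.trans (congrArg concatLists (funext fun i => ?_)) h₁.symm
    rw [List.map_ofFn]
    exact (List.ofFn_get (a i).letters).symm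
  have hs := structural_canonIso (X := X) (.nary m a) (seqWord s)
    (.of_eq (hl.trans (letters_seqWord s).symm))
  have hr := structural_regroup_seqWord (Profile.split b) X r
  have hop := A.op_comp (a := ⟨m, fun _ => t⟩) (b := b) (C.cls (PermOp.ordered fun _ => h))
    fun i => C.cls (PermOp.ordered (c := b i) fun j => f (r i j))
  rw [OrthCat.cls_comp, PermOp.comp_ordered] at hop
  have hc : ∀ i, Structural X (a i) (seqWord (r i)) (canonIso X (a i) (seqWord (r i))
      (.of_eq (letters_seqWord_get _).symm)).hom := fun i => structural_canonIso _ _ _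
  -- Flattening the product and regrouping it is the same, by coherence, as bringing each factor
  -- separately to the row of its letters.
  have hu := (hs.comp hr).unique (Structural.nary hc) hn
  refine (A.evalWord_eq _ hn hl hs).trans ((congrArg (_ ≫ ·) hop).trans ?_)
  refine (Category.assoc _ _ _).symm.trans ((congrArg (· ≫ _) hu).trans ?_)
  refine (Category.assoc _ _ _).symm.trans (congrArg (· ≫ _) ?_)
  exact (tensorFinMap_comp _ _).symm

/-- The unit of the monoid given by an algebra. -/
noncomputable def unit (t : C.carrier) : 𝟙_ M ⟶ A.carrier t :=
  A.op (a := ⟨0, fun _ => t⟩) (C.cls (PermOp.ordered fun _ => 𝟙 t))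

/-- The multiplication of the monoid given by an algebra. -/
noncomputable def mult (t : C.carrier) : A.carrier t ⊗ A.carrier t ⟶ A.carrier t :=
  A.carrier t ◁ (ρ_ (A.carrier t)).inv ≫
    A.op (a := ⟨2, fun _ => t⟩) (C.cls (PermOp.ordered fun _ => 𝟙 t))

/-- The action of the morphisms of the orthogonal category on an algebra. -/
noncomputable def unary (f : t ⟶ t') : A.carrier t ⟶ A.carrier t' :=
  (ρ_ (A.carrier t)).inv ≫ A.op (a := ⟨1, fun _ => t⟩) (C.cls (PermOp.ordered fun _ => f))

theorem evalWord_nary (f : ∀ i, col i ⟶ t) {m : ℕ} (a : Fin m → TensorWord ι)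
    (hn : (TensorWord.nary m a).letters.Nodup) :
    A.evalWord f (.nary m a) = tensorFinMap (fun i => A.evalWord f (a i)) ≫
      A.op (a := ⟨m, fun _ => t⟩) (C.cls (PermOp.ordered fun _ => 𝟙 t)) := by
  rw [← A.evalWord_comp_nary f (𝟙 t) a hn]
  exact congrArg (fun g => A.evalWord g _) (funext fun i => (Category.comp_id (f i)).symm)

theorem evalWord_unit (f : ∀ i, col i ⟶ t) : A.evalWord f .unit = A.unit t := by
  rw [← A.evalWord_structural f (a := .unit) (b := .nary 0 Fin.elim0) List.nodup_nil rfl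
    (.naryZero_inv _)]
  refine (Category.id_comp _).trans ((A.evalWord_nary f (m := 0) Fin.elim0 List.nodup_nil).trans ?_)
  exact Category.id_comp (A.unit t)

theorem evalWord_letter (f : ∀ i, col i ⟶ t) (i : ι) :
    A.evalWord f (.letter i) = A.unary (f i) := by
  refine A.evalWord_eq f (a := .letter i) (List.nodup_singleton i) (s := fun _ : Fin 1 => i) (by simp [TensorWord.letters])
    (φ := (ρ_ (A.carrier (col i))).inv) ?_
  refine ((Structural.rightUnitor_inv (.letter i)).comp ((Structural.whiskerLeft (.letter i)
    (.naryZero_inv fun _ => .letter i)).comp (.narySucc_inv fun _ : Fin 1 => .letter i))).congr ?_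
  refine Eq.trans (congrArg (_ ≫ ·) ?_) (Category.comp_id _)
  exact (Category.comp_id _).trans (MonoidalCategory.whiskerLeft_id _ _)

/-- A word is regarded as a one-fold product, so that `h` becomes the outer unary operation. -/
theorem evalWord_comp (f : ∀ i, col i ⟶ t) (h : t ⟶ t') (a : TensorWord ι)
    (hn : a.letters.Nodup) :
    A.evalWord (fun i => f i ≫ h) a = A.evalWord f a ≫ A.unary h := by
  have hl : a.letters = (TensorWord.nary 1 fun _ => a).letters :=
    (List.append_nil a.letters).symm
  have hs : Structural (fun i => A.carrier (col i)) a (.nary 1 fun _ => a)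
      (ρ_ (a.eval fun i => A.carrier (col i))).inv := by
    refine ((Structural.rightUnitor_inv a).comp ((Structural.whiskerLeft a
      (.naryZero_inv fun _ => a)).comp (.narySucc_inv fun _ => a))).congr ?_
    refine Eq.trans (congrArg (_ ≫ ·) ?_) (Category.comp_id _)
    exact (Category.comp_id _).trans (MonoidalCategory.whiskerLeft_id _ _)
  rw [← A.evalWord_structural _ hn hl hs, A.evalWord_comp_nary f h _ (hl ▸ hn)]
  exact rightUnitor_inv_tensor_comp _ _

theorem evalWord_mul (f : ∀ i, col i ⟶ t) (a b : TensorWord ι)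
    (hn : (TensorWord.mul a b).letters.Nodup) :
    A.evalWord f (.mul a b) = (A.evalWord f a ⊗ₘ A.evalWord f b) ≫ A.mult t := by
  let c : Fin 2 → TensorWord ι := Fin.cons a fun _ => b
  have hl : (TensorWord.mul a b).letters = (TensorWord.nary 2 c).letters :=
    congrArg (a.letters ++ ·) (List.append_nil b.letters).symm
  let X : ι → M := fun i => A.carrier (col i)
  -- `tensorFin` of two factors ends in a unit object. The right unitor inserts it, as in the
  -- definition of `mult`.
  have hs : Structural X (.mul a b) (.nary 2 c) (a.eval X ◁ (ρ_ (b.eval X)).inv) := by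
    refine (((Structural.rightUnitor_inv b).whiskerLeft a).comp
      ((((Structural.naryZero_inv fun _ => b).whiskerLeft b).whiskerLeft a).comp
      (((Structural.narySucc_inv fun _ : Fin 1 => b).whiskerLeft a).comp (.narySucc_inv c)))).congr ?_
    refine Eq.trans (congrArg (_ ≫ ·) ?_) (Category.comp_id _)
    refine (congrArg₂ (· ≫ ·) ?_ ((Category.comp_id _).trans
      (MonoidalCategory.whiskerLeft_id _ _))).trans (Category.comp_id _)
    exact (congrArg (a.eval X ◁ ·) (MonoidalCategory.whiskerLeft_id _ _)).trans
      (MonoidalCategory.whiskerLeft_id _ _)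
  rw [← A.evalWord_structural f hn hl hs, A.evalWord_nary f c (hl ▸ hn)]
  exact whiskerLeft_rightUnitor_inv_tensor_comp _ _ _

end Evaluation

end OperadAlgebra

end AQFT

namespace AQFT

namespace OperadAlgebra

/-! ### From algebras to `⊥`-commutative functors -/

section Monoids

variable {M : Type u} [Category.{v} M] [MonoidalCategory M] [SymmetricCategory M]
  [MonoidalClosed M] [HasColimits M] {C : OrthCat.{v}}
  (A : OperadAlgebra (C.setOperad.baseChange M)) {t t' t'' : C.carrier}

theorem unary_id (t : C.carrier) : A.unary (𝟙 t) = 𝟙 (A.carrier t) :=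
  (congrArg ((ρ_ (A.carrier t)).inv ≫ ·) (A.op_one t)).trans (Iso.inv_hom_id _)

theorem unary_comp (f : t ⟶ t') (g : t' ⟶ t'') : A.unary (f ≫ g) = A.unary f ≫ A.unary g := by
  have h := A.evalWord_comp (ι := Fin 1) (col := fun _ => t) (fun _ => f) g (.letter 0)
    (List.nodup_singleton _)
  rwa [evalWord_letter, evalWord_letter] at h

theorem evalWord_mul_of {ι : Type w} [DecidableEq ι] {col : ι → C.carrier} (f : ∀ i, col i ⟶ t)
    {a b : TensorWord ι} (hn : (TensorWord.mul a b).letters.Nodup)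
    {p : a.eval (fun i => A.carrier (col i)) ⟶ A.carrier t}
    {q : b.eval (fun i => A.carrier (col i)) ⟶ A.carrier t} (hp : A.evalWord f a = p)
    (hq : A.evalWord f b = q) : A.evalWord f (.mul a b) = (p ⊗ₘ q) ≫ A.mult t :=
  hp ▸ hq ▸ A.evalWord_mul f a b hn

theorem evalWord_id {ι : Type w} [DecidableEq ι] (i : ι) :
    A.evalWord (col := fun _ => t) (fun _ => 𝟙 t) (.letter i) = 𝟙 (A.carrier t) :=
  (A.evalWord_letter _ i).trans (A.unary_id t)

/-- Each monoid axiom compares two expressions with the same letters in the same order, so it is an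
instance of `evalWord_structural`. Separate letters are used for factors of the same color `t`,
because coherence needs distinct letters. -/
theorem unit_mult (t : C.carrier) : A.unit t ▷ A.carrier t ≫ A.mult t = (λ_ (A.carrier t)).hom := by
  have h := A.evalWord_structural (ι := Fin 1) (col := fun _ => t) (fun _ => 𝟙 t)
    (a := .mul .unit (.letter 0)) (b := .letter 0) (List.nodup_singleton 0) rfl (.leftUnitor _)
  rw [A.evalWord_mul_of (fun _ => 𝟙 t) (a := .unit) (b := .letter 0) (List.nodup_singleton 0)
    (A.evalWord_unit _) (A.evalWord_id 0), evalWord_id] at h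
  rw [← tensorHom_id]
  exact h.symm.trans (Category.comp_id _)

theorem mult_unit (t : C.carrier) : A.carrier t ◁ A.unit t ≫ A.mult t = (ρ_ (A.carrier t)).hom := by
  have h := A.evalWord_structural (ι := Fin 1) (col := fun _ => t) (fun _ => 𝟙 t)
    (a := .mul (.letter 0) .unit) (b := .letter 0) (List.nodup_singleton 0) rfl (.rightUnitor _)
  rw [A.evalWord_mul_of (fun _ => 𝟙 t) (a := .letter 0) (b := .unit) (List.nodup_singleton 0)
    (A.evalWord_id 0) (A.evalWord_unit _), evalWord_id] at h
  rw [← id_tensorHom]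
  exact h.symm.trans (Category.comp_id _)

theorem mult_assoc (t : C.carrier) : A.mult t ▷ A.carrier t ≫ A.mult t =
    (α_ _ _ _).hom ≫ A.carrier t ◁ A.mult t ≫ A.mult t := by
  have hn : ([0, 1, 2] : List (Fin 3)).Nodup := by decide
  have e : ∀ i j : Fin 3, i ≠ j → A.evalWord (col := fun _ => t) (fun _ => 𝟙 t)
      (.mul (.letter i) (.letter j)) = A.mult t := fun i j hij => by
    refine (A.evalWord_mul_of _ (a := .letter i) (b := .letter j) (show [i, j].Nodup by simpa using hij)
      (A.evalWord_id i) (A.evalWord_id j)).trans ?_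
    exact (congrArg (· ≫ A.mult t) (id_tensorHom_id _ _)).trans (Category.id_comp _)
  have h := A.evalWord_structural (ι := Fin 3) (col := fun _ => t) (fun _ => 𝟙 t)
    (a := .mul (.mul (.letter 0) (.letter 1)) (.letter 2))
    (b := .mul (.letter 0) (.mul (.letter 1) (.letter 2))) hn rfl (.assoc _ _ _)
  rw [A.evalWord_mul_of (fun _ => 𝟙 t) (a := .mul (.letter 0) (.letter 1)) (b := .letter 2) hn
      (e 0 1 (by decide)) (A.evalWord_id 2), A.evalWord_mul_of (fun _ => 𝟙 t) (a := .letter 0)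
      (b := .mul (.letter 1) (.letter 2)) hn (A.evalWord_id 0) (e 1 2 (by decide))] at h
  rw [← id_tensorHom, ← tensorHom_id]
  exact h.symm

/-- The monoid given by an algebra and a color. -/
@[reducible]
noncomputable def monObj (t : C.carrier) : MonObj (A.carrier t) where
  one := A.unit t
  mul := A.mult t
  one_mul := A.unit_mult t
  mul_one := A.mult_unit t
  mul_assoc := A.mult_assoc t

theorem unit_unary (h : t ⟶ t') : A.unit t ≫ A.unary h = A.unit t' := by
  have e := A.evalWord_comp (ι := Fin 1) (col := fun _ => t) (fun _ => 𝟙 t) h .unit List.nodup_nil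
  rw [evalWord_unit, evalWord_unit] at e
  exact e.symm

theorem mult_unary (h : t ⟶ t') :
    A.mult t ≫ A.unary h = (A.unary h ⊗ₘ A.unary h) ≫ A.mult t' := by
  have hn : ([0, 1] : List (Fin 2)).Nodup := by decide
  have e := A.evalWord_comp (ι := Fin 2) (col := fun _ => t) (fun _ => 𝟙 t) h
    (.mul (.letter 0) (.letter 1)) hn
  rw [A.evalWord_mul_of (fun _ => 𝟙 t) (a := .letter 0) (b := .letter 1) hn (A.evalWord_id 0)
    (A.evalWord_id 1), A.evalWord_mul_of (fun _ => 𝟙 t ≫ h) (a := .letter 0) (b := .letter 1) hn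
    (A.evalWord_letter _ 0) (A.evalWord_letter _ 1), Category.id_comp] at e
  exact Eq.symm (e.trans (congrArg (· ≫ _)
    ((congrArg (· ≫ A.mult t) (id_tensorHom_id _ _)).trans (Category.id_comp _))))

/-- The right action of `σ⁻¹` takes `(σ, f)` to `(e, f σ⁻¹)`. Equivariance thus reduces every
operation to one with the identity permutation, preceded by a permutation of the arguments. -/
theorem op_cls {c : Profile C.carrier} (x : PermOp C.carrier t c) :
    A.op (C.cls x) = permFin (fun i => A.carrier (c.col i)) x.perm.symm ≫
      A.evalWord x.hom (permWord x.perm.symm) := by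
  refine (A.op_perm (C.cls x) x.perm.symm).symm.trans (congrArg (_ ≫ ·) ?_)
  have hx : PermOp.map (c.permHom x.perm.symm) x =
      PermOp.ordered (c := c.permute x.perm.symm) fun k => x.hom (x.perm.symm k) :=
    PermOp.ext (Equiv.symm_trans_self x.perm) (funext fun k => Category.id_comp _)
  refine (congrArg (fun y => A.op (C.cls y)) hx).trans ?_
  have hn : (seqWord x.perm.symm).letters.Nodup := by
    rw [letters_seqWord, List.nodup_ofFn]
    exact x.perm.symm.injective
  exact ((A.evalWord_eq x.hom hn (letters_seqWord _) (.id _)).trans (Category.id_comp _)).symm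

/-- Operations of the same class have the same action. Written out by `op_cls`, this compares the
evaluation of the letters in the order of `σ⁻¹` with that in the order of `τ⁻¹`. -/
theorem evalWord_eq_of_cls_eq {c : Profile C.carrier} {f : ∀ i, c.col i ⟶ t}
    {σ τ : Equiv.Perm (Fin c.len)} (h : C.cls ⟨σ, f⟩ = C.cls ⟨τ, f⟩) {a b : TensorWord (Fin c.len)}
    (ha : a.letters = List.ofFn σ.symm) (hb : b.letters = List.ofFn τ.symm)
    {φ : a.eval (fun i => A.carrier (c.col i)) ⟶ b.eval fun i => A.carrier (c.col i)}
    (hφ : Structural (fun i => A.carrier (c.col i)) a b φ) :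
    φ ≫ A.evalWord f b = A.evalWord f a := by
  let X : Fin c.len → M := fun i => A.carrier (c.col i)
  have hn : ∀ ρ : Equiv.Perm (Fin c.len), (List.ofFn ρ).Nodup :=
    fun ρ => List.nodup_ofFn.2 ρ.injective
  have hp : ∀ ρ : Equiv.Perm (Fin c.len), (permWord ρ).letters = List.ofFn ρ := fun ρ => letters_seqWord ρ
  have e := congrArg A.op h
  rw [op_cls, op_cls] at e
  dsimp only at e
  -- The equation of actions starts from the letters in their original order, so `a` is first
  -- brought to that order.
  let s := permWord (Equiv.refl (Fin c.len))
  have hs : a.letters.Perm s.letters := by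
    rw [ha, ← hp]
    exact permWord_perm _ _
  have h₁ := structural_canonIso (X := X) a s hs
  have hσ := (h₁.comp (structural_permFin X σ.symm))
  have hτ := (h₁.comp (structural_permFin X τ.symm))
  have h₂ := structural_canonIso (X := X) (permWord τ.symm) b (.of_eq ((hp _).trans hb.symm))
  have hna : a.letters.Nodup := ha ▸ hn _
  rw [← (hτ.comp h₂).unique hφ hna]
  refine (Category.assoc _ _ _).trans ?_
  rw [A.evalWord_structural f (hp _ ▸ hn _) ((hp _).trans hb.symm) h₂]
  refine (Category.assoc _ _ _).trans ((congrArg (_ ≫ ·) e.symm).trans ?_)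
  refine (Category.assoc _ _ _).symm.trans ?_
  exact A.evalWord_structural f hna (ha.trans (hp _).symm) hσ

/-- For an orthogonal pair, the binary operations with the identity and with the transposition are
related by one step of `∼⊥`. Their actions are the two orders of multiplication. -/
theorem unary_mult_of_orth {c₁ c₂ : C.carrier} (f₁ : c₁ ⟶ t) (f₂ : c₂ ⟶ t) (h : C.orth f₁ f₂) :
    (A.unary f₁ ⊗ₘ A.unary f₂) ≫ A.mult t =
      (A.unary f₁ ⊗ₘ A.unary f₂) ≫ (β_ _ _).hom ≫ A.mult t := by
  let c : Profile C.carrier := ⟨2, Fin.cons c₁ fun _ => c₂⟩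
  let f : ∀ i, c.col i ⟶ t := Fin.cons f₁ fun _ => f₂
  have e : C.cls ⟨Equiv.refl (Fin 2), f⟩ = C.cls ⟨Equiv.swap (0 : Fin 2) 1, f⟩ :=
    Quotient.sound (s := PermOp.setoid C t c)
      (Relation.ReflTransGen.single (PermOp.Step.swap (PermOp.mk (c := c) (Equiv.refl (Fin 2)) f)
        (0 : Fin 2) (1 : Fin 2) rfl h))
  have hn : ([0, 1] : List (Fin 2)).Nodup := by decide
  have hn' : ([1, 0] : List (Fin 2)).Nodup := by decide
  have h' := A.evalWord_eq_of_cls_eq e (a := .mul (.letter (0 : Fin 2)) (.letter (1 : Fin 2)))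
    (b := .mul (.letter (1 : Fin 2)) (.letter (0 : Fin 2)))
    (show [0, 1] = List.ofFn fun k : Fin 2 => k by simp)
    (show [1, 0] = List.ofFn fun k : Fin 2 => Equiv.swap (0 : Fin 2) 1 k by decide)
    (.braiding (.letter (0 : Fin 2)) (.letter (1 : Fin 2)))
  rw [A.evalWord_mul_of f (a := .letter (0 : Fin 2)) (b := .letter (1 : Fin 2)) hn
    (A.evalWord_letter f (0 : Fin 2)) (A.evalWord_letter f (1 : Fin 2)),
    A.evalWord_mul_of f (a := .letter (1 : Fin 2)) (b := .letter (0 : Fin 2)) hn'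
    (A.evalWord_letter f (1 : Fin 2)) (A.evalWord_letter f (0 : Fin 2))] at h'
  refine h'.symm.trans ?_
  refine (Category.assoc _ _ _).symm.trans (Eq.trans (congrArg (· ≫ _) ?_) (Category.assoc _ _ _))
  exact (BraidedCategory.braiding_naturality (A.unary f₁) (A.unary f₂)).symm

/-- The functor to monoids given by an algebra. -/
noncomputable def toFunctor : C.carrier ⥤ Mon M where
  obj t := { X := A.carrier t, mon := A.monObj t }
  map {t t'} f := letI := A.monObj t; letI := A.monObj t'
    { hom := A.unary f
      isMonHom_hom := { one_hom := A.unit_unary f, mul_hom := A.mult_unary f } }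
  map_id t := Mon.Hom.ext (A.unary_id t)
  map_comp f g := Mon.Hom.ext (A.unary_comp f g)

/-- The field theory given by an algebra. -/
noncomputable def toFieldTheory : FieldTheory M C where
  obj := A.toFunctor
  property _ _ _ f₁ f₂ h := A.unary_mult_of_orth f₁ f₂ h

/-- Unit, multiplication and unary operations generate all operations with identity permutation. An
algebra can therefore be recovered from its field theory. -/
theorem evalWord_eq_wordProd {ι : Type w} [DecidableEq ι] {col : ι → C.carrier}
    (f : ∀ i, col i ⟶ t) : (a : TensorWord ι) → a.letters.Nodup →
    letI := A.monObj t
    A.evalWord f a = wordProd (fun i => A.unary (f i)) a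
  | .unit, _ => A.evalWord_unit f
  | .letter i, _ => A.evalWord_letter f i
  | .mul a b, hn => by
    have hn' := List.nodup_append.1 hn
    rw [A.evalWord_mul f a b hn, evalWord_eq_wordProd f a hn'.1, evalWord_eq_wordProd f b hn'.2.1]
    rfl
  | .nary n a, hn => by
    let _ := A.monObj t
    -- The induction on the number of factors is kept apart from the recursion on words, which
    -- enters through the hypothesis on the single factors.
    have key : ∀ {n : ℕ} (a : Fin n → TensorWord ι), (TensorWord.nary n a).letters.Nodup →
        (∀ i, (a i).letters.Nodup → A.evalWord f (a i) = wordProd (fun i => A.unary (f i)) (a i)) →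
        A.evalWord f (.nary n a) = wordProd (fun i => A.unary (f i)) (.nary n a) := by
      intro n
      induction n with
      | zero =>
        intro a hn _
        rw [← A.evalWord_structural f (a := .nary 0 a) (b := .unit) List.nodup_nil rfl
          (.naryZero a), evalWord_unit]
        exact Category.id_comp _
      | succ n ih =>
        intro a hn h
        have hn' := List.nodup_append.1 hn
        rw [← A.evalWord_structural f (a := .nary (n + 1) a)
          (b := .mul (a 0) (.nary n fun i => a i.succ)) hn rfl (.narySucc a),
          A.evalWord_mul f (a 0) (.nary n fun i => a i.succ) hn, h 0 hn'.1, ih (fun i => a i.succ) hn'.2.1 fun i => h i.succ]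
        exact Category.id_comp _
    exact key a hn fun i hi => evalWord_eq_wordProd f (a i) hi

end Monoids

end OperadAlgebra

end AQFT

namespace AQFT

/-! ### Inversions and permutations of finite sequences -/

section Sequences

/-- `e.symm` lists the letters by increasing value of `e`. This translates the order of letters in a
word into inequalities between values of a permutation. -/
theorem lt_of_sublist_ofFn {ι : Type w} {n : ℕ} (e : ι ≃ Fin n) {i j : ι}
    (h : [i, j].Sublist (List.ofFn e.symm)) : e i < e j := by
  have hp : (List.ofFn e.symm).Pairwise fun i j => e i < e j := by
    rw [List.pairwise_ofFn]
    intro k l hkl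
    simpa using hkl
  exact List.pairwise_iff_forall_sublist.1 hp h

variable {M : Type u} [Category.{v} M] [MonoidalCategory M] [SymmetricCategory M] {ι : Type w}

theorem Structural.substitute {κ : Type*} {Y : κ → M} (s : ι → TensorWord κ) {n n' : ℕ}
    {p : Fin n → ι} {q : Fin n' → ι}
    {f : (seqWord p).eval (fun i => (s i).eval Y) ⟶ (seqWord q).eval fun i => (s i).eval Y}
    (h : Structural (fun i => (s i).eval Y) (seqWord p) (seqWord q) f) :
    Structural Y (.nary n fun k => s (p k)) (.nary n' fun k => s (q k)) f := by
  let φ : ∀ i, (s i).eval Y ≅ (s i).eval Y := fun i => Iso.refl _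
  have h' := h.bind φ
  have h₁ : (bindIso φ (seqWord p)).hom = 𝟙 _ := tensorFinMap_id fun k => (s (p k)).eval Y
  have h₂ : (bindIso φ (seqWord q)).inv = 𝟙 _ := tensorFinMap_id fun k => (s (q k)).eval Y
  rw [h₁, h₂] at h'
  exact h'.congr ((Category.id_comp _).trans (Category.comp_id _))

theorem permFin_refl {n : ℕ} (X : Fin n → M) : permFin X (Equiv.refl _) = 𝟙 (tensorFin X) := by
  refine (structural_permFin X (Equiv.refl _)).unique (.id _) ?_
  rw [show (permWord (Equiv.refl (Fin n))).letters = _ from letters_seqWord _, List.nodup_ofFn]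
  exact Function.injective_id

theorem permFin_naturality {n : ℕ} {X Y : Fin n → M} (f : ∀ i, X i ⟶ Y i)
    (σ : Equiv.Perm (Fin n)) :
    tensorFinMap f ≫ permFin Y σ = permFin X σ ≫ tensorFinMap fun i => f (σ i) :=
  wordMap_canon f (permWord (Equiv.refl _)) (permWord σ) (permWord_perm _ _)

end Sequences

namespace FieldTheory

/-! ### From `⊥`-commutative functors to algebras -/

section Operations

variable {M : Type u} [Category.{v} M] [MonoidalCategory M] [SymmetricCategory M]
  {C : OrthCat.{v}} (A : FieldTheory M C) {t : C.carrier} {c : Profile C.carrier}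

theorem commutes_of_orth {c₁ c₂ : C.carrier} {f₁ : c₁ ⟶ t} {f₂ : c₂ ⟶ t} (h : C.orth f₁ f₂) :
    Commutes (A.obj.map f₁).hom (A.obj.map f₂).hom :=
  (A.property f₁ f₂ h).trans (BraidedCategory.braiding_naturality_assoc _ _ _)

/-- The operation on a field theory given by a permutation and a sequence of morphisms. -/
def opRep (x : PermOp C.carrier t c) :
    tensorFin (fun i => (A.obj.obj (c.col i)).X) ⟶ (A.obj.obj t).X :=
  permFin (fun i => (A.obj.obj (c.col i)).X) x.perm.symm ≫
    prodFin fun k => (A.obj.map (x.hom (x.perm.symm k))).hom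

/-- The images of orthogonal morphisms commute, so the product may be taken along any word whose
order differs from that of `x` only in orthogonal pairs. Independence of representatives and
equivariance are both obtained by a choice of `b`. -/
theorem opRep_eq (x : PermOp C.carrier t c) {b : TensorWord (Fin c.len)}
    {φ : (permWord (Equiv.refl _)).eval (fun i => (A.obj.obj (c.col i)).X) ⟶
      b.eval fun i => (A.obj.obj (c.col i)).X}
    (hφ : Structural (fun i => (A.obj.obj (c.col i)).X) (permWord (Equiv.refl _)) b φ)
    (h : ∀ i j, [i, j].Sublist b.letters → x.perm j < x.perm i → C.orth (x.hom i) (x.hom j)) :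
    A.opRep x = φ ≫ wordProd (fun i => (A.obj.map (x.hom i)).hom) b := by
  refine Structural.wordProd_eq (fun i => (A.obj.map (x.hom i)).hom)
    (structural_permFin _ x.perm.symm) hφ ?_ fun i j _ h₁ h₂ => ?_
  · rw [show (permWord (Equiv.refl (Fin c.len))).letters = _ from letters_seqWord _,
      List.nodup_ofFn]
    exact Function.injective_id
  · rw [show (permWord x.perm.symm).letters = _ from letters_seqWord _] at h₁
    exact (A.commutes_of_orth (h j i h₂ (lt_of_sublist_ofFn x.perm h₁))).symm

/-- By `PermOp.rel_iff`, every pair on whose order the two permutations disagree is orthogonal, so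
the second order is an admissible one for `x`. -/
theorem opRep_eq_of_rel {x y : PermOp C.carrier t c} (h : PermOp.Rel C x y) :
    A.opRep x = A.opRep y := by
  obtain ⟨e, h'⟩ := PermOp.rel_iff.1 h
  obtain ⟨σ, f⟩ := x
  obtain ⟨τ, g⟩ := y
  dsimp only at e h'
  subst e
  refine A.opRep_eq _ (structural_permFin _ τ.symm) fun i j h₁ h₂ => ?_
  rw [show (permWord τ.symm).letters = _ from letters_seqWord _] at h₁
  exact C.symm _ _ (h' j i h₂ (lt_of_sublist_ofFn τ h₁))

/-- After undoing the permutation of the arguments, both sides multiply in the same order. No pair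
is inverted, and orthogonality is not called upon. -/
theorem opRep_map (x : PermOp C.carrier t c) (σ : Equiv.Perm (Fin c.len)) :
    permFin (fun i => (A.obj.obj (c.col i)).X) σ ≫ A.opRep (PermOp.map (c.permHom σ) x) =
      A.opRep x := by
  let X : Fin c.len → M := fun i => (A.obj.obj (c.col i)).X
  let τ : Equiv.Perm (Fin c.len) := (PermOp.map (c.permHom σ) x).perm
  have hτ := (structural_permFin (fun k => X (σ k)) τ.symm).substitute (Y := X)
    fun k => .letter (σ k)
  have h := A.opRep_eq x ((structural_permFin X σ).comp hτ) fun i j h₁ h₂ => ?_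
  · refine Eq.trans ?_ h.symm
    refine Eq.trans (congrArg (_ ≫ ·) (congrArg (_ ≫ ·) ?_)) (Category.assoc _ _ _).symm
    exact congrArg prodFin (funext fun k => congrArg (fun f => (A.obj.map f).hom)
      (Category.id_comp _))
  -- Up to the identification of lengths, `τ` is `x.perm` after `σ`. Hence `σ (τ.symm k)` runs
  -- through the letters in the order of `x.perm`.
  · refine absurd h₂ (lt_asymm ?_)
    have e : (TensorWord.nary c.len fun k => .letter (σ (τ.symm k))).letters =
        List.ofFn (τ.symm.trans σ) := letters_seqWord _
    rw [e] at h₁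
    have h₃ := (PermOp.map_lt (c.permHom σ) x _ _).1 (lt_of_sublist_ofFn (σ.symm.trans τ) h₁)
    simpa [Profile.permHom] using h₃

theorem opRep_one (t : C.carrier) : A.opRep (PermOp.one t) = (ρ_ (A.obj.obj t).X).hom := by
  refine (congrArg (· ≫ _) (permFin_refl _)).trans ((Category.id_comp _).trans ?_)
  refine (tensor_one_mul (A.obj.map (𝟙 t)).hom).trans ?_
  rw [A.obj.map_id]
  exact Category.comp_id _

/-- Both sides multiply in the same order: the blocks in the order of `x.perm`, and the entries of
each block in the order of its own permutation, as `PermOp.comp_lt` says. Thus no commutativity is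
needed. Functoriality and multiplicativity of the outer maps then carry them into the inner
products. -/
theorem opRep_comp {a : Profile C.carrier} {b : Fin a.len → Profile C.carrier}
    (x : PermOp C.carrier t a) (y : ∀ i, PermOp C.carrier (a.col i) (b i)) :
    A.opRep (PermOp.comp x y) =
      regroup (Profile.split b) (fun i j => (A.obj.obj ((b i).col j)).X) ≫
        tensorFinMap (fun i => A.opRep (y i)) ≫ A.opRep x := by
  let Y : ((i : Fin a.len) × Fin (b i).len) → M := fun z => (A.obj.obj ((b z.1).col z.2)).X
  let g : ∀ z, Y z ⟶ (A.obj.obj t).X := fun z => (A.obj.map ((y z.1).hom z.2 ≫ x.hom z.1)).hom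
  let s : Fin a.len → TensorWord ((i : Fin a.len) × Fin (b i).len) :=
    fun i => .nary (b i).len fun j => .letter ⟨i, j⟩
  let s' : Fin a.len → TensorWord ((i : Fin a.len) × Fin (b i).len) :=
    fun i => .nary (b i).len fun j => .letter ⟨i, (y i).perm.symm j⟩
  let ρ := (PermOp.comp x y).perm
  let p : ∀ i, (s i).eval Y ⟶ (s' i).eval Y :=
    fun i => permFin (fun j => Y ⟨i, j⟩) (y i).perm.symm
  have hp : ∀ i, Structural Y (s i) (s' i) (p i) := fun i =>
    (structural_permFin (fun j => Y ⟨i, j⟩) (y i).perm.symm).substitute (Y := Y)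
      fun j => .letter (⟨i, j⟩ : (i : Fin a.len) × Fin (b i).len)
  have h₁ := (structural_permFin (fun k => Y (Profile.split b k)) ρ.symm).substitute (Y := Y)
    fun k => .letter (Profile.split b k)
  have h₂ := ((structural_regroup (Profile.split b) Y).comp
    ((structural_permFin (fun i => (s i).eval Y) x.perm.symm).substitute (Y := Y) s)).comp
    (Structural.nary fun k => hp (x.perm.symm k))
  have hl₁ : (TensorWord.nary (Profile.concat b).len fun k =>
      .letter (Profile.split b (ρ.symm k))).letters =
        List.ofFn (ρ.symm.trans (Profile.split b)) := letters_seqWord _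
  have hlt := fun z w : (i : Fin a.len) × Fin (b i).len =>
    PermOp.comp_lt x y ((Profile.split b).apply_symm_apply z)
      ((Profile.split b).apply_symm_apply w)
  -- The iterated product lists its letters by increasing value of the composed permutation, so it
  -- has no inversion against the flat product.
  have hl₂ : (TensorWord.nary a.len fun k => s' (x.perm.symm k)).letters.Pairwise
      fun z w => ρ ((Profile.split b).symm z) < ρ ((Profile.split b).symm w) := by
    have hs' : ∀ i, (s' i).letters = List.ofFn fun j => ⟨i, (y i).perm.symm j⟩ :=
      fun i => letters_seqWord _
    refine pairwise_concatLists _ (fun k => ?_) fun k l hkl z hz w hw => (hlt z w).2 (Or.inl ?_)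
    · rw [hs', List.pairwise_ofFn]
      exact fun i j hij => (hlt _ _).2 (Or.inr ⟨rfl, by simpa using hij⟩)
    · rw [hs', List.mem_ofFn'] at hz hw
      obtain ⟨z, rfl⟩ := hz
      obtain ⟨w, rfl⟩ := hw
      simpa using hkl
  have hn : (TensorWord.nary (Profile.concat b).len fun k =>
      .letter (Profile.split b k)).letters.Nodup := by
    have e : (TensorWord.nary (Profile.concat b).len fun k =>
        .letter (Profile.split b k)).letters = List.ofFn (Profile.split b) := letters_seqWord _
    rw [e, List.nodup_ofFn]
    exact (Profile.split b).injective
  have key := Structural.wordProd_eq g h₁ h₂ hn fun z w _ hz hw => by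
    rw [hl₁] at hz
    exact absurd (lt_of_sublist_ofFn ((Profile.split b).symm.trans ρ) hz)
      (lt_asymm (List.pairwise_iff_forall_sublist.1 hl₂ hw))
  refine key.trans ?_
  refine (Category.assoc _ _ _).trans ((Category.assoc _ _ _).trans (congrArg (_ ≫ ·) ?_))
  -- Naturality of permutations moves the outer reordering past the inner operations, so that the
  -- two sides can be compared block by block.
  refine Eq.trans ?_ ((congrArg (· ≫ _) (permFin_naturality (fun i => A.opRep (y i))
    x.perm.symm).symm).trans (Category.assoc _ _ _))
  refine Eq.trans (congrArg (_ ≫ ·) ?_) (Category.assoc _ _ _).symm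
  refine (tensorFinMap_prodFin _ _).trans (Eq.trans ?_ (tensorFinMap_prodFin _ _).symm)
  refine congrArg prodFin (funext fun k => Eq.trans (congrArg (_ ≫ ·) ?_)
    (Category.assoc _ _ _).symm)
  -- The outer map of the block is a homomorphism of monoids and so passes inside the inner product.
  -- There, functoriality composes it with the inner maps.
  refine Eq.trans ?_ (wordProd_comp (A.obj.map (x.hom (x.perm.symm k))).hom
    (fun j => (A.obj.map ((y (x.perm.symm k)).hom j)).hom)
    (permWord (y (x.perm.symm k)).perm.symm)).symm
  exact congrArg prodFin (funext fun j => congrArg Mon.Hom.hom (A.obj.map_comp _ _))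

theorem opRep_hom {A B : FieldTheory M C} (f : A ⟶ B) (x : PermOp C.carrier t c) :
    A.opRep x ≫ (f.hom.app t).hom =
      tensorFinMap (fun i => (f.hom.app (c.col i)).hom) ≫ B.opRep x := by
  refine Eq.trans ?_ (Category.assoc _ _ _)
  refine Eq.trans ?_ (congrArg (· ≫ _) (permFin_naturality
    (fun i => (f.hom.app (c.col i)).hom) x.perm.symm).symm)
  refine (Category.assoc _ _ _).trans (Eq.trans (congrArg (_ ≫ ·) ?_) (Category.assoc _ _ _).symm)
  refine (wordProd_comp (f.hom.app t).hom (fun i => (A.obj.map (x.hom i)).hom)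
    (permWord x.perm.symm)).trans (Eq.trans ?_ (tensorFinMap_prodFin _ _).symm)
  exact congrArg prodFin (funext fun i => congrArg Mon.Hom.hom (f.hom.naturality _))

end Operations

section Algebra

variable {M : Type u} [Category.{v} M] [MonoidalCategory M] [SymmetricCategory M]
  [MonoidalClosed M] [HasColimits M] {C : OrthCat.{v}} (A : FieldTheory M C)

/-- The action of an operation of the operad of an orthogonal category on a field theory. -/
def op {t : C.carrier} {c : Profile C.carrier} :
    C.setOperad.obj t c → (tensorFin (fun i => (A.obj.obj (c.col i)).X) ⟶ (A.obj.obj t).X) :=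
  Quotient.lift (s := PermOp.setoid C t c) A.opRep fun _ _ h => A.opRep_eq_of_rel h

/-- The algebra given by a field theory. -/
noncomputable def toAlgebra : OperadAlgebra (C.setOperad.baseChange M) :=
  OperadAlgebra.ofOp (fun t => (A.obj.obj t).X) A.op
    (fun x σ => by
      obtain ⟨x, rfl⟩ := C.congruence.exists_rep x
      exact A.opRep_map x σ)
    (fun x y => by
      obtain ⟨x, rfl⟩ := C.congruence.exists_rep x
      obtain ⟨y, rfl⟩ := C.congruence.exists_reps y
      exact (congrArg A.op (C.cls_comp x y)).trans (A.opRep_comp x y))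
    A.opRep_one

end Algebra

end FieldTheory

end AQFT

namespace AQFT

/-! ### Strict equality of monoids and field theories -/

section Extensionality

variable {M : Type u} [Category.{v} M] [MonoidalCategory M]

/-- The unit of a monoid is determined by its multiplication, so units need not be compared. -/
theorem mon_ext {A B : Mon M} (h : A.X = B.X)
    (h' : HEq (MonObj.mul (X := A.X)) (MonObj.mul (X := B.X))) : A = B := by
  obtain ⟨A⟩ := A
  obtain ⟨B⟩ := B
  dsimp only at h
  subst h
  exact congrArg (fun m : MonObj A => (Mon.mk A (mon := m))) (MonObj.ext _ _ (eq_of_heq h'))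

theorem mon_hom_heq {A A' B B' : Mon M} (hA : A = A') (hB : B = B') {f : A ⟶ B} {f' : A' ⟶ B'}
    (h : HEq f.hom f'.hom) : HEq f f' := by
  subst hA hB
  exact heq_of_eq (Mon.Hom.ext (eq_of_heq h))

variable [SymmetricCategory M] {C : OrthCat.{v}}

theorem FieldTheory.ext_of_mul {A B : FieldTheory M C}
    (h : ∀ t, (A.obj.obj t).X = (B.obj.obj t).X)
    (hm : ∀ t, HEq (MonObj.mul (X := (A.obj.obj t).X)) (MonObj.mul (X := (B.obj.obj t).X)))
    (hf : ∀ {t t'} (f : t ⟶ t'), HEq (A.obj.map f).hom (B.obj.map f).hom) : A = B := by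
  obtain ⟨A, hA⟩ := A
  obtain ⟨B, hB⟩ := B
  have e : ∀ t, A.obj t = B.obj t := fun t => mon_ext (h t) (hm t)
  obtain rfl : A = B :=
    CategoryTheory.Functor.hext e fun t t' f => mon_hom_heq (e t) (e t') (hf f)
  rfl

theorem FieldTheory.hom_heq {A A' B B' : FieldTheory M C} (hA : A = A') (hB : B = B') {f : A ⟶ B}
    {f' : A' ⟶ B'} (h : ∀ t, HEq (f.hom.app t).hom (f'.hom.app t).hom) : HEq f f' := by
  subst hA hB
  exact heq_of_eq (ObjectProperty.hom_ext _ (NatTrans.ext (funext fun t =>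
    Mon.Hom.ext (eq_of_heq (h t)))))

end Extensionality

/-! ### The two constructions are inverse and natural -/

section Comparison

variable {M : Type u} [Category.{v} M] [MonoidalCategory M] [SymmetricCategory M]
  [MonoidalClosed M] [HasColimits M] {C D : OrthCat.{v}}

theorem FieldTheory.op_toAlgebra (A : FieldTheory M C) {t : C.carrier} {c : Profile C.carrier}
    (x : C.setOperad.obj t c) : A.toAlgebra.op x = A.op x :=
  atPt_copowerTensorDesc _ _

/-- The carriers are literally the same. The operations that define multiplication and functoriality
have identity permutation, so they act as the products of `A`, with an extra unit factor that the
monoid laws remove. -/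
theorem FieldTheory.toFieldTheory_toAlgebra (A : FieldTheory M C) :
    A.toAlgebra.toFieldTheory = A := by
  refine FieldTheory.ext_of_mul (fun _ => rfl) (fun t => heq_of_eq ?_) fun {t t'} f => heq_of_eq ?_
  · let X := (A.obj.obj t).X
    refine (congrArg (X ◁ (ρ_ X).inv ≫ ·) ((A.op_toAlgebra _).trans
      ((congrArg (· ≫ _) (permFin_refl _)).trans (Category.id_comp _)))).trans ?_
    exact whiskerLeft_rightUnitor_inv_mul (A.obj.map_id t)
  · let X := (A.obj.obj t).X
    refine (congrArg ((ρ_ X).inv ≫ ·) ((A.op_toAlgebra _).trans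
      ((congrArg (· ≫ _) (permFin_refl _)).trans (Category.id_comp _)))).trans ?_
    exact (congrArg ((ρ_ X).inv ≫ ·) (tensor_one_mul (A.obj.map f).hom)).trans
      (Iso.inv_hom_id_assoc _ _)
where
  whiskerLeft_rightUnitor_inv_mul {B : Mon M} {f : B ⟶ B} (h : f = 𝟙 B) :
      B.X ◁ (ρ_ B.X).inv ≫ (f.hom ⊗ₘ ((f.hom ⊗ₘ MonObj.one (X := B.X)) ≫ MonObj.mul (X := B.X))) ≫
        MonObj.mul (X := B.X) = MonObj.mul (X := B.X) := by
    subst h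
    rw [tensor_one_mul]
    simp

/-- Every operation is a permutation of the arguments followed by an operation with identity
permutation, and the latter is a product in the associated monoid. This is also how the field theory
makes it act. -/
theorem OperadAlgebra.toAlgebra_toFieldTheory (A : OperadAlgebra (C.setOperad.baseChange M)) :
    A.toFieldTheory.toAlgebra = A := by
  refine OperadAlgebra.ext_of_op rfl fun {t c} x => heq_of_eq ?_
  obtain ⟨x, rfl⟩ := C.congruence.exists_rep x
  refine (A.toFieldTheory.op_toAlgebra _).trans (Eq.trans ?_ (A.op_cls x).symm)
  refine congrArg (_ ≫ ·) (A.evalWord_eq_wordProd x.hom (permWord x.perm.symm) ?_).symm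
  rw [show (permWord x.perm.symm).letters = _ from letters_seqWord _, List.nodup_ofFn]
  exact x.perm.symm.injective

theorem OperadAlgebra.unit_app {A B : OperadAlgebra (C.setOperad.baseChange M)} (f : A ⟶ B)
    (t : C.carrier) : A.unit t ≫ Hom.app f t = B.unit t :=
  (op_hom f _).trans (Category.id_comp _)

theorem OperadAlgebra.mult_app {A B : OperadAlgebra (C.setOperad.baseChange M)} (f : A ⟶ B)
    (t : C.carrier) : A.mult t ≫ Hom.app f t = (Hom.app f t ⊗ₘ Hom.app f t) ≫ B.mult t :=
  (Category.assoc _ _ _).trans ((congrArg (A.carrier t ◁ (ρ_ (A.carrier t)).inv ≫ ·)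
    (op_hom f _)).trans (whiskerLeft_rightUnitor_inv_tensor_comp _ _ _))

theorem OperadAlgebra.unary_app {A B : OperadAlgebra (C.setOperad.baseChange M)} (f : A ⟶ B)
    {t t' : C.carrier} (h : t ⟶ t') : A.unary h ≫ Hom.app f t' = Hom.app f t ≫ B.unary h :=
  (Category.assoc _ _ _).trans ((congrArg ((ρ_ (A.carrier t)).inv ≫ ·) (op_hom f _)).trans
    (rightUnitor_inv_tensor_comp _ _))

variable (M)

/-- The functor from algebras over the operad of an orthogonal category to field theories. -/
noncomputable def OrthCat.toFieldTheories (C : OrthCat.{v}) :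
    OperadAlgebra (C.setOperad.baseChange M) ⥤ FieldTheory M C where
  obj A := A.toFieldTheory
  map {A B} f := ObjectProperty.homMk
    { app t := letI := A.monObj t; letI := B.monObj t
        { hom := OperadAlgebra.Hom.app f t
          isMonHom_hom := { one_hom := OperadAlgebra.unit_app f t
                            mul_hom := OperadAlgebra.mult_app f t } }
      naturality _ _ h := Mon.Hom.ext (OperadAlgebra.unary_app f h) }

/-- The functor from field theories to algebras over the operad of an orthogonal category. -/
noncomputable def OrthCat.toAlgebras (C : OrthCat.{v}) :
    FieldTheory M C ⥤ OperadAlgebra (C.setOperad.baseChange M) where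
  obj A := A.toAlgebra
  map {A B} f := OperadAlgebra.homOfOp (A := A.toAlgebra) (B := B.toAlgebra)
    (fun t => (f.hom.app t).hom) fun x => by
      rw [A.op_toAlgebra, B.op_toAlgebra]
      obtain ⟨x, rfl⟩ := C.congruence.exists_rep x
      exact FieldTheory.opRep_hom f x

/-- The isomorphism between the category of algebras over the operad of an orthogonal category and
the category of field theories. -/
noncomputable def OrthCat.algebraIso (C : OrthCat.{v}) :
    Cat.of (OperadAlgebra (C.setOperad.baseChange M)) ≅ Cat.of (FieldTheory M C) where
  hom := (C.toFieldTheories M).toCatHom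
  inv := (C.toAlgebras M).toCatHom
  -- The composites fix objects on the nose and keep the components of morphisms, so they equal the
  -- identity functors and are not merely isomorphic to them.
  hom_inv_id := Cat.Hom.ext (CategoryTheory.Functor.hext
    (fun A => A.toAlgebra_toFieldTheory) fun A B _ =>
      OperadAlgebra.hom_heq A.toAlgebra_toFieldTheory B.toAlgebra_toFieldTheory _ _
        fun _ => HEq.rfl)
  inv_hom_id := Cat.Hom.ext (CategoryTheory.Functor.hext
    (fun A => A.toFieldTheory_toAlgebra) fun A B _ =>
      FieldTheory.hom_heq A.toFieldTheory_toAlgebra B.toFieldTheory_toAlgebra fun _ => HEq.rfl)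

theorem OperadAlgebra.op_pullback (F : C ⟶ D) (A : OperadAlgebra (D.setOperad.baseChange M))
    {t : C.carrier} {c : Profile C.carrier} (x : C.setOperad.obj t c) :
    OperadAlgebra.op (O := C.setOperad) (OpCat.pullbackObj (O := C.operad M) (P := D.operad M)
        ((OrthCat.setOperadHom F).baseChange M) A) x = A.op ((OrthCat.setOperadHom F).app x) :=
  (atPt_whiskerRight _ _ _).trans (congrArg (fun q => atPt q _)
    ((OrthCat.setOperadHom F).pt_baseChange M x))

/-- The operations which define the field theory are sent by `F` to operations of the same kind. For
the multiplication this uses that `F` preserves identities. -/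
theorem OperadAlgebra.toFieldTheory_pullback (F : C ⟶ D)
    (A : OperadAlgebra (D.setOperad.baseChange M)) :
    OperadAlgebra.toFieldTheory (C := C) (OpCat.pullbackObj (O := C.operad M) (P := D.operad M)
        ((OrthCat.setOperadHom F).baseChange M) A) =
      (FieldTheory.pullback M F).obj A.toFieldTheory := by
  refine FieldTheory.ext_of_mul (fun _ => rfl) (fun t => heq_of_eq ?_) fun {t t'} f => heq_of_eq ?_
  · refine congrArg (_ ≫ ·) ((A.op_pullback M F _).trans ?_)
    exact congrArg (fun f => A.op (a := ⟨2, fun _ => F.functor.obj t⟩) (D.cls (PermOp.ordered f)))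
      (funext fun _ => F.functor.map_id t)
  · exact congrArg (_ ≫ ·) (A.op_pullback M F _)

theorem OrthCat.pullback_toFieldTheories (F : C ⟶ D) :
    OpCat.pullback (O := C.operad M) (P := D.operad M) ((OrthCat.setOperadHom F).baseChange M) ⋙
        C.toFieldTheories M =
      D.toFieldTheories M ⋙ FieldTheory.pullback M F :=
  CategoryTheory.Functor.hext (fun A => A.toFieldTheory_pullback M F) fun A B _ =>
    FieldTheory.hom_heq (A.toFieldTheory_pullback M F) (B.toFieldTheory_pullback M F)
      fun _ => HEq.rfl

end Comparison

end AQFT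

theorem theorem4p18 (M : Type u) [Category.{v} M] [MonoidalCategory M] [SymmetricCategory M]
    [MonoidalClosed M] [HasLimits M] [HasColimits M] :
    Nonempty (AQFT.algebraFunctor.{v, u} M ≅ AQFT.fieldTheoryFunctor.{v, u} M) :=
  ⟨NatIso.ofComponents (fun C => C.unop.algebraIso M)
    -- In `Cat` naturality is an equality of functors, so it expresses the strict compatibility of
    -- the isomorphisms with pullback and precomposition.
    fun F => Cat.Hom.ext (AQFT.OrthCat.pullback_toFieldTheories M F.unop)⟩
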